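/- **Theorem A.** Let $\gamma:(0,\infty)\to\mathbb R$ be differentiable and suppose that there are constants $C,c>0$ such that for all $r>0$ $$\gamma(r)\le C\,(r^{-1}+r^{-2}),\qquad \gamma'(r)\le 0,\qquad r\,|\gamma'(r)|\le C\,\gamma(r),\qquad \gamma(r)\ge c\,\min\{r^{-2},r^{-1}\}.$$ Let $\Gamma$ be the Fourier multiplier on $\mathbb R^3$ with symbol $\gamma(|\xi|)$, where $\nabla\times\Gamma[B]$ denotes the field with Fourier transform $i\xi\times\gamma(|\xi|)\hat B(\xi)$ (Fourier variable normalized so that $\nabla$ has symbol $i\xi$). Consider, for $B(t,\cdot):\mathbb R^3\to\mathbb R^3$, the system $$\partial_t B+\nabla\times\big((\nabla\times\Gamma[B])\times B\big)=0,\qquad \nabla\cdot B=0, \tag{1}$$ with spatial derivatives understood in the sense of distributions. Let $s>5/2$, and write $\|f\|_{\mathcal Y^1}=\int_{\mathbb R^3}(1+|\xi|)\,|\hat f(\xi)|\,d\xi$. (i) (Local well-posedness.) For every divergence-free $B_0\in H^s(\mathbb R^3)$ there exist $T>0$ and a solution $B\in C([0,T];H^s(\mathbb R^3))$ of (1) with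 $B(0)=B_0$. Solutions are unique: for every $T>0$, any two solutions of (1) in $C([0,T];H^s(\mathbb R^3))$ with initial value $B_0$ coincide on $[0,T]$. (ii) (Blow-up criterion.) Let $0<T<\infty$ and let $B\in C([0,T);H^s(\mathbb R^3))$ be a solution of (1) on $[0,T)$. Then $$\limsup_{t\to T^-}\|B(t)\|_{H^s}=+\infty\quad\Longleftrightarrow\quad\int_0^T\|B(t)\|_{\mathcal Y^1}\,dt=+\infty .$$ Moreover, $B$ can be continued past $T$, i.e. there are $T'>T$ and a solution in $C([0,T'];H^s(\mathbb R^3))$ of (1) that coincides with $B$ on $[0,T)$, if and only if $\int_0^T\|B(t)\|_{\mathcal Y^1}\,dt<\infty$. -/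

import Mathlib

open MeasureTheory Filter Set
open scoped Topology ENNReal FourierTransform ContDiff

namespace ActiveVector

/-- Three-dimensional Euclidean space. -/
abbrev E3 : Type := EuclideanSpace ℝ (Fin 3)

/-- Three-dimensional complex Euclidean space. -/
abbrev C3 : Type := EuclideanSpace ℂ (Fin 3)

/-- Real square-integrable vector fields on `ℝ³`. -/
abbrev L2 : Type := Lp E3 2 (volume : Measure E3)

/-- The inclusion `ℝ³ → ℂ³`. -/
noncomputable def toC3 : E3 →L[ℝ] C3 :=
  LinearMap.toContinuousLinearMap
    { toFun := fun v => WithLp.toLp 2 fun i => (v i : ℂ)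
      map_add' := fun v w => by ext i; simp
      map_smul' := fun c v => by ext i; simp }

/-- The Fourier transform on `L²`, in the normalization `𝓕 f(ξ) = ∫ exp(-2πi x·ξ) f(x) dx`,
so that `ξ` here corresponds to the angular frequency `2πξ`. -/
noncomputable def fourierL2 (f : L2) : Lp C3 2 (volume : Measure E3) :=
  𝓕 (toC3.compLp f)

/-- The norm of `H^s(ℝ³; ℝ³)`, with value `∞` when the field is not in `H^s`.
It is `(∫ (1 + |ζ|²)^s |f̂(ζ)|² dζ)^(1/2)` in terms of the angular frequency `ζ = 2πξ`
(with the unitary normalization of `f̂`). -/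
noncomputable def sobolevNorm (s : ℝ) (f : L2) : ℝ≥0∞ :=
  (∫⁻ ξ : E3, ENNReal.ofReal ((1 + (2 * Real.pi * ‖ξ‖) ^ 2) ^ s) * ‖fourierL2 f ξ‖ₑ ^ 2) ^
    (1 / 2 : ℝ)

/-- The norm `∫ (1 + |ζ|) |f̂(ζ)| dζ` of the space `𝒴¹`, with value `∞` when the field is not in
`𝒴¹`; again `ζ = 2πξ` is the angular frequency. -/
noncomputable def yNorm (f : L2) : ℝ≥0∞ :=
  ∫⁻ ξ : E3, ENNReal.ofReal (1 + 2 * Real.pi * ‖ξ‖) * ‖fourierL2 f ξ‖ₑ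

/-- The assumptions on the radial symbol `γ = γ(|ζ|)` of the multiplier `Γ`. Nothing is said
about `γ` at or below zero, and nothing depends on it. -/
structure AdmissibleSymbol (γ : ℝ → ℝ) : Prop where
  differentiableAt : ∀ r : ℝ, 0 < r → DifferentiableAt ℝ γ r
  upper : ∃ C : ℝ, 0 < C ∧ ∀ r : ℝ, 0 < r → γ r ≤ C * (r⁻¹ + (r ^ 2)⁻¹)
  deriv_nonpos : ∀ r : ℝ, 0 < r → deriv γ r ≤ 0
  deriv_bound : ∃ C : ℝ, 0 < C ∧ ∀ r : ℝ, 0 < r → r * |deriv γ r| ≤ C * γ r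
  lower : ∃ c : ℝ, 0 < c ∧ ∀ r : ℝ, 0 < r → c * min (r ^ 2)⁻¹ r⁻¹ ≤ γ r

/-- The cross product. -/
def cross {R : Type*} [CommRing R] (v w : EuclideanSpace R (Fin 3)) : EuclideanSpace R (Fin 3) :=
  WithLp.toLp 2 (crossProduct v.ofLp w.ofLp)

/-- The partial derivative `∂ᵢ φⱼ` of a vector field. -/
noncomputable def partialDeriv (φ : E3 → E3) (i j : Fin 3) (x : E3) : ℝ :=
  (fderiv ℝ φ x (EuclideanSpace.single i 1)) j

/-- The curl of a differentiable vector field. -/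
noncomputable def curl (φ : E3 → E3) (x : E3) : E3 :=
  !₂[partialDeriv φ 1 2 x - partialDeriv φ 2 1 x,
     partialDeriv φ 2 0 x - partialDeriv φ 0 2 x,
     partialDeriv φ 0 1 x - partialDeriv φ 1 0 x]

/-- The Fourier transform `i ζ × γ(|ζ|) f̂(ζ)`, `ζ = 2πξ`, of `∇ × Γ[f]`. -/
noncomputable def curlGammaHat (γ : ℝ → ℝ) (f : L2) (ξ : E3) : C3 :=
  (2 * Real.pi * Complex.I * (γ (2 * Real.pi * ‖ξ‖) : ℂ)) • cross (toC3 ξ) (fourierL2 f ξ)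

/-- The field `∇ × Γ[f]`, by Fourier inversion. For `f ∈ H^s`, `s > 5/2`, and admissible `γ` the
Fourier transform `curlGammaHat γ f` is integrable (although that of `Γ[f]` need not be), and the
inverse transform is real, because `f` is real and `γ` is radial and real. -/
noncomputable def curlGamma (γ : ℝ → ℝ) (f : L2) (x : E3) : E3 :=
  WithLp.toLp 2 fun i => (𝓕⁻ (curlGammaHat γ f) x i).re

/-- `∇ · f = 0` in the sense of distributions. -/
def DivFree (f : L2) : Prop :=
  ∀ φ : E3 → ℝ, ContDiff ℝ ∞ φ → HasCompactSupport φ → (∫ x, fderiv ℝ φ x (f x)) = 0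

/-- `B ∈ C(I; H^s)` is a solution of `∂ₜB + ∇ × ((∇ × Γ[B]) × B) = 0`, `∇ · B = 0`
on the time interval `I`, the spatial derivatives in the sense of distributions. -/
structure IsSolutionOn (γ : ℝ → ℝ) (s : ℝ) (I : Set ℝ) (B : ℝ → L2) : Prop where
  memHs : ∀ t ∈ I, sobolevNorm s (B t) < ⊤
  continuousHs : ∀ t ∈ I, Tendsto (fun τ => sobolevNorm s (B τ - B t)) (𝓝[I] t) (𝓝 0)
  divFree : ∀ t ∈ I, DivFree (B t)
  equation : ∀ φ : E3 → E3, ContDiff ℝ ∞ φ → HasCompactSupport φ → ∀ t ∈ I,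
    HasDerivWithinAt (fun τ => ∫ x, inner ℝ (B τ x) (φ x))
      (-∫ x, inner ℝ (cross (curlGamma γ (B t) x) (B t x)) (curl φ x)) I t

end ActiveVector

open ActiveVector

/-! Write `b` for the Fourier transform of `B` and `u = ∇ × Γ[B]`. For divergence-free fields the
nonlinearity is a transport term `u·∇B` minus a stretching term `B·∇u`, and each seems to lose one
derivative. In the pairing of the nonlinearity with `W b`, for a weight `W` on the Fourier side,
neither does: transport by a divergence-free field is skew, and stretching is skew up to commutators
because `∇ × Γ` is moreover self-adjoint. Concretely, the double integral over `(ξ, η)` is averaged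
with the conjugate of its reflection, and only the differences `W(ξ) - W(η)` and `W(ξ) sym(η) - W(η)
sym(ξ)` survive.

If `|ξ - η| ≤ |η|/2`, the bounds on `γ` and `γ'` trade the factor `|η|` for `1 + |ξ - η|`. Otherwise
`|ξ - η|` dominates `|ξ|` and `|η|` up to a constant, and the weight moves to the third factor. In
both cases the derivative lands on a factor measured in `L¹`, which gives `|d/dt ∫ W|b|²| ≤ C
‖B‖_{𝒴¹} ∫ W|b|²` (`exists_energy_bound`), where `C` depends on `W` only through its doubling and
slow-variation constant. The weights `min((1+|ζ|²)^s, n+1)` share such a constant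
(`exists_weightBound`). They are bounded, so their energies are differentiable along any `C¹` path
in `L²`, and `n → ∞` recovers the `H^s` norm. Grönwall's inequality then bounds the `H^s` norm by
the exponential of `∫ ‖B‖_{𝒴¹}` (`exists_hn_sq_le_exp`), which is the essential half of the blow-up
criterion; the other half is the embedding of `H^s` in `𝒴¹` for `s > 5/2`.

At low frequencies the symbol of `∇ × Γ` may grow like `|ζ|⁻¹`. This is square-integrable near the
origin of `ℝ³`, so the transform of `u` is still integrable (`exists_vn_le`), and the nonlinearity
lies in `L²` with a small gain of decay at infinity (`exists_quadHat_bound`).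

Uniqueness is an `L²` estimate for the difference of two solutions (`exists_difference_bound`), with
the same symmetrization for the dangerous terms. Existence comes from Galerkin approximations: the
energy estimate bounds them in `H^s` for a time that depends only on the size of the data, and the
difference estimate together with the decay of the nonlinearity makes them Cauchy in `L²`. The limit
is a bounded path in `H^s`, and it is continuous there because its `H^s` norm is Lipschitz in time
(`FourierSolution.of_bounded`). As the lifespan depends only on the norm, bounded solutions continue
(`exists_continuation`). Distributional solutions and paths differentiable in `L²` on the Fourier
side are the same thing (`IsSolutionOn.fourierSolution`, `FourierSolution.isSolutionOn`). -/

namespace ActiveVector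

/-! ### Vector algebra in `ℂ³` -/

/-- Coordinatewise complex conjugation on `ℂ³`. -/
noncomputable def conjC3 (v : C3) : C3 := WithLp.toLp 2 fun i => (starRingEnd ℂ) (v i)

/-- The bilinear dot product on `ℂ³`. -/
noncomputable def dotC3 (v w : C3) : ℂ := v 0 * w 0 + v 1 * w 1 + v 2 * w 2

@[simp] lemma conjC3_apply (v : C3) (i : Fin 3) : conjC3 v i = (starRingEnd ℂ) (v i) := rfl

@[simp] lemma toC3_apply (v : E3) (i : Fin 3) : toC3 v i = (v i : ℂ) := rfl

lemma cross_zero_apply {R : Type*} [CommRing R] (v w : EuclideanSpace R (Fin 3)) :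
    cross v w 0 = v 1 * w 2 - v 2 * w 1 := by simp [cross, crossProduct]

lemma cross_one_apply {R : Type*} [CommRing R] (v w : EuclideanSpace R (Fin 3)) :
    cross v w 1 = v 2 * w 0 - v 0 * w 2 := by simp [cross, crossProduct]

lemma cross_two_apply {R : Type*} [CommRing R] (v w : EuclideanSpace R (Fin 3)) :
    cross v w 2 = v 0 * w 1 - v 1 * w 0 := by simp [cross, crossProduct]

lemma euclidean_ext_three {R : Type*} {v w : EuclideanSpace R (Fin 3)}
    (h0 : v 0 = w 0) (h1 : v 1 = w 1) (h2 : v 2 = w 2) : v = w := by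
  ext i; fin_cases i <;> assumption

lemma toC3_cross (v w : E3) : toC3 (cross v w) = cross (toC3 v) (toC3 w) := by
  apply euclidean_ext_three <;>
    simp [cross_zero_apply, cross_one_apply, cross_two_apply]

lemma conjC3_conjC3 (v : C3) : conjC3 (conjC3 v) = v := by
  apply euclidean_ext_three <;> simp

lemma conjC3_toC3 (v : E3) : conjC3 (toC3 v) = toC3 v := by
  apply euclidean_ext_three <;> simp

lemma conjC3_smul (c : ℂ) (v : C3) : conjC3 (c • v) = (starRingEnd ℂ) c • conjC3 v := by
  apply euclidean_ext_three <;> simp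

lemma conjC3_add (v w : C3) : conjC3 (v + w) = conjC3 v + conjC3 w := by
  apply euclidean_ext_three <;> simp

lemma conjC3_sub (v w : C3) : conjC3 (v - w) = conjC3 v - conjC3 w := by
  apply euclidean_ext_three <;> simp

lemma conjC3_cross (v w : C3) : conjC3 (cross v w) = cross (conjC3 v) (conjC3 w) := by
  apply euclidean_ext_three <;>
    simp [cross_zero_apply, cross_one_apply, cross_two_apply]

lemma norm_conjC3 (v : C3) : ‖conjC3 v‖ = ‖v‖ := by
  simp [EuclideanSpace.norm_eq]

lemma norm_toC3 (v : E3) : ‖toC3 v‖ = ‖v‖ := by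
  simp [EuclideanSpace.norm_eq]

lemma dotC3_eq_inner (v w : C3) : dotC3 v w = inner ℂ (conjC3 v) w := by
  simp [dotC3, PiLp.inner_apply, Fin.sum_univ_three, mul_comm]

lemma inner_eq_dotC3 (v w : C3) : inner ℂ v w = dotC3 (conjC3 v) w := by
  rw [dotC3_eq_inner, conjC3_conjC3]

lemma norm_dotC3_le (v w : C3) : ‖dotC3 v w‖ ≤ ‖v‖ * ‖w‖ := by
  rw [dotC3_eq_inner, ← norm_conjC3 v]; exact norm_inner_le_norm _ _

lemma dotC3_comm (v w : C3) : dotC3 v w = dotC3 w v := by simp [dotC3]; ring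

lemma dotC3_sub_left (u v w : C3) : dotC3 (u - v) w = dotC3 u w - dotC3 v w := by
  simp [dotC3]; ring

lemma dotC3_neg_left (v w : C3) : dotC3 (-v) w = -dotC3 v w := by
  simp [dotC3]; ring

lemma dotC3_add_right (u v w : C3) : dotC3 u (v + w) = dotC3 u v + dotC3 u w := by
  simp [dotC3]; ring

lemma dotC3_smul_left (c : ℂ) (v w : C3) : dotC3 (c • v) w = c * dotC3 v w := by
  simp [dotC3]; ring

lemma dotC3_smul_right (c : ℂ) (v w : C3) : dotC3 v (c • w) = c * dotC3 v w := by
  simp [dotC3]; ring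

lemma conj_dotC3 (v w : C3) :
    (starRingEnd ℂ) (dotC3 v w) = dotC3 (conjC3 v) (conjC3 w) := by
  simp [dotC3]

lemma dotC3_cross_self (v w : C3) : dotC3 v (cross v w) = 0 := by
  simp [dotC3, cross_zero_apply, cross_one_apply, cross_two_apply]; ring

/-- With `x` the output frequency and `a` the velocity, the first term is the stretching part of the
nonlinearity and the second the transport part. -/
lemma cross_cross (x a g : C3) :
    cross x (cross a g) = dotC3 x g • a - dotC3 x a • g := by
  apply euclidean_ext_three <;>
    simp [dotC3, cross_zero_apply, cross_one_apply, cross_two_apply] <;> ring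

lemma dotC3_cross_right (u v w : C3) : dotC3 u (cross v w) = -dotC3 (cross v u) w := by
  simp [dotC3, cross_zero_apply, cross_one_apply, cross_two_apply]; ring

lemma norm_cross_le (v w : C3) : ‖cross v w‖ ≤ ‖v‖ * ‖w‖ := by
  have h : ‖cross v w‖ ^ 2 ≤ (‖v‖ * ‖w‖) ^ 2 := by
    -- Lagrange's identity; over `ℂ` the defect is the squared modulus of the Hermitian product of
    -- `v` and `w`.
    have key : (‖v‖ * ‖w‖) ^ 2 - ‖cross v w‖ ^ 2
        = Complex.normSq ((starRingEnd ℂ) (v 0) * w 0 + (starRingEnd ℂ) (v 1) * w 1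
          + (starRingEnd ℂ) (v 2) * w 2) := by
      simp only [mul_pow, EuclideanSpace.norm_sq_eq, Fin.sum_univ_three, ← Complex.normSq_eq_norm_sq,
        cross_zero_apply, cross_one_apply, cross_two_apply]
      simp [Complex.normSq_apply]
      ring
    have := Complex.normSq_nonneg ((starRingEnd ℂ) (v 0) * w 0 + (starRingEnd ℂ) (v 1) * w 1
          + (starRingEnd ℂ) (v 2) * w 2)
    linarith
  exact le_of_sq_le_sq h (by positivity)

/-- The cross product on `ℂ³` as a continuous bilinear map. -/
noncomputable def crossL : C3 →L[ℂ] C3 →L[ℂ] C3 :=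
  LinearMap.mkContinuous₂
    (LinearMap.mk₂ ℂ (fun v w : C3 => cross v w)
      (fun u v w => by
        apply euclidean_ext_three <;>
          simp [cross_zero_apply, cross_one_apply, cross_two_apply] <;> ring)
      (fun c v w => by
        apply euclidean_ext_three <;>
          simp [cross_zero_apply, cross_one_apply, cross_two_apply] <;> ring)
      (fun u v w => by
        apply euclidean_ext_three <;>
          simp [cross_zero_apply, cross_one_apply, cross_two_apply] <;> ring)
      (fun c v w => by
        apply euclidean_ext_three <;>
          simp [cross_zero_apply, cross_one_apply, cross_two_apply] <;> ring)) 1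
    (fun v w => by simpa using norm_cross_le v w)

@[simp] lemma crossL_apply (v w : C3) : crossL v w = cross v w := rfl

lemma cross_sub_left (u v w : C3) : cross (u - v) w = cross u w - cross v w := by
  simp only [← crossL_apply, map_sub, sub_apply]

lemma cross_sub_right (u v w : C3) : cross u (v - w) = cross u v - cross u w := by
  simp only [← crossL_apply, map_sub]

lemma cross_smul_left (c : ℂ) (v w : C3) : cross (c • v) w = c • cross v w := by
  simp only [← crossL_apply, map_smul, smul_apply]

lemma cross_neg_left (v w : C3) : cross (-v) w = -cross v w := by
  simp only [← crossL_apply, map_neg, neg_apply]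

/-- Coordinatewise conjugation as a real linear isometry. -/
noncomputable def conjL : C3 →L[ℝ] C3 :=
  LinearMap.mkContinuous
    { toFun := conjC3
      map_add' := conjC3_add
      map_smul' := fun c v => by apply euclidean_ext_three <;> simp } 1
    (fun v => by simp [norm_conjC3])

@[simp] lemma conjL_apply (v : C3) : conjL v = conjC3 v := rfl

lemma measurable_coord {α : Type*} [MeasurableSpace α] {f : α → C3} (hf : Measurable f)
    (i : Fin 3) : Measurable fun x => f x i :=
  (measurable_pi_apply i).comp ((PiLp.continuous_ofLp 2 _).measurable.comp hf)

lemma measurable_of_coord {α : Type*} [MeasurableSpace α] {f : α → C3}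
    (h0 : Measurable fun x => f x 0) (h1 : Measurable fun x => f x 1)
    (h2 : Measurable fun x => f x 2) : Measurable f := by
  have h : Measurable fun x => (f x).ofLp := by
    refine measurable_pi_lambda _ fun i => ?_
    fin_cases i <;> assumption
  exact (PiLp.continuous_toLp 2 (fun _ : Fin 3 => ℂ)).measurable.comp h

lemma measurable_dotC3 {α : Type*} [MeasurableSpace α] {f g : α → C3} (hf : Measurable f)
    (hg : Measurable g) : Measurable fun x => dotC3 (f x) (g x) :=
  (((measurable_coord hf 0).mul (measurable_coord hg 0)).add
    ((measurable_coord hf 1).mul (measurable_coord hg 1))).add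
      ((measurable_coord hf 2).mul (measurable_coord hg 2))

lemma measurable_cross {α : Type*} [MeasurableSpace α] {f g : α → C3} (hf : Measurable f)
    (hg : Measurable g) : Measurable fun x => cross (f x) (g x) := by
  have hf' := measurable_coord hf
  have hg' := measurable_coord hg
  apply measurable_of_coord <;>
    simp only [cross_zero_apply, cross_one_apply, cross_two_apply]
  · exact ((hf' 1).mul (hg' 2)).sub ((hf' 2).mul (hg' 1))
  · exact ((hf' 2).mul (hg' 0)).sub ((hf' 0).mul (hg' 2))
  · exact ((hf' 0).mul (hg' 1)).sub ((hf' 1).mul (hg' 0))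

lemma measurable_toC3 : Measurable toC3 := toC3.continuous.measurable

lemma measurable_conjC3 : Measurable conjC3 := conjL.continuous.measurable

/-! ### The Fourier transform of real fields -/

/-- Complex square-integrable fields on the Fourier side. -/
abbrev HL2 : Type := Lp C3 2 (volume : Measure E3)

/-- Reflection `g ↦ g(-·)` on `L²`. -/
noncomputable def reflLp (g : HL2) : HL2 :=
  Lp.compMeasurePreserving (fun x : E3 => -x) (Measure.measurePreserving_neg volume) g

lemma reflLp_coe (g : HL2) : reflLp g =ᵐ[volume] fun x => g (-x) :=
  Lp.coeFn_compMeasurePreserving g (Measure.measurePreserving_neg volume)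

lemma continuous_reflLp : Continuous reflLp :=
  (Lp.isometry_compMeasurePreserving (Measure.measurePreserving_neg volume)).continuous

lemma ae_comp_neg {p : E3 → Prop} (h : ∀ᵐ x, p x) : ∀ᵐ x, p (-x) :=
  (Measure.measurePreserving_neg (volume : Measure E3)).quasiMeasurePreserving.ae h

/-- Conjugating the character `exp(-2πi v·x)` reflects `x`. No integrability is needed, since
otherwise both integrals take the default value zero. -/
lemma fourier_conj (f : E3 → C3) (x : E3) :
    𝓕 (fun y => conjC3 (f y)) x = conjC3 (𝓕 f (-x)) := by
  by_cases hf : Integrable f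
  · rw [Real.fourier_eq, Real.fourier_eq]
    have h := conjL.integral_comp_comm (φ := fun v : E3 => Real.fourierChar (-inner ℝ v (-x)) • f v)
      (by simpa using (Real.fourierIntegral_convergent_iff (-x)).2 hf)
    simp only [conjL_apply] at h
    rw [← h]
    congr 1
    ext1 v
    rw [Circle.smul_def, Circle.smul_def, conjC3_smul]
    congr 1
    rw [← Circle.coe_inv_eq_conj, ← AddChar.map_neg_eq_inv]
    simp
  · have hf' : ¬ Integrable (fun y => conjC3 (f y)) := by
      intro h
      apply hf
      have := conjL.integrable_comp h
      simpa [conjC3_conjC3] using this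
    rw [Real.fourier_eq, Real.fourier_eq, integral_undef, integral_undef]
    · apply euclidean_ext_three <;> simp
    · simpa using (not_congr (Real.fourierIntegral_convergent_iff (-x))).2 hf
    · exact (not_congr (Real.fourierIntegral_convergent_iff x)).2 hf'

/-- Both sides are continuous in `L²`, so the pointwise identity for Schwartz functions extends by
density. -/
lemma fourier_conj_Lp (h : HL2) :
    𝓕 (conjL.compLp h) = reflLp (conjL.compLp (𝓕 h)) := by
  set p : HL2 → Prop := fun h => 𝓕 (conjL.compLp h) = reflLp (conjL.compLp (𝓕 h))
  apply DenseRange.induction_on (p := p)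
    (SchwartzMap.denseRange_toLpCLM (p := 2) (μ := volume) ENNReal.ofNat_ne_top) h
  · apply isClosed_eq
    · exact (Lp.fourierTransformₗᵢ E3 C3).continuous.comp (conjL.compLpL 2 volume).continuous
    · exact continuous_reflLp.comp ((conjL.compLpL 2 volume).continuous.comp
        (Lp.fourierTransformₗᵢ E3 C3).continuous)
  intro f
  change 𝓕 (conjL.compLp (f.toLp 2)) = reflLp (conjL.compLp (𝓕 (f.toLp 2)))
  have h1 : conjL.compLp (f.toLp 2 : HL2) = (f.postcompCLM conjL).toLp 2 := by
    ext1
    filter_upwards [conjL.coeFn_compLp (f.toLp 2 : HL2), f.coeFn_toLp 2,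
      (f.postcompCLM conjL).coeFn_toLp 2] with x h1 h2 h3
    rw [h1, h2, h3]; rfl
  rw [h1, SchwartzMap.toLp_fourier_eq, SchwartzMap.toLp_fourier_eq]
  have hF : ∀ᵐ x, ((𝓕 f).toLp 2 : HL2) x = 𝓕 f x :=
    (𝓕 f).coeFn_toLp 2 volume
  ext1
  filter_upwards [(𝓕 (f.postcompCLM conjL)).coeFn_toLp 2,
    reflLp_coe (conjL.compLp ((𝓕 f).toLp 2)),
    ae_comp_neg (conjL.coeFn_compLp ((𝓕 f).toLp 2 : HL2)),
    ae_comp_neg hF] with x h1 h2 h3 h4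
  rw [h1, h2, h3, h4]
  exact fourier_conj f x

/-- Hermitian symmetry of a Fourier transform, which characterizes real fields. -/
def Hermitian (g : HL2) : Prop := ∀ᵐ ξ, g (-ξ) = conjC3 (g ξ)

lemma hermitian_iff (g : HL2) : Hermitian g ↔ reflLp (conjL.compLp g) = g := by
  have hc := ae_comp_neg (conjL.coeFn_compLp g)
  constructor
  · intro h
    ext1
    filter_upwards [h, reflLp_coe (conjL.compLp g), hc] with x h1 h2 h3
    rw [h2, h3, h1]
    exact conjC3_conjC3 _
  · intro h
    have h' : reflLp (conjL.compLp g) =ᵐ[volume] g := by rw [h]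
    filter_upwards [h', reflLp_coe (conjL.compLp g), hc] with x h1 h2 h3
    rw [← h1, h2, h3]
    exact (conjC3_conjC3 _).symm

lemma hermitian_fourierL2 (f : L2) : Hermitian (fourierL2 f) := by
  rw [hermitian_iff, fourierL2, ← fourier_conj_Lp]
  congr 1
  ext1
  filter_upwards [conjL.coeFn_compLp (toC3.compLp f), toC3.coeFn_compLp f] with x h1 h2
  rw [h1, h2]
  exact conjC3_toC3 _

/-- The coordinatewise real part. -/
noncomputable def reL : C3 →L[ℝ] E3 :=
  LinearMap.toContinuousLinearMap
    { toFun := fun v => WithLp.toLp 2 fun i => (v i).re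
      map_add' := fun v w => by ext i; simp
      map_smul' := fun c v => by ext i; simp }

lemma reL_apply (v : C3) (i : Fin 3) : reL v i = (v i).re := rfl

lemma toC3_reL {v : C3} (h : conjC3 v = v) : toC3 (reL v) = v := by
  have h' : ∀ i, ((v i).re : ℂ) = v i := fun i => by
    rw [← Complex.conj_eq_iff_re, ← conjC3_apply, h]
  apply euclidean_ext_three <;> simp [reL_apply, h']

/-- This turns paths constructed on the Fourier side back into real fields: Hermitian symmetry says
that the inverse transform equals its own conjugate. -/
lemma exists_fourierL2_eq {g : HL2} (hg : Hermitian g) : ∃ f : L2, fourierL2 f = g := by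
  set h : HL2 := 𝓕⁻ g with hh
  have h1 : 𝓕 h = g := FourierTransform.fourier_fourierInv_eq g
  have h2 : conjL.compLp h = h := by
    apply (Lp.fourierTransformₗᵢ E3 C3).injective
    change 𝓕 (conjL.compLp h) = 𝓕 h
    rw [fourier_conj_Lp, h1, (hermitian_iff g).1 hg]
  refine ⟨reL.compLp h, ?_⟩
  rw [fourierL2, ← h1]
  congr 1
  have h3 : conjL.compLp h =ᵐ[volume] h := by rw [h2]
  ext1
  filter_upwards [toC3.coeFn_compLp (reL.compLp h), reL.coeFn_compLp h, h3,
    conjL.coeFn_compLp h] with x h4 h5 h6 h7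
  rw [h4, h5]
  exact toC3_reL (h7.symm.trans h6)

lemma fourierL2_add (f g : L2) : fourierL2 (f + g) = fourierL2 f + fourierL2 g := by
  change Lp.fourierTransformₗᵢ E3 C3 (toC3.compLpL 2 volume (f + g)) = _
  rw [map_add, map_add]; rfl

lemma fourierL2_sub (f g : L2) : fourierL2 (f - g) = fourierL2 f - fourierL2 g := by
  change Lp.fourierTransformₗᵢ E3 C3 (toC3.compLpL 2 volume (f - g)) = _
  rw [map_sub, map_sub]; rfl

lemma fourierL2_smul (c : ℝ) (f : L2) : fourierL2 (c • f) = c • fourierL2 f := by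
  change Lp.fourierTransformₗᵢ E3 C3 (toC3.compLpL 2 volume (c • f)) = _
  rw [map_smul]
  exact ((Lp.fourierTransformₗᵢ E3 C3).toLinearEquiv.toLinearMap.restrictScalars ℝ).map_smul c _

lemma norm_fourierL2 (f : L2) : ‖fourierL2 f‖ = ‖f‖ := by
  rw [fourierL2, Lp.norm_fourier_eq, Lp.norm_def, Lp.norm_def]
  congr 1
  apply eLpNorm_congr_norm_ae
  filter_upwards [toC3.coeFn_compLp f] with x hx
  rw [hx]
  exact norm_toC3 _

/-- `fourierL2` as a real linear isometry. -/
noncomputable def fourierL2ₗᵢ : L2 →ₗᵢ[ℝ] HL2 where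
  toFun := fourierL2
  map_add' := fourierL2_add
  map_smul' := fourierL2_smul
  norm_map' := norm_fourierL2

lemma fourierL2_injective : Function.Injective fourierL2 := fourierL2ₗᵢ.injective

open scoped SchwartzMap LineDeriv

/-! ### The equation on the Fourier side -/

/-- Multiplication by the symbol of `∇ × Γ`. -/
noncomputable def kmul (γ : ℝ → ℝ) (f : E3 → C3) (ξ : E3) : C3 :=
  (2 * Real.pi * Complex.I * (γ (2 * Real.pi * ‖ξ‖) : ℂ)) • cross (toC3 ξ) (f ξ)

/-- The convolution of two fields with respect to the cross product. -/
noncomputable def convCross (a b : E3 → C3) (ξ : E3) : C3 := ∫ η, cross (a (ξ - η)) (b η)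

/-- The Fourier transform of `-∇ × ((∇ × Γ[f]) × g)` in terms of those of `f` and `g`. -/
noncomputable def quadHat (γ : ℝ → ℝ) (f g : E3 → C3) (ξ : E3) : C3 :=
  (-(2 * Real.pi * Complex.I)) • cross (toC3 ξ) (convCross (kmul γ f) g ξ)

lemma convCross_eq_convolution (a b : E3 → C3) : convCross a b = convolution a b crossL volume := by
  rw [← convolution_flip]; rfl

/-- Parseval for the transform defined by an integral. Compared with `integral_inner_fourier_L2`, it
shows that this transform and the one on `L²` agree. -/
lemma integral_inner_fourierInv (Φ : 𝓢(E3, C3)) {g : E3 → C3} (hg : Integrable g) :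
    ∫ x, inner ℂ (Φ x) (𝓕⁻ g x) = ∫ ξ, inner ℂ (𝓕 Φ ξ) (g ξ) := by
  have h := VectorFourier.integral_sesq_fourierIntegral_eq_neg_flip (innerSL ℂ (E := C3))
    Real.continuous_fourierChar (L := innerₗ E3) continuous_inner (μ := volume) (ν := volume)
    Φ.integrable hg
  simp only [innerSL_apply_apply] at h
  rw [SchwartzMap.fourier_coe]
  refine Eq.trans ?_ h.symm
  congr 1
  ext1 x
  congr 1
  rw [Real.fourierInv_eq]
  simp only [VectorFourier.fourierIntegral]
  congr 1
  ext1 v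
  simp [real_inner_comm]

lemma integral_inner_fourier_L2 (Φ : 𝓢(E3, C3)) (h : HL2) :
    ∫ x, inner ℂ (Φ x) (h x) = ∫ ξ, inner ℂ (𝓕 Φ ξ) ((𝓕 h : HL2) ξ) := by
  have key := Lp.inner_fourier_eq (Φ.toLp 2 : HL2) h
  rw [SchwartzMap.toLp_fourier_eq, L2.inner_def, L2.inner_def] at key
  rw [← integral_congr_ae (f := fun a => inner ℂ ((Φ.toLp 2 : HL2) a) (h a)), ← key]
  · apply integral_congr_ae
    filter_upwards [(𝓕 Φ).coeFn_toLp 2] with x hx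
    rw [hx]
  · filter_upwards [Φ.coeFn_toLp 2] with x hx
    rw [hx]

/-- The Schwartz function `g v`, for a scalar test function `g`. -/
noncomputable def testSchwartz {g : E3 → ℝ} (hg : ContDiff ℝ ∞ g) (hc : HasCompactSupport g)
    (v : C3) : 𝓢(E3, C3) :=
  (hc.smul_right (f' := fun _ => v)).toSchwartzMap (hg.smul contDiff_const)

lemma testSchwartz_apply {g : E3 → ℝ} (hg : ContDiff ℝ ∞ g) (hc : HasCompactSupport g)
    (v : C3) (x : E3) : testSchwartz hg hc v x = g x • v := rfl

/-- Letting `v` range over `ℂ³` recovers the vector integral `∫ g F`, so scalar test functions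
suffice. -/
lemma ae_eq_zero_of_testSchwartz {F : E3 → C3} (hF : LocallyIntegrable F)
    (h : ∀ (g : E3 → ℝ) (hg : ContDiff ℝ ∞ g) (hc : HasCompactSupport g) (v : C3),
      ∫ x, inner ℂ (testSchwartz hg hc v x) (F x) = 0) : ∀ᵐ x, F x = 0 := by
  apply ae_eq_zero_of_integral_contDiff_smul_eq_zero hF
  intro g hg hc
  apply ext_inner_left ℂ
  intro v
  rw [← integral_inner
    (hF.integrable_smul_left_of_hasCompactSupport hg.continuous hc), inner_zero_right,
    ← h g hg hc v]
  congr 1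
  ext1 x
  rw [testSchwartz_apply, ← Complex.coe_smul, ← Complex.coe_smul, inner_smul_left,
    inner_smul_right, Complex.conj_ofReal]


/-- Both sides have the same pairings with test functions, by Plancherel for one and Fubini for the
other. Thanks to this the pointwise product in the weak formulation becomes a convolution of
transforms. -/
lemma ae_toC3_eq_fourierInv {f : L2} (hf : Integrable (fourierL2 f)) :
    ∀ᵐ x, toC3 (f x) = 𝓕⁻ (fourierL2 f : E3 → C3) x := by
  have hloc : LocallyIntegrable (toC3.compLp f : HL2) :=
    (Lp.memLp _).locallyIntegrable (by norm_num)
  have hcont : Continuous (𝓕⁻ (fourierL2 f : E3 → C3)) :=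
    VectorFourier.fourierIntegral_continuous Real.continuous_fourierChar
      (L := -innerₗ E3) (continuous_inner.neg) hf
  have h := ae_eq_zero_of_testSchwartz (hloc.sub hcont.locallyIntegrable) (fun g hg hc v => by
    have i1 : Integrable fun x => inner ℂ (testSchwartz hg hc v x) ((toC3.compLp f : HL2) x) := by
      have := L2.integrable_inner (𝕜 := ℂ) ((testSchwartz hg hc v).toLp 2 : HL2) (toC3.compLp f : HL2)
      refine this.congr ?_
      filter_upwards [(testSchwartz hg hc v).coeFn_toLp 2] with x hx
      rw [hx]
    have i2 : Integrable fun x =>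
        inner ℂ (testSchwartz hg hc v x) (𝓕⁻ (fourierL2 f : E3 → C3) x) := by
      apply Continuous.integrable_of_hasCompactSupport
      · exact ((testSchwartz hg hc v).continuous).inner hcont
      · refine HasCompactSupport.mono hc ?_
        intro x hx
        contrapose! hx
        simp only [Function.mem_support, not_not] at hx
        simp [testSchwartz_apply, hx]
    simp only [Pi.sub_apply, inner_sub_right]
    rw [integral_sub i1 i2, integral_inner_fourierInv _ hf, integral_inner_fourier_L2]
    exact sub_self _)
  filter_upwards [h, toC3.coeFn_compLp f] with x h1 h2
  rw [← h2]
  exact sub_eq_zero.1 h1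

/-- Taking real parts in `curlGamma` loses nothing: the symbol is imaginary and odd in `ξ`, so it
preserves Hermitian symmetry. -/
lemma toC3_curlGamma (γ : ℝ → ℝ) (f : L2) (x : E3) :
    toC3 (curlGamma γ f x) = 𝓕⁻ (curlGammaHat γ f) x := by
  have hherm : (fun ξ => conjC3 (curlGammaHat γ f ξ)) =ᵐ[volume]
      fun ξ => curlGammaHat γ f (-ξ) := by
    filter_upwards [hermitian_fourierL2 f] with ξ hξ
    simp only [curlGammaHat, conjC3_smul, conjC3_cross, conjC3_toC3, norm_neg, map_neg,
      cross_neg_left, hξ]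
    simp [map_ofNat (starRingEnd ℂ) 2]
  have key : conjC3 (𝓕⁻ (curlGammaHat γ f) x) = 𝓕⁻ (curlGammaHat γ f) x := by
    conv_lhs => rw [Real.fourierInv_eq_fourier_neg, ← fourier_conj]
    rw [Real.fourier_congr_ae hherm, Real.fourierInv_eq_fourier_comp_neg]
  exact toC3_reL key

/-- A vector-valued test function as a Schwartz function with values in `ℂ³`. -/
noncomputable def testField {φ : E3 → E3} (hφ : ContDiff ℝ ∞ φ) (hc : HasCompactSupport φ) :
    𝓢(E3, C3) := (hc.toSchwartzMap hφ).postcompCLM toC3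

lemma testField_apply {φ : E3 → E3} (hφ : ContDiff ℝ ∞ φ) (hc : HasCompactSupport φ) (x : E3) :
    testField hφ hc x = toC3 (φ x) := rfl

lemma inner_toC3 (v w : E3) : inner ℂ (toC3 v) (toC3 w) = ((inner ℝ w v : ℝ) : ℂ) := by
  simp [PiLp.inner_apply, Fin.sum_univ_three]
  ring

lemma fourier_postcomp (L : C3 →L[ℂ] C3) (Φ : 𝓢(E3, C3)) (ξ : E3) :
    𝓕 (Φ.postcompCLM L) ξ = L (𝓕 Φ ξ) := by
  rw [SchwartzMap.fourier_coe, SchwartzMap.fourier_coe, Real.fourier_eq, Real.fourier_eq,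
    ← L.integral_comp_comm ((Real.fourierIntegral_convergent_iff ξ).2 Φ.integrable)]
  congr 1
  ext1 v
  simp [Circle.smul_def]

lemma fourier_lineDeriv_apply (Φ : 𝓢(E3, C3)) (m ξ : E3) :
    𝓕 (∂_{m} Φ) ξ = (2 * Real.pi * Complex.I * (inner ℝ ξ m : ℝ)) • 𝓕 Φ ξ := by
  rw [SchwartzMap.fourier_lineDerivOp_eq, smul_apply,
    SchwartzMap.smulLeftCLM_apply_apply (by fun_prop),
    mul_smul _ ((inner ℝ ξ m : ℝ) : ℂ), Complex.coe_smul]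

/-- The curl of a Schwartz field. -/
noncomputable def curlSchwartz (Φ : 𝓢(E3, C3)) : 𝓢(E3, C3) :=
  ∑ j : Fin 3, (∂_{EuclideanSpace.single j (1 : ℝ)} Φ).postcompCLM
    (crossL (toC3 (EuclideanSpace.single j 1)))

lemma fourier_curlSchwartz (Φ : 𝓢(E3, C3)) (ξ : E3) :
    𝓕 (curlSchwartz Φ) ξ = (2 * Real.pi * Complex.I) • cross (toC3 ξ) (𝓕 Φ ξ) := by
  have h : 𝓕 (curlSchwartz Φ) = ∑ j : Fin 3, 𝓕 ((∂_{EuclideanSpace.single j (1 : ℝ)} Φ).postcompCLM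
    (crossL (toC3 (EuclideanSpace.single j 1)))) := by
    unfold curlSchwartz
    exact map_sum (FourierTransform.fourierCLE ℂ 𝓢(E3, C3)) _ _
  rw [h, sum_apply]
  simp only [fourier_postcomp, fourier_lineDeriv_apply, Fin.sum_univ_three]
  apply euclidean_ext_three <;>
    simp [cross_zero_apply, cross_one_apply, cross_two_apply, EuclideanSpace.inner_single_right] <;>
    ring

lemma curlSchwartz_testField {φ : E3 → E3} (hφ : ContDiff ℝ ∞ φ) (hc : HasCompactSupport φ)
    (x : E3) : curlSchwartz (testField hφ hc) x = toC3 (curl φ x) := by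
  have hd : ∀ m : E3, fderiv ℝ (testField hφ hc) x m = toC3 (fderiv ℝ φ x m) := by
    intro m
    have h1 : HasFDerivAt φ (fderiv ℝ φ x) x :=
      (hφ.differentiable (by simp) x).hasFDerivAt
    have h2 : HasFDerivAt (testField hφ hc) (toC3.comp (fderiv ℝ φ x)) x :=
      toC3.hasFDerivAt.comp x h1
    rw [h2.fderiv]; rfl
  rw [curlSchwartz, sum_apply]
  simp only [SchwartzMap.postcompCLM_apply, SchwartzMap.lineDerivOp_apply_eq_fderiv, hd,
    Fin.sum_univ_three]
  apply euclidean_ext_three <;>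
    simp [cross_zero_apply, cross_one_apply, cross_two_apply, curl, partialDeriv] <;>
    ring

lemma integral_inner_testField (f : L2) {φ : E3 → E3} (hφ : ContDiff ℝ ∞ φ)
    (hc : HasCompactSupport φ) :
    ((∫ x, inner ℝ (f x) (φ x) : ℝ) : ℂ)
      = ∫ ξ, inner ℂ (𝓕 (testField hφ hc) ξ) (fourierL2 f ξ) := by
  rw [← integral_complex_ofReal]
  refine Eq.trans ?_ (integral_inner_fourier_L2 (testField hφ hc) (toC3.compLp f))
  apply integral_congr_ae
  filter_upwards [toC3.coeFn_compLp f] with x hx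
  rw [hx, testField_apply, inner_toC3]

lemma integrable_convCross {a b : E3 → C3} (ha : Integrable a) (hb : Integrable b) :
    Integrable (convCross a b) := by
  rw [convCross_eq_convolution]
  exact ha.integrable_convolution crossL hb

lemma fourierInv_convCross {a b : E3 → C3} (ha : Integrable a) (hb : Integrable b) (x : E3) :
    𝓕⁻ (convCross a b) x = cross (𝓕⁻ a x) (𝓕⁻ b x) := by
  rw [convCross_eq_convolution, Real.fourierInv_eq_fourier_neg,
    Real.fourier_bilin_convolution_eq crossL ha hb, ← Real.fourierInv_eq_fourier_neg,
    ← Real.fourierInv_eq_fourier_neg, crossL_apply]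

/-- The weak form of the nonlinearity on the Fourier side. -/
lemma neg_integral_inner_curl (γ : ℝ → ℝ) {f : L2} (ha : Integrable (curlGammaHat γ f))
    (hb : Integrable (fourierL2 f)) {φ : E3 → E3} (hφ : ContDiff ℝ ∞ φ)
    (hc : HasCompactSupport φ) :
    ((-∫ x, inner ℝ (cross (curlGamma γ f x) (f x)) (curl φ x) : ℝ) : ℂ)
      = ∫ ξ, inner ℂ (𝓕 (testField hφ hc) ξ) (quadHat γ (fourierL2 f) (fourierL2 f) ξ) := by
  have h1 : ((∫ x, inner ℝ (cross (curlGamma γ f x) (f x)) (curl φ x) : ℝ) : ℂ)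
      = ∫ x, inner ℂ (curlSchwartz (testField hφ hc) x)
          (𝓕⁻ (convCross (curlGammaHat γ f) (fourierL2 f)) x) := by
    rw [← integral_complex_ofReal]
    apply integral_congr_ae
    filter_upwards [ae_toC3_eq_fourierInv hb] with x hx
    rw [fourierInv_convCross ha hb, ← hx, ← toC3_curlGamma, ← toC3_cross, curlSchwartz_testField,
      inner_toC3]
  rw [Complex.ofReal_neg, h1, integral_inner_fourierInv _ (integrable_convCross ha hb),
    ← integral_neg]
  congr 1
  ext1 ξ
  -- The antisymmetry of the triple product moves the curl from the test field to the convolution.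
  rw [fourier_curlSchwartz, inner_eq_dotC3, inner_eq_dotC3, conjC3_smul, conjC3_cross, conjC3_toC3,
    dotC3_smul_left, quadHat, dotC3_smul_right, dotC3_cross_right]
  change -(_ * dotC3 _ (convCross (kmul γ (fourierL2 f)) (fourierL2 f) ξ)) = _
  simp [map_ofNat (starRingEnd ℂ) 2]

lemma fourier_testSchwartz {g : E3 → ℝ} (hg : ContDiff ℝ ∞ g) (hc : HasCompactSupport g)
    (v : C3) (ξ : E3) :
    𝓕 (testSchwartz hg hc v) ξ = 𝓕 (fun x => (g x : ℂ)) ξ • v := by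
  rw [SchwartzMap.fourier_coe, Real.fourier_eq, Real.fourier_eq, ← integral_smul_const]
  congr 1
  ext1 x
  rw [testSchwartz_apply]
  simp [Circle.smul_def, mul_smul]

lemma integral_fderiv_eq (f : L2) {g : E3 → ℝ} (hg : ContDiff ℝ ∞ g) (hc : HasCompactSupport g) :
    ((∫ x, fderiv ℝ g x (f x) : ℝ) : ℂ)
      = ∫ ξ, (starRingEnd ℂ) (2 * Real.pi * Complex.I * 𝓕 (fun x => (g x : ℂ)) ξ) *
          dotC3 (toC3 ξ) (fourierL2 f ξ) := by
  -- The gradient of `g` as a Schwartz field, with transform `2πi ĝ(ξ) ξ`.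
  set G : 𝓢(E3, C3) := ∑ j : Fin 3, ∂_{EuclideanSpace.single j (1 : ℝ)}
    (testSchwartz hg hc (toC3 (EuclideanSpace.single j 1))) with hG
  have h1 : ∀ x, G x = ∑ j : Fin 3, (fderiv ℝ g x (EuclideanSpace.single j 1)) •
      toC3 (EuclideanSpace.single j 1) := by
    intro x
    rw [hG, sum_apply]
    congr 1
    ext1 j
    rw [SchwartzMap.lineDerivOp_apply_eq_fderiv]
    have h2 : HasFDerivAt (testSchwartz hg hc (toC3 (EuclideanSpace.single j 1)))
        ((fderiv ℝ g x).smulRight (toC3 (EuclideanSpace.single j 1))) x :=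
      (hg.differentiable (by simp) x).hasFDerivAt.smul_const _
    rw [h2.fderiv]; rfl
  have h3 : ∀ ξ, 𝓕 G ξ = (2 * Real.pi * Complex.I * 𝓕 (fun x => (g x : ℂ)) ξ) • toC3 ξ := by
    intro ξ
    have : 𝓕 G = ∑ j : Fin 3, 𝓕 (∂_{EuclideanSpace.single j (1 : ℝ)}
        (testSchwartz hg hc (toC3 (EuclideanSpace.single j 1)))) :=
      map_sum (FourierTransform.fourierCLE ℂ 𝓢(E3, C3)) _ _
    rw [this, sum_apply]
    simp only [fourier_lineDeriv_apply, fourier_testSchwartz, Fin.sum_univ_three]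
    apply euclidean_ext_three <;> simp [EuclideanSpace.inner_single_right] <;> ring
  rw [← integral_complex_ofReal]
  refine Eq.trans ?_ ((integral_inner_fourier_L2 G (toC3.compLp f)).trans ?_)
  · apply integral_congr_ae
    filter_upwards [toC3.coeFn_compLp f] with x hx
    rw [hx, h1]
    have h4 : f x = ∑ j : Fin 3, (f x j) • EuclideanSpace.single j (1 : ℝ) := by
      apply euclidean_ext_three <;> simp [Fin.sum_univ_three]
    conv_lhs => rw [h4, map_sum]
    simp [Fin.sum_univ_three, inner_eq_dotC3, dotC3]
    ring
  · congr 1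
    ext1 ξ
    rw [h3, inner_eq_dotC3, conjC3_smul, conjC3_toC3, dotC3_smul_left]
    rfl

/-! ### The divergence condition on the Fourier side -/

/-- The divergence of a field vanishes, on the Fourier side. -/
def FourierDivFree (g : HL2) : Prop := ∀ᵐ ξ, dotC3 (toC3 ξ) (g ξ) = 0

lemma divFree_of_fourierDivFree {f : L2} (h : FourierDivFree (fourierL2 f)) : DivFree f := by
  intro g hg hc
  rw [← Complex.ofReal_inj, integral_fderiv_eq f hg hc, Complex.ofReal_zero]
  apply integral_eq_zero_of_ae
  filter_upwards [h] with ξ hξ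
  simp [hξ]

/-- The first hypothesis makes `ξ · f̂` square-integrable, so that it is the transform of an `L²`
function; that function vanishes because its pairings with test functions do. -/
lemma fourierDivFree_of_divFree {f : L2}
    (hm : MemLp (fun ξ => (‖ξ‖ : ℝ) • fourierL2 f ξ) 2) (h : DivFree f) :
    FourierDivFree (fourierL2 f) := by
  -- The scalar `ξ · f̂` is stored in the first coordinate, so that the `ℂ³`-valued tools apply.
  obtain ⟨F, hF⟩ : ∃ F : E3 → C3, F = fun ξ =>
    EuclideanSpace.single 0 (dotC3 (toC3 ξ) (fourierL2 f ξ)) := ⟨_, rfl⟩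
  have hFm : MemLp F 2 := by
    refine MemLp.of_le hm ?_ ?_
    · have hd := measurable_dotC3 measurable_toC3 (Lp.stronglyMeasurable (fourierL2 f)).measurable
      rw [hF]
      refine (measurable_of_coord ?_ ?_ ?_).aestronglyMeasurable
      · simpa using hd
      · simp
      · simp
    · filter_upwards with ξ
      simp only [hF, PiLp.norm_single, norm_smul, norm_norm]
      exact (norm_dotC3_le _ _).trans (by rw [norm_toC3])
  set G : HL2 := 𝓕⁻ (hFm.toLp F)
  have hG : 𝓕 G = hFm.toLp F := FourierTransform.fourier_fourierInv_eq _
  have hz := ae_eq_zero_of_testSchwartz ((Lp.memLp G).locallyIntegrable (by norm_num))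
    (fun g hg hc v => by
      rw [integral_inner_fourier_L2, hG]
      have hi := integral_fderiv_eq f hg hc
      rw [h g hg hc, Complex.ofReal_zero] at hi
      -- Only the first coordinate of `v` meets `F`, and the inverse constant removes the factor
      -- `2πi` produced by the gradient of `g`.
      have h5 : ∫ ξ, inner ℂ (𝓕 (testSchwartz hg hc v) ξ) ((hFm.toLp F : HL2) ξ)
          = ∫ ξ, ((starRingEnd ℂ) (v 0) * (starRingEnd ℂ (2 * Real.pi * Complex.I))⁻¹) *
            ((starRingEnd ℂ) (2 * Real.pi * Complex.I * 𝓕 (fun x => (g x : ℂ)) ξ) *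
              dotC3 (toC3 ξ) (fourierL2 f ξ)) := by
        apply integral_congr_ae
        filter_upwards [hFm.coeFn_toLp] with ξ hξ
        rw [hξ, fourier_testSchwartz]
        have hpi : (Real.pi : ℂ) ≠ 0 := by exact_mod_cast Real.pi_ne_zero
        have hne : (starRingEnd ℂ) (2 * Real.pi * Complex.I) ≠ 0 := by
          simp [Real.pi_ne_zero]
        rw [inner_eq_dotC3, conjC3_smul, dotC3_smul_left, map_mul _ (2 * Real.pi * Complex.I)]
        simp only [hF, dotC3, PiLp.single_apply, conjC3_apply]
        field_simp
        simp
        ring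
      rw [h5, integral_const_mul, ← hi, mul_zero])
  have hG0 : G = 0 := by
    rw [← Lp.eq_zero_iff_ae_eq_zero.symm]
    exact hz
  have hF0 : F =ᵐ[volume] 0 := by
    have : hFm.toLp F = 0 := by
      rw [← hG, hG0]; exact map_zero (Lp.fourierTransformₗᵢ E3 C3)
    exact hFm.coeFn_toLp.symm.trans ((Lp.eq_zero_iff_ae_eq_zero).1 this)
  filter_upwards [hF0] with ξ hξ
  have := congrArg (fun v : C3 => v 0) hξ
  simpa [hF] using this

/-! ### Inequalities of Cauchy–Schwarz and Young -/

/-- The `L²` norm of a nonnegative function. -/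
noncomputable def l2 (F : E3 → ℝ≥0∞) : ℝ≥0∞ := (∫⁻ ξ, F ξ ^ 2) ^ (1 / 2 : ℝ)

lemma l2_sq (F : E3 → ℝ≥0∞) : l2 F ^ 2 = ∫⁻ ξ, F ξ ^ 2 := by
  rw [l2, ← ENNReal.rpow_natCast, ← ENNReal.rpow_mul]; norm_num

lemma sqrt_sq_ennreal (x : ℝ≥0∞) : (x ^ 2) ^ (1 / 2 : ℝ) = x := by
  rw [← ENNReal.rpow_natCast, ← ENNReal.rpow_mul]; norm_num

lemma l2_mono {F G : E3 → ℝ≥0∞} (h : ∀ ξ, F ξ ≤ G ξ) : l2 F ≤ l2 G := by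
  unfold l2
  gcongr with ξ
  exact h ξ

lemma l2_const_mul {F : E3 → ℝ≥0∞} (c : ℝ≥0∞) (hF : Measurable F) :
    l2 (fun ξ => c * F ξ) = c * l2 F := by
  unfold l2
  simp_rw [mul_pow]
  rw [lintegral_const_mul _ (by fun_prop), ENNReal.mul_rpow_of_nonneg _ _ (by norm_num),
    sqrt_sq_ennreal]

lemma lintegral_mul_le_l2 {F G : E3 → ℝ≥0∞} (hF : Measurable F) (hG : Measurable G) :
    ∫⁻ ξ, F ξ * G ξ ≤ l2 F * l2 G := by
  have h := ENNReal.lintegral_mul_le_Lp_mul_Lq volume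
    (Real.HolderConjugate.two_two) hF.aemeasurable hG.aemeasurable
  simp only [Pi.mul_apply, ENNReal.rpow_two] at h
  exact h

lemma l2_comp_sub_right (F : E3 → ℝ≥0∞) (η : E3) : l2 (fun ξ => F (ξ - η)) = l2 F := by
  unfold l2
  rw [lintegral_sub_right_eq_self (fun ξ => F ξ ^ 2) η]

lemma l2_comp_sub_left (F : E3 → ℝ≥0∞) (ξ : E3) : l2 (fun η => F (ξ - η)) = l2 F := by
  unfold l2
  rw [lintegral_sub_left_eq_self (fun ξ => F ξ ^ 2) ξ]

lemma lintegral_conv_comm (G K : E3 → ℝ≥0∞) (ξ : E3) :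
    ∫⁻ η, G η * K (ξ - η) = ∫⁻ η, G (ξ - η) * K η := by
  rw [← lintegral_sub_left_eq_self (fun η => G η * K (ξ - η)) ξ]
  simp

lemma measurable_comp_sub {K : E3 → ℝ≥0∞} (hK : Measurable K) :
    Measurable fun p : E3 × E3 => K (p.1 - p.2) :=
  hK.comp (measurable_fst.sub measurable_snd)

/-- This and the next two lemmas bound one trilinear form by Cauchy–Schwarz in two factors and the
`L¹` norm of the third. The energy estimates need each choice of the third factor, namely the one
that carries the derivative. -/
lemma lintegral_trilinear_le_of_L1_first {F G K : E3 → ℝ≥0∞} (hF : Measurable F)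
    (hG : Measurable G) (hK : Measurable K) :
    ∫⁻ ξ, ∫⁻ η, F ξ * (G η * K (ξ - η)) ≤ l2 G * l2 K * ∫⁻ ξ, F ξ := by
  calc ∫⁻ ξ, ∫⁻ η, F ξ * (G η * K (ξ - η))
      ≤ ∫⁻ ξ, F ξ * (l2 G * l2 K) := by
        apply lintegral_mono
        intro ξ
        have hK' : Measurable fun η => K (ξ - η) := hK.comp (measurable_const.sub measurable_id)
        change ∫⁻ η, F ξ * (G η * K (ξ - η)) ≤ F ξ * (l2 G * l2 K)
        rw [lintegral_const_mul _ (by fun_prop)]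
        gcongr
        rw [← l2_comp_sub_left K ξ]
        exact lintegral_mul_le_l2 hG hK'
    _ = _ := by rw [lintegral_mul_const _ hF, mul_comm]

lemma lintegral_trilinear_le_of_L1_second {F G K : E3 → ℝ≥0∞} (hF : Measurable F)
    (hG : Measurable G) (hK : Measurable K) :
    ∫⁻ ξ, ∫⁻ η, F ξ * (G η * K (ξ - η)) ≤ l2 F * l2 K * ∫⁻ ξ, G ξ := by
  rw [lintegral_lintegral_swap]
  · calc ∫⁻ η, ∫⁻ ξ, F ξ * (G η * K (ξ - η))
        ≤ ∫⁻ η, G η * (l2 F * l2 K) := by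
          apply lintegral_mono
          intro η
          have hK' : Measurable fun ξ => K (ξ - η) := hK.comp (measurable_id.sub measurable_const)
          change ∫⁻ ξ, F ξ * (G η * K (ξ - η)) ≤ G η * (l2 F * l2 K)
          simp_rw [mul_left_comm (F _)]
          rw [lintegral_const_mul _ (by fun_prop)]
          gcongr
          rw [← l2_comp_sub_right K η]
          exact lintegral_mul_le_l2 hF hK'
      _ = _ := by rw [lintegral_mul_const _ hG, mul_comm]
  · exact ((hF.comp measurable_fst).mul ((hG.comp measurable_snd).mul
      (measurable_comp_sub hK))).aemeasurable

lemma lintegral_trilinear_le_of_L1_third {F G K : E3 → ℝ≥0∞} (hF : Measurable F)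
    (hG : Measurable G) (hK : Measurable K) :
    ∫⁻ ξ, ∫⁻ η, F ξ * (G η * K (ξ - η)) ≤ l2 F * l2 G * ∫⁻ ξ, K ξ := by
  refine le_trans (le_of_eq ?_) (lintegral_trilinear_le_of_L1_second hF hK hG)
  congr 1
  ext1 ξ
  have hK' : Measurable fun η => K (ξ - η) := hK.comp (measurable_const.sub measurable_id)
  have hG' : Measurable fun η => G (ξ - η) := hG.comp (measurable_const.sub measurable_id)
  rw [lintegral_const_mul _ (by fun_prop), lintegral_const_mul _ (by fun_prop),
    lintegral_conv_comm]
  simp_rw [mul_comm]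

/-- Young's inequality `L² * L¹ → L²`. -/
lemma l2_conv_le {G K : E3 → ℝ≥0∞} (hG : Measurable G) (hK : Measurable K) :
    l2 (fun ξ => ∫⁻ η, G η * K (ξ - η)) ≤ l2 G * ∫⁻ ξ, K ξ := by
  have key : ∫⁻ ξ, (∫⁻ η, G η * K (ξ - η)) ^ 2 ≤ (l2 G * ∫⁻ ξ, K ξ) ^ 2 := by
    have h1 : ∀ ξ, (∫⁻ η, G η * K (ξ - η)) ^ 2
        ≤ (∫⁻ ξ, K ξ) * ∫⁻ η, G η ^ 2 * K (ξ - η) := by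
      intro ξ
      have hK' : Measurable fun η => K (ξ - η) := hK.comp (measurable_const.sub measurable_id)
      -- Splitting `K` into two square roots makes Cauchy–Schwarz produce one factor `‖K‖₁`; Fubini
      -- produces the second.
      have e : ∀ η, G η * K (ξ - η)
          = (G η * K (ξ - η) ^ (1 / 2 : ℝ)) * K (ξ - η) ^ (1 / 2 : ℝ) := by
        intro η
        rw [mul_assoc, ← ENNReal.rpow_add_of_nonneg _ _ (by norm_num) (by norm_num)]
        norm_num
      have hsq : ∀ x : ℝ≥0∞, (x ^ (1 / 2 : ℝ)) ^ 2 = x := by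
        intro x
        rw [← ENNReal.rpow_natCast, ← ENNReal.rpow_mul]; norm_num
      calc (∫⁻ η, G η * K (ξ - η)) ^ 2
          = (∫⁻ η, (G η * K (ξ - η) ^ (1 / 2 : ℝ)) * K (ξ - η) ^ (1 / 2 : ℝ)) ^ 2 := by
            simp_rw [← e]
        _ ≤ (l2 (fun η => G η * K (ξ - η) ^ (1 / 2 : ℝ)) *
              l2 (fun η => K (ξ - η) ^ (1 / 2 : ℝ))) ^ 2 := by
            gcongr
            exact lintegral_mul_le_l2 (by fun_prop) (by fun_prop)
        _ = _ := by
            rw [mul_pow, l2_sq, l2_sq]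
            simp_rw [mul_pow, hsq]
            rw [lintegral_sub_left_eq_self (fun η => K η) ξ, mul_comm]
    calc ∫⁻ ξ, (∫⁻ η, G η * K (ξ - η)) ^ 2
        ≤ ∫⁻ ξ, (∫⁻ ξ, K ξ) * ∫⁻ η, G η ^ 2 * K (ξ - η) := lintegral_mono h1
      _ = (∫⁻ ξ, K ξ) * ∫⁻ η, ∫⁻ ξ, G η ^ 2 * K (ξ - η) := by
          rw [lintegral_const_mul, lintegral_lintegral_swap]
          · exact (((hG.pow_const 2).comp measurable_snd).mul (measurable_comp_sub hK)).aemeasurable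
          · exact Measurable.lintegral_prod_right
              (((hG.pow_const 2).comp measurable_snd).mul (measurable_comp_sub hK))
      _ = (∫⁻ ξ, K ξ) * ∫⁻ η, G η ^ 2 * ∫⁻ ξ, K ξ := by
          congr 1
          apply lintegral_congr
          intro η
          rw [lintegral_const_mul _ (by fun_prop),
            lintegral_sub_right_eq_self (fun ξ => K ξ) η]
      _ = _ := by
          rw [lintegral_mul_const _ (hG.pow_const 2), mul_pow, l2_sq]; ring
  calc l2 (fun ξ => ∫⁻ η, G η * K (ξ - η)) ≤ ((l2 G * ∫⁻ ξ, K ξ) ^ 2) ^ (1 / 2 : ℝ) := by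
        unfold l2 at key ⊢
        gcongr
    _ = _ := sqrt_sq_ennreal _

/-! ### Weights and Sobolev norms on the Fourier side -/

/-- The weight `1 + |ζ|`, `ζ = 2πξ`. -/
noncomputable def rho (ξ : E3) : ℝ := 1 + 2 * Real.pi * ‖ξ‖

/-- The weight `1 + |ζ|²`, `ζ = 2πξ`. -/
noncomputable def jb (ξ : E3) : ℝ := 1 + (2 * Real.pi * ‖ξ‖) ^ 2

/-- The weight `1 + |ζ|⁻¹`, `ζ = 2πξ`. -/
noncomputable def kap (ξ : E3) : ℝ := 1 + (2 * Real.pi * ‖ξ‖)⁻¹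

lemma one_le_rho (ξ : E3) : 1 ≤ rho ξ := by
  unfold rho; have : 0 ≤ 2 * Real.pi * ‖ξ‖ := by positivity
  linarith

lemma rho_pos (ξ : E3) : 0 < rho ξ := zero_lt_one.trans_le (one_le_rho ξ)

lemma one_le_jb (ξ : E3) : 1 ≤ jb ξ := by
  unfold jb; have : 0 ≤ (2 * Real.pi * ‖ξ‖) ^ 2 := by positivity
  linarith

lemma jb_pos (ξ : E3) : 0 < jb ξ := zero_lt_one.trans_le (one_le_jb ξ)

lemma one_le_kap (ξ : E3) : 1 ≤ kap ξ := by
  unfold kap; have : 0 ≤ (2 * Real.pi * ‖ξ‖)⁻¹ := by positivity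
  linarith

lemma kap_pos (ξ : E3) : 0 < kap ξ := zero_lt_one.trans_le (one_le_kap ξ)

@[fun_prop] lemma measurable_rho : Measurable rho := by unfold rho; fun_prop
@[fun_prop] lemma measurable_jb : Measurable jb := by unfold jb; fun_prop
@[fun_prop] lemma measurable_kap : Measurable kap := by unfold kap; fun_prop

lemma rho_sq_le (ξ : E3) : rho ξ ^ 2 ≤ 2 * jb ξ := by
  unfold rho jb; nlinarith [sq_nonneg (1 - 2 * Real.pi * ‖ξ‖)]

/-- Submultiplicativity distributes a weight at the output frequency of a convolution over its two
inputs. -/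
lemma rho_le_mul (ξ η : E3) : rho ξ ≤ rho (ξ - η) * rho η := by
  unfold rho
  have h : ‖ξ‖ ≤ ‖ξ - η‖ + ‖η‖ := by simpa using norm_add_le (ξ - η) η
  have hp := Real.pi_pos
  have : 0 ≤ (2 * Real.pi * ‖ξ - η‖) * (2 * Real.pi * ‖η‖) := by positivity
  nlinarith [mul_le_mul_of_nonneg_left h (by positivity : (0 : ℝ) ≤ 2 * Real.pi)]

/-- A factor `|ζ|` absorbs the singularity of `kap` at the origin. -/
lemma norm_mul_kap_le (ξ : E3) : 2 * Real.pi * ‖ξ‖ * kap ξ ≤ rho ξ := by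
  unfold kap rho
  rcases eq_or_ne ξ 0 with rfl | h
  · simp
  · have : 2 * Real.pi * ‖ξ‖ ≠ 0 := by
      have := norm_pos_iff.2 h; have := Real.pi_pos; positivity
    rw [mul_add, mul_inv_cancel₀ this]; linarith

lemma rho_rpow_le {τ σ : ℝ} (h0 : 0 ≤ τ) (h : τ ≤ σ) (ξ : E3) :
    rho ξ ^ τ ≤ 2 ^ (σ / 2) * jb ξ ^ (σ / 2) := by
  calc rho ξ ^ τ ≤ rho ξ ^ σ := Real.rpow_le_rpow_of_exponent_le (one_le_rho ξ) h
    _ = (rho ξ ^ 2) ^ (σ / 2) := by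
        rw [← Real.rpow_natCast, ← Real.rpow_mul (rho_pos ξ).le]; congr 1; push_cast; ring
    _ ≤ (2 * jb ξ) ^ (σ / 2) :=
        Real.rpow_le_rpow (by positivity) (rho_sq_le ξ) (by linarith)
    _ = _ := Real.mul_rpow (by norm_num) (jb_pos ξ).le

/-- The norm of `H^σ` on the Fourier side. -/
noncomputable def hs (σ : ℝ) (f : E3 → C3) : ℝ≥0∞ :=
  eLpNorm (fun ξ => (jb ξ ^ (σ / 2)) • f ξ) 2 volume

lemma hs_eq_l2 (σ : ℝ) (f : E3 → C3) :
    hs σ f = l2 (fun ξ => ENNReal.ofReal (jb ξ ^ (σ / 2)) * ‖f ξ‖ₑ) := by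
  rw [hs, eLpNorm_eq_lintegral_rpow_enorm_toReal (by norm_num) (by norm_num), l2]
  simp only [enorm_smul, ENNReal.toReal_ofNat, ENNReal.rpow_two]
  congr 2
  ext1 ξ
  rw [Real.enorm_of_nonneg (Real.rpow_nonneg (jb_pos ξ).le _)]

lemma hs_sq (σ : ℝ) (f : E3 → C3) :
    hs σ f ^ 2 = ∫⁻ ξ, ENNReal.ofReal (jb ξ ^ σ) * ‖f ξ‖ₑ ^ 2 := by
  rw [hs_eq_l2, l2_sq]
  congr 1
  ext1 ξ
  rw [mul_pow, ← ENNReal.ofReal_pow (Real.rpow_nonneg (jb_pos ξ).le _), ← Real.rpow_natCast,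
    ← Real.rpow_mul (jb_pos ξ).le]
  congr 3
  push_cast; ring_nf

lemma sobolevNorm_eq (s : ℝ) (f : L2) : sobolevNorm s f = hs s (fourierL2 f) := by
  rw [← sqrt_sq_ennreal (hs s (fourierL2 f)), hs_sq]; rfl

lemma hs_congr_ae {σ : ℝ} {f g : E3 → C3} (h : f =ᵐ[volume] g) : hs σ f = hs σ g := by
  apply eLpNorm_congr_ae
  filter_upwards [h] with ξ hξ
  rw [hξ]

lemma hs_mono_ae {σ : ℝ} {f g : E3 → C3} (h : ∀ᵐ ξ, ‖f ξ‖ ≤ ‖g ξ‖) : hs σ f ≤ hs σ g := by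
  apply eLpNorm_mono_ae
  filter_upwards [h] with ξ hξ
  rw [norm_smul, norm_smul]
  gcongr

lemma hs_mono_exponent {τ σ : ℝ} (h : τ ≤ σ) (f : E3 → C3) : hs τ f ≤ hs σ f := by
  apply eLpNorm_mono
  intro ξ
  rw [norm_smul, norm_smul, Real.norm_of_nonneg (Real.rpow_nonneg (jb_pos ξ).le _),
    Real.norm_of_nonneg (Real.rpow_nonneg (jb_pos ξ).le _)]
  gcongr
  exact one_le_jb ξ

lemma aestronglyMeasurable_jb_smul (σ : ℝ) {f : E3 → C3} (hf : AEStronglyMeasurable f) :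
    AEStronglyMeasurable (fun ξ => (jb ξ ^ (σ / 2)) • f ξ) :=
  ((measurable_jb.pow_const _).aestronglyMeasurable).smul hf

lemma hs_sub_le (σ : ℝ) {f g : E3 → C3} (hf : AEStronglyMeasurable f)
    (hg : AEStronglyMeasurable g) : hs σ (f - g) ≤ hs σ f + hs σ g := by
  unfold hs
  refine le_trans (le_of_eq ?_) (eLpNorm_sub_le (aestronglyMeasurable_jb_smul σ hf)
    (aestronglyMeasurable_jb_smul σ hg) (by norm_num))
  congr 1
  ext1 ξ
  simp [smul_sub]

/-- The norm of `𝒴¹` on the Fourier side. -/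
noncomputable def yn (f : E3 → C3) : ℝ≥0∞ := ∫⁻ ξ, ENNReal.ofReal (rho ξ) * ‖f ξ‖ₑ

/-- The margin of regularity above the critical exponent. -/
noncomputable def marg (σ : ℝ) : ℝ := (σ - 5 / 2) / 2

/-- The weight of the `L¹` norm that controls the velocity. -/
noncomputable def vwt (σ : ℝ) (ξ : E3) : ℝ := kap ξ * rho ξ ^ (1 + marg σ)

lemma vwt_pos (σ : ℝ) (ξ : E3) : 0 < vwt σ ξ :=
  mul_pos (kap_pos ξ) (Real.rpow_pos_of_pos (rho_pos ξ) _)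

@[fun_prop] lemma measurable_vwt (σ : ℝ) : Measurable (vwt σ) := by unfold vwt; fun_prop

/-- In polar coordinates the Jacobian `r²` absorbs the singularity of `kap²`. At infinity the
integrand decays like `r ^ (4 + 2m - 2σ)` with `m = marg σ`, and this is integrable exactly when `m
< σ - 5/2`; `marg` takes half of that room. -/
lemma integrable_vwt_sq {σ : ℝ} (hσ : 5 / 2 < σ) :
    Integrable fun ξ : E3 => vwt σ ξ ^ 2 * jb ξ ^ (-σ) := by
  set p : ℝ → ℝ := fun r => 1 + 2 * Real.pi * r
  set F : ℝ → ℝ := fun r => ((1 + (2 * Real.pi * r)⁻¹) * (p r) ^ (1 + marg σ)) ^ 2 *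
    (1 + (2 * Real.pi * r) ^ 2) ^ (-σ) with hF
  have hmain : IntegrableOn (fun y : ℝ => y ^ (Module.finrank ℝ E3 - 1) • F y) (Ioi 0) := by
    have hb : IntegrableOn (fun y : ℝ => 2 ^ σ * (1 + ‖y‖) ^ (-(σ - 3 / 2))) (Ioi 0) :=
      ((integrable_one_add_norm (by simp; linarith)).const_mul _).integrableOn
    refine Integrable.mono' hb ?_ ?_
    · refine Measurable.aestronglyMeasurable ?_
      simp only [hF, p, smul_eq_mul]
      fun_prop
    · filter_upwards [ae_restrict_mem measurableSet_Ioi] with y hy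
      have hy : 0 < y := hy
      have hpi : 3 < Real.pi := Real.pi_gt_three
      have hz : 0 < 2 * Real.pi * y := by positivity
      have hp1 : 1 + y ≤ p y := by simp only [p]; nlinarith
      have hp0 : 0 < p y := by simp only [p]; positivity
      -- Here `y²(1 + 1/(2πy))² = (1 + 2πy)²/(2π)²`, which has no singularity left.
      have e1 : y ^ (Module.finrank ℝ E3 - 1) • F y
          = (2 * Real.pi) ^ (-2 : ℤ) * ((p y) ^ 2 * ((p y) ^ (1 + marg σ)) ^ 2) *
            (1 + (2 * Real.pi * y) ^ 2) ^ (-σ) := by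
        simp only [hF, finrank_euclideanSpace_fin, smul_eq_mul, p]
        have : 1 + (2 * Real.pi * y)⁻¹ = (1 + 2 * Real.pi * y) / (2 * Real.pi * y) := by
          field_simp; ring
        rw [this]
        norm_num
        field_simp
      have e2 : (p y) ^ 2 * ((p y) ^ (1 + marg σ)) ^ 2 = (p y) ^ (σ + 3 / 2) := by
        rw [← Real.rpow_natCast, ← Real.rpow_natCast, ← Real.rpow_mul hp0.le, ← Real.rpow_add hp0]
        congr 1; unfold marg; push_cast; ring
      have e3 : (1 + (2 * Real.pi * y) ^ 2) ^ (-σ) ≤ 2 ^ σ * (p y) ^ (-(2 * σ)) := by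
        have h2 : (p y) ^ 2 ≤ 2 * (1 + (2 * Real.pi * y) ^ 2) := by
          simp only [p]; nlinarith [sq_nonneg (1 - 2 * Real.pi * y)]
        have h3 : (2 * (1 + (2 * Real.pi * y) ^ 2)) ^ (-σ) ≤ ((p y) ^ 2) ^ (-σ) :=
          Real.rpow_le_rpow_of_nonpos (by positivity) h2 (by linarith)
        rw [Real.mul_rpow (by norm_num) (by positivity), ← Real.rpow_natCast (p y),
          ← Real.rpow_mul hp0.le] at h3
        have h4 : (2 : ℝ) ^ σ * 2 ^ (-σ) = 1 := by
          rw [← Real.rpow_add (by norm_num)]; simp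
        calc (1 + (2 * Real.pi * y) ^ 2) ^ (-σ)
            = 2 ^ σ * (2 ^ (-σ) * (1 + (2 * Real.pi * y) ^ 2) ^ (-σ)) := by
              rw [← mul_assoc, h4, one_mul]
          _ ≤ 2 ^ σ * (p y) ^ (-(2 * σ)) := by
              gcongr
              refine h3.trans (le_of_eq ?_)
              congr 1; push_cast; ring
      rw [e1, e2, Real.norm_of_nonneg (by positivity), Real.norm_of_nonneg hy.le]
      calc (2 * Real.pi) ^ (-2 : ℤ) * (p y) ^ (σ + 3 / 2) * (1 + (2 * Real.pi * y) ^ 2) ^ (-σ)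
          ≤ 1 * (p y) ^ (σ + 3 / 2) * (2 ^ σ * (p y) ^ (-(2 * σ))) := by
            gcongr
            rw [zpow_neg]
            apply inv_le_one_of_one_le₀
            norm_cast
            nlinarith
        _ = 2 ^ σ * (p y) ^ (-(σ - 3 / 2)) := by
            rw [one_mul, mul_left_comm, ← Real.rpow_add hp0]
            congr 2; ring
        _ ≤ 2 ^ σ * (1 + y) ^ (-(σ - 3 / 2)) := by
            gcongr 2 ^ σ * ?_
            exact Real.rpow_le_rpow_of_nonpos (by positivity) hp1 (by linarith)
  exact (integrable_fun_norm_addHaar (volume : Measure E3) (f := F)).2 hmain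

/-- The weighted `L¹` norm that controls the velocity. -/
noncomputable def vn (σ : ℝ) (f : E3 → C3) : ℝ≥0∞ := ∫⁻ ξ, ENNReal.ofReal (vwt σ ξ) * ‖f ξ‖ₑ

/-- Cauchy–Schwarz against the square-integrable function `vwt σ · jb^(-σ/2)`. -/
lemma exists_vn_le {σ : ℝ} (hσ : 5 / 2 < σ) :
    ∃ C : ℝ, 0 < C ∧ ∀ f : E3 → C3, Measurable f → vn σ f ≤ ENNReal.ofReal C * hs σ f := by
  set K := l2 (fun ξ => ENNReal.ofReal (vwt σ ξ * jb ξ ^ (-(σ / 2)))) with hK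
  have hKfin : K ≠ ⊤ := by
    rw [hK, l2]
    apply ENNReal.rpow_ne_top_of_nonneg (by norm_num)
    have h := (integrable_vwt_sq hσ).lintegral_lt_top
    refine ne_of_lt (lt_of_le_of_lt (le_of_eq ?_) h)
    congr 1
    ext1 ξ
    have hj := jb_pos ξ
    rw [← ENNReal.ofReal_pow (mul_nonneg (vwt_pos σ ξ).le (by positivity)), mul_pow,
      ← Real.rpow_natCast (jb ξ ^ _), ← Real.rpow_mul (jb_pos ξ).le]
    congr 3
    push_cast; ring
  refine ⟨K.toReal + 1, by positivity, fun f hf => ?_⟩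
  have h1 : vn σ f = ∫⁻ ξ, ENNReal.ofReal (vwt σ ξ * jb ξ ^ (-(σ / 2))) *
      (ENNReal.ofReal (jb ξ ^ (σ / 2)) * ‖f ξ‖ₑ) := by
    unfold vn
    congr 1
    ext1 ξ
    have hj := jb_pos ξ
    rw [← mul_assoc, ← ENNReal.ofReal_mul (mul_nonneg (vwt_pos σ ξ).le (by positivity)), mul_assoc,
      ← Real.rpow_add (jb_pos ξ)]
    simp
  rw [h1, hs_eq_l2]
  refine (lintegral_mul_le_l2 (by fun_prop) (by fun_prop)).trans ?_
  gcongr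
  rw [← hK]
  exact ENNReal.le_ofReal_iff_toReal_le hKfin (by positivity) |>.2 (by linarith)

lemma yn_le_vn {σ : ℝ} (hσ : 5 / 2 < σ) (f : E3 → C3) : yn f ≤ vn σ f := by
  unfold yn vn vwt
  gcongr with ξ
  have h1 : rho ξ ≤ rho ξ ^ (1 + marg σ) := by
    conv_lhs => rw [← Real.rpow_one (rho ξ)]
    exact Real.rpow_le_rpow_of_exponent_le (one_le_rho ξ) (by unfold marg; linarith)
  have := one_le_kap ξ
  have := rho_pos ξ
  nlinarith

/-! ### The symbol of `∇ × Γ` -/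

/-- The symbol of `∇ × Γ` is `v ↦ i sym(ξ) × v`. -/
noncomputable def sym (γ : ℝ → ℝ) (ξ : E3) : E3 := (2 * Real.pi * γ (2 * Real.pi * ‖ξ‖)) • ξ

lemma kmul_eq (γ : ℝ → ℝ) (f : E3 → C3) (ξ : E3) :
    kmul γ f ξ = Complex.I • cross (toC3 (sym γ ξ)) (f ξ) := by
  rw [kmul, sym, map_smul, ← Complex.coe_smul, cross_smul_left, smul_smul]
  congr 1
  push_cast; ring

lemma sym_neg (γ : ℝ → ℝ) (ξ : E3) : sym γ (-ξ) = -sym γ ξ := by simp [sym]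

lemma AdmissibleSymbol.nonneg {γ : ℝ → ℝ} (hγ : AdmissibleSymbol γ) {r : ℝ} (hr : 0 < r) :
    0 ≤ γ r := by
  obtain ⟨c, hc, h⟩ := hγ.lower
  exact le_trans (by positivity) (h r hr)

/-- A constant that bounds the symbol and its difference quotients. -/
structure SymbolBound (γ : ℝ → ℝ) (C : ℝ) : Prop where
  pos : 0 < C
  norm_le : ∀ ξ : E3, ‖sym γ ξ‖ ≤ C * kap ξ
  norm_sub_le : ∀ ξ η : E3, ‖ξ - η‖ ≤ ‖η‖ / 2 →
    ‖sym γ ξ - sym γ η‖ * (2 * Real.pi * ‖η‖) ≤ C * rho (ξ - η)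

/-- The size of `sym` is `r γ(r) ≲ 1 + r⁻¹`. For the difference, `|γ'| ≲ γ/r` and the mean value
theorem on `[q/2, 3q/2]`, `q = 2π|η|`, give `|sym ξ - sym η| q ≲ d (1 + 1/q)` with `d = 2π|ξ - η|`;
since `d ≤ q/2`, the singular term `d/q` is harmless. -/
lemma AdmissibleSymbol.exists_bound {γ : ℝ → ℝ} (hγ : AdmissibleSymbol γ) :
    ∃ C, SymbolBound γ C := by
  obtain ⟨C₁, hC₁, hup⟩ := hγ.upper
  obtain ⟨C₂, hC₂, hder⟩ := hγ.deriv_bound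
  have hpi := Real.pi_pos
  -- The `8` in the bound for `γ'` on `[q/2, 3q/2]` times `|ζ| ≤ 3q/2` gives `12 C₁ C₂`; the other
  -- `C₁` bounds the contribution of `γ(q) d`.
  refine ⟨12 * C₁ * C₂ + C₁, by positivity, ?_, ?_⟩
  · intro ξ
    rcases eq_or_ne ξ 0 with rfl | hξ
    · have := kap_pos 0
      simp only [sym, smul_zero, norm_zero]; positivity
    have hn := norm_pos_iff.2 hξ
    set r := 2 * Real.pi * ‖ξ‖ with hr
    have hr0 : 0 < r := by positivity
    have h1 := hup r hr0
    have h2 : ‖sym γ ξ‖ = γ r * r := by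
      rw [sym, norm_smul, ← hr, Real.norm_of_nonneg (mul_nonneg (by positivity) (hγ.nonneg hr0))]
      rw [hr]; ring
    have h3 : γ r * r ≤ C₁ * kap ξ := by
      calc γ r * r ≤ C₁ * (r⁻¹ + (r ^ 2)⁻¹) * r := by gcongr
        _ = C₁ * kap ξ := by unfold kap; rw [← hr]; field_simp
    rw [h2]
    have := kap_pos ξ
    have : 0 ≤ 12 * C₁ * C₂ * kap ξ := by positivity
    linarith
  · intro ξ η h
    rcases eq_or_ne η 0 with rfl | hη
    · have := rho_pos (ξ - 0)
      simp only [norm_zero, mul_zero]; positivity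
    have hn := norm_pos_iff.2 hη
    set r := 2 * Real.pi * ‖ξ‖ with hr
    set q := 2 * Real.pi * ‖η‖ with hq
    set d := 2 * Real.pi * ‖ξ - η‖ with hd
    have hq0 : 0 < q := by positivity
    have hd0 : 0 ≤ d := by positivity
    have hdq : d ≤ q / 2 := by
      rw [hd, hq]; nlinarith
    have hrq : |r - q| ≤ d := by
      rw [hr, hq, hd, ← mul_sub, abs_mul, abs_of_pos (by positivity : 0 < 2 * Real.pi)]
      gcongr
      exact abs_norm_sub_norm_le ξ η
    have hr1 : q / 2 ≤ r := by linarith [(abs_le.1 hrq).1]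
    have hr2 : r ≤ 3 * q / 2 := by linarith [(abs_le.1 hrq).2]
    have hγd : |γ r - γ q| ≤ (C₁ * C₂ * (8 * (q⁻¹ + (q ^ 2)⁻¹) / q)) * |r - q| := by
      have hmv := (convex_Icc (q / 2) (3 * q / 2)).norm_image_sub_le_of_norm_deriv_le
        (f := γ) (C := C₁ * C₂ * (8 * (q⁻¹ + (q ^ 2)⁻¹) / q)) (x := q) (y := r)
        (fun x hx => hγ.differentiableAt x (by linarith [hx.1]))
        (fun x hx => by
          have hx0 : 0 < x := by linarith [hx.1]
          have hxq : x⁻¹ ≤ 2 * q⁻¹ := by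
            calc x⁻¹ ≤ (q / 2)⁻¹ := by gcongr; exact hx.1
              _ = 2 * q⁻¹ := by field_simp
          have h1 := hder x hx0
          have h2 := hup x hx0
          have h3 : |deriv γ x| ≤ C₂ * γ x * x⁻¹ := by
            rw [← div_eq_mul_inv, le_div_iff₀ hx0]; linarith
          rw [Real.norm_eq_abs]
          have h4 : γ x ≤ C₁ * (2 * q⁻¹ + (2 * q⁻¹) ^ 2) := by
            refine h2.trans ?_
            rw [← inv_pow]
            gcongr
          calc |deriv γ x| ≤ C₂ * γ x * x⁻¹ := h3
            _ ≤ C₂ * (C₁ * (2 * q⁻¹ + (2 * q⁻¹) ^ 2)) * (2 * q⁻¹) := by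
              have := hγ.nonneg hx0
              gcongr
            _ ≤ C₁ * C₂ * (8 * (q⁻¹ + (q ^ 2)⁻¹) / q) := by
              have e : C₁ * C₂ * (8 * (q⁻¹ + (q ^ 2)⁻¹) / q)
                  - C₂ * (C₁ * (2 * q⁻¹ + (2 * q⁻¹) ^ 2)) * (2 * q⁻¹)
                  = 4 * C₁ * C₂ * (q⁻¹) ^ 2 := by field_simp; ring
              have : 0 ≤ 4 * C₁ * C₂ * (q⁻¹) ^ 2 := by positivity
              linarith)
        ⟨by linarith, by linarith⟩ ⟨hr1, hr2⟩
      simpa [Real.norm_eq_abs] using hmv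
    have hs1 : sym γ ξ - sym γ η
        = (2 * Real.pi * (γ r - γ q)) • ξ + (2 * Real.pi * γ q) • (ξ - η) := by
      simp only [sym, ← hr, ← hq]; module
    have hs2 : ‖sym γ ξ - sym γ η‖ ≤ |γ r - γ q| * r + γ q * d := by
      rw [hs1]
      refine (norm_add_le _ _).trans (le_of_eq ?_)
      rw [norm_smul, norm_smul, Real.norm_eq_abs, Real.norm_eq_abs, abs_mul (2 * Real.pi),
        abs_mul (2 * Real.pi), abs_of_pos (by positivity : 0 < 2 * Real.pi), abs_of_nonneg (hγ.nonneg hq0), hr, hd]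
      ring
    have hrho : d + 1 / 2 ≤ rho (ξ - η) := by
      unfold rho; rw [← hd]; linarith
    calc ‖sym γ ξ - sym γ η‖ * q ≤ (|γ r - γ q| * r + γ q * d) * q := by gcongr
      _ ≤ ((C₁ * C₂ * (8 * (q⁻¹ + (q ^ 2)⁻¹) / q)) * d * (3 * q / 2)
            + C₁ * (q⁻¹ + (q ^ 2)⁻¹) * d) * q := by
          have := hup q hq0
          have h0 : 0 ≤ C₁ * C₂ * (8 * (q⁻¹ + (q ^ 2)⁻¹) / q) := by positivity
          have h5 : |γ r - γ q| ≤ (C₁ * C₂ * (8 * (q⁻¹ + (q ^ 2)⁻¹) / q)) * d :=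
            hγd.trans (by gcongr)
          gcongr
      _ = (12 * C₁ * C₂ + C₁) * (d + d / q) := by field_simp; ring
      _ ≤ (12 * C₁ * C₂ + C₁) * (d + 1 / 2) := by
          have : d / q ≤ 1 / 2 := by rw [div_le_iff₀ hq0]; linarith
          gcongr
      _ ≤ _ := by gcongr

/-- Outside `(0, ∞)` the function `γ` is arbitrary, so it is replaced by a constant there; only the
value at `ξ = 0` is affected, and the factor `ξ` annihilates it. -/
lemma AdmissibleSymbol.measurable_sym {γ : ℝ → ℝ} (hγ : AdmissibleSymbol γ) :
    Measurable (sym γ) := by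
  classical
  have hc : ContinuousOn γ (Ioi 0) := fun r hr =>
    (hγ.differentiableAt r hr).continuousAt.continuousWithinAt
  have hm : Measurable ((Ioi (0 : ℝ)).piecewise γ fun _ => γ 0) :=
    hc.measurable_piecewise continuousOn_const measurableSet_Ioi
  have he : sym γ = fun ξ => (2 * Real.pi *
      (Ioi (0 : ℝ)).piecewise γ (fun _ => γ 0) (2 * Real.pi * ‖ξ‖)) • ξ := by
    ext1 ξ
    rcases eq_or_ne ξ 0 with rfl | hξ
    · simp [sym]
    · have : 2 * Real.pi * ‖ξ‖ ∈ Ioi (0 : ℝ) := by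
        have := norm_pos_iff.2 hξ; have := Real.pi_pos
        simp only [mem_Ioi]; positivity
      rw [Set.piecewise_eq_of_mem _ _ _ this]; rfl
  rw [he]
  exact ((hm.comp (by fun_prop)).const_mul _).smul measurable_id

lemma AdmissibleSymbol.measurable_kmul {γ : ℝ → ℝ} (hγ : AdmissibleSymbol γ) {f : E3 → C3}
    (hf : Measurable f) : Measurable (kmul γ f) := by
  have : kmul γ f = fun ξ => Complex.I • cross (toC3 (sym γ ξ)) (f ξ) := by
    ext1 ξ; exact kmul_eq γ f ξ
  rw [this]
  exact (measurable_cross (measurable_toC3.comp hγ.measurable_sym) hf).const_smul Complex.I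

lemma SymbolBound.norm_kmul_le {γ : ℝ → ℝ} {C : ℝ} (h : SymbolBound γ C) (f : E3 → C3) (ξ : E3) :
    ‖kmul γ f ξ‖ ≤ C * kap ξ * ‖f ξ‖ := by
  rw [kmul_eq, norm_smul, Complex.norm_I, one_mul]
  refine (norm_cross_le _ _).trans ?_
  rw [norm_toC3]
  gcongr
  exact h.norm_le ξ

lemma SymbolBound.enorm_kmul_le {γ : ℝ → ℝ} {C : ℝ} (h : SymbolBound γ C) (f : E3 → C3) (ξ : E3) :
    ‖kmul γ f ξ‖ₑ ≤ ENNReal.ofReal C * (ENNReal.ofReal (kap ξ) * ‖f ξ‖ₑ) := by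
  rw [← ofReal_norm, ← ofReal_norm, ← ENNReal.ofReal_mul (kap_pos ξ).le,
    ← ENNReal.ofReal_mul h.pos.le, ← mul_assoc]
  exact ENNReal.ofReal_le_ofReal (h.norm_kmul_le f ξ)

lemma kmul_sub (γ : ℝ → ℝ) (f g : E3 → C3) : kmul γ (f - g) = kmul γ f - kmul γ g := by
  ext1 ξ
  simp only [kmul, Pi.sub_apply, cross_sub_right, smul_sub]

/-! ### The nonlinearity in `L²` -/

lemma measurable_convCross {a b : E3 → C3} (ha : Measurable a) (hb : Measurable b) :
    Measurable (convCross a b) := by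
  have h : Measurable (Function.uncurry fun ξ η : E3 => cross (a (ξ - η)) (b η)) :=
    measurable_cross (ha.comp (measurable_fst.sub measurable_snd)) (hb.comp measurable_snd)
  exact (StronglyMeasurable.integral_prod_right h.stronglyMeasurable).measurable

lemma AdmissibleSymbol.measurable_quadHat {γ : ℝ → ℝ} (hγ : AdmissibleSymbol γ) {f g : E3 → C3}
    (hf : Measurable f) (hg : Measurable g) : Measurable (quadHat γ f g) :=
  (measurable_cross measurable_toC3
    (measurable_convCross (hγ.measurable_kmul hf) hg)).const_smul (-(2 * Real.pi * Complex.I))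

lemma kmul_congr_ae {γ : ℝ → ℝ} {f f' : E3 → C3} (h : f =ᵐ[volume] f') :
    kmul γ f =ᵐ[volume] kmul γ f' := by
  filter_upwards [h] with ξ hξ
  simp only [kmul, hξ]

lemma ae_comp_sub_left {p : E3 → Prop} (h : ∀ᵐ x, p x) (ξ : E3) : ∀ᵐ η, p (ξ - η) :=
  (quasiMeasurePreserving_sub_left volume ξ).ae h

lemma quadHat_congr_ae {γ : ℝ → ℝ} {f f' g g' : E3 → C3} (hf : f =ᵐ[volume] f')
    (hg : g =ᵐ[volume] g') : quadHat γ f g = quadHat γ f' g' := by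
  ext1 ξ
  unfold quadHat convCross
  congr 2
  apply integral_congr_ae
  filter_upwards [ae_comp_sub_left (kmul_congr_ae (γ := γ) hf) ξ, hg] with η h1 h2
  rw [h1, h2]

lemma eLpNorm_eq_l2 (f : E3 → C3) : eLpNorm f 2 volume = l2 fun ξ => ‖f ξ‖ₑ := by
  rw [eLpNorm_eq_lintegral_rpow_enorm_toReal (by norm_num) (by norm_num), l2]
  simp

lemma enorm_quadHat_le (γ : ℝ → ℝ) (f g : E3 → C3) (ξ : E3) :
    ‖quadHat γ f g ξ‖ₑ
      ≤ ENNReal.ofReal (rho ξ) * ∫⁻ η, ‖g η‖ₑ * ‖kmul γ f (ξ - η)‖ₑ := by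
  have h1 : ‖quadHat γ f g ξ‖ ≤ rho ξ * ‖convCross (kmul γ f) g ξ‖ := by
    rw [quadHat, norm_smul]
    have h2 : ‖(-(2 * Real.pi * Complex.I) : ℂ)‖ = 2 * Real.pi := by
      simp [abs_of_pos Real.pi_pos]
    have h3 := norm_cross_le (toC3 ξ) (convCross (kmul γ f) g ξ)
    rw [norm_toC3] at h3
    rw [h2]
    have hpi := Real.pi_pos
    calc 2 * Real.pi * ‖cross (toC3 ξ) (convCross (kmul γ f) g ξ)‖
        ≤ 2 * Real.pi * (‖ξ‖ * ‖convCross (kmul γ f) g ξ‖) := by gcongr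
      _ = (2 * Real.pi * ‖ξ‖) * ‖convCross (kmul γ f) g ξ‖ := by ring
      _ ≤ _ := by gcongr; unfold rho; linarith
  calc ‖quadHat γ f g ξ‖ₑ ≤ ENNReal.ofReal (rho ξ) * ‖convCross (kmul γ f) g ξ‖ₑ := by
        rw [← ofReal_norm, ← ofReal_norm, ← ENNReal.ofReal_mul (rho_pos ξ).le]
        exact ENNReal.ofReal_le_ofReal h1
    _ ≤ _ := by
        gcongr
        refine (enorm_integral_le_lintegral_enorm _).trans ?_
        gcongr with η
        rw [mul_comm, ← ofReal_norm, ← ofReal_norm, ← ofReal_norm,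
          ← ENNReal.ofReal_mul (norm_nonneg _)]
        exact ENNReal.ofReal_le_ofReal (norm_cross_le _ _)

/-- The outer derivative and the extra weight form `rho^(1 + marg σ)`, which splits over the two
inputs. Young's inequality then takes `g` in `L²` and the velocity in weighted `L¹`. The surplus
`rho^(marg σ)` yields the convergence rate of the frequency cut-offs. -/
lemma exists_quadHat_bound {γ : ℝ → ℝ} (hγ : AdmissibleSymbol γ) {σ : ℝ} (hσ : 5 / 2 < σ) :
    ∃ C : ℝ, 0 < C ∧ ∀ f g : E3 → C3, Measurable f → Measurable g →
      l2 (fun ξ => ENNReal.ofReal (rho ξ ^ marg σ) * ‖quadHat γ f g ξ‖ₑ)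
        ≤ ENNReal.ofReal C * (hs σ f * hs σ g) := by
  obtain ⟨C₁, hC₁⟩ := hγ.exists_bound
  obtain ⟨C₂, hC₂, hvn⟩ := exists_vn_le hσ
  have hm : 0 < marg σ := by unfold marg; linarith
  have hm2 : 1 + marg σ ≤ σ := by unfold marg; linarith
  refine ⟨2 ^ (σ / 2) * (C₁ * C₂), by have := hC₁.pos; positivity, fun f g hf hg => ?_⟩
  have hpt : ∀ ξ, ENNReal.ofReal (rho ξ ^ marg σ) * ‖quadHat γ f g ξ‖ₑ
      ≤ ∫⁻ η, (ENNReal.ofReal (rho η ^ (1 + marg σ)) * ‖g η‖ₑ) *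
          (ENNReal.ofReal C₁ * (ENNReal.ofReal (vwt σ (ξ - η)) * ‖f (ξ - η)‖ₑ)) := by
    intro ξ
    have hr := rho_pos ξ
    calc ENNReal.ofReal (rho ξ ^ marg σ) * ‖quadHat γ f g ξ‖ₑ
        ≤ ENNReal.ofReal (rho ξ ^ marg σ) *
            (ENNReal.ofReal (rho ξ) * ∫⁻ η, ‖g η‖ₑ * ‖kmul γ f (ξ - η)‖ₑ) := by
          gcongr; exact enorm_quadHat_le γ f g ξ
      _ = ∫⁻ η, ENNReal.ofReal (rho ξ ^ (1 + marg σ)) * (‖g η‖ₑ * ‖kmul γ f (ξ - η)‖ₑ) := by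
          rw [← mul_assoc, ← ENNReal.ofReal_mul (by positivity), lintegral_const_mul' _ _ (by simp),
            Real.rpow_add hr, Real.rpow_one, mul_comm (rho ξ)]
      _ ≤ _ := by
          refine lintegral_mono fun η => ?_
          have h1 : rho ξ ^ (1 + marg σ) ≤ rho (ξ - η) ^ (1 + marg σ) * rho η ^ (1 + marg σ) := by
            rw [← Real.mul_rpow (rho_pos _).le (rho_pos _).le]
            exact Real.rpow_le_rpow hr.le (rho_le_mul ξ η) (by linarith)
          have hr1 := rho_pos (ξ - η)
          have hr2 := rho_pos η
          calc ENNReal.ofReal (rho ξ ^ (1 + marg σ)) * (‖g η‖ₑ * ‖kmul γ f (ξ - η)‖ₑ)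
              ≤ ENNReal.ofReal (rho (ξ - η) ^ (1 + marg σ) * rho η ^ (1 + marg σ)) *
                (‖g η‖ₑ * (ENNReal.ofReal C₁ *
                  (ENNReal.ofReal (kap (ξ - η)) * ‖f (ξ - η)‖ₑ))) := by
                gcongr
                exact hC₁.enorm_kmul_le f _
            _ = _ := by
                unfold vwt
                rw [ENNReal.ofReal_mul (by positivity), ENNReal.ofReal_mul (kap_pos _).le]
                ring
  refine (l2_mono hpt).trans ?_
  refine (l2_conv_le (G := fun η => ENNReal.ofReal (rho η ^ (1 + marg σ)) * ‖g η‖ₑ)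
    (K := fun ζ => ENNReal.ofReal C₁ * (ENNReal.ofReal (vwt σ ζ) * ‖f ζ‖ₑ))
    (by fun_prop) (by fun_prop)).trans ?_
  rw [lintegral_const_mul _ (by fun_prop)]
  have hG : l2 (fun η => ENNReal.ofReal (rho η ^ (1 + marg σ)) * ‖g η‖ₑ)
      ≤ ENNReal.ofReal (2 ^ (σ / 2)) * hs σ g := by
    rw [hs_eq_l2, ← l2_const_mul _ (by fun_prop)]
    apply l2_mono
    intro η
    rw [← mul_assoc, ← ENNReal.ofReal_mul (by positivity)]
    gcongr
    exact rho_rpow_le (by linarith) hm2 η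
  calc _ ≤ (ENNReal.ofReal (2 ^ (σ / 2)) * hs σ g) *
        (ENNReal.ofReal C₁ * (ENNReal.ofReal C₂ * hs σ f)) := by
        gcongr
        exact hvn f hf
    _ = _ := by
        rw [ENNReal.ofReal_mul (by positivity), ENNReal.ofReal_mul hC₁.pos.le]; ring

lemma l2_quadHat_le {γ : ℝ → ℝ} {σ : ℝ} (hσ : 5 / 2 < σ) (f g : E3 → C3) :
    eLpNorm (quadHat γ f g) 2 volume
      ≤ l2 (fun ξ => ENNReal.ofReal (rho ξ ^ marg σ) * ‖quadHat γ f g ξ‖ₑ) := by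
  rw [eLpNorm_eq_l2]
  apply l2_mono
  intro ξ
  conv_lhs => rw [← one_mul (‖quadHat γ f g ξ‖ₑ)]
  gcongr
  rw [← ENNReal.ofReal_one]
  exact ENNReal.ofReal_le_ofReal (Real.one_le_rpow (one_le_rho ξ) (by unfold marg; linarith))

lemma integrable_kmul {γ : ℝ → ℝ} (hγ : AdmissibleSymbol γ) {σ : ℝ} (hσ : 5 / 2 < σ) {f : E3 → C3}
    (hf : Measurable f) (hfs : hs σ f < ⊤) : Integrable (kmul γ f) := by
  obtain ⟨C₁, hC₁⟩ := hγ.exists_bound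
  obtain ⟨C₂, hC₂, hvn⟩ := exists_vn_le hσ
  refine ⟨(hγ.measurable_kmul hf).aestronglyMeasurable, ?_⟩
  calc ∫⁻ ξ, ‖kmul γ f ξ‖ₑ
      ≤ ∫⁻ ξ, ENNReal.ofReal C₁ * (ENNReal.ofReal (vwt σ ξ) * ‖f ξ‖ₑ) := by
        gcongr with ξ
        refine (hC₁.enorm_kmul_le f ξ).trans ?_
        gcongr
        unfold vwt
        exact le_mul_of_one_le_right (kap_pos ξ).le
          (Real.one_le_rpow (one_le_rho ξ) (by unfold marg; linarith))
    _ = ENNReal.ofReal C₁ * vn σ f := by rw [lintegral_const_mul _ (by fun_prop)]; rfl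
    _ ≤ ENNReal.ofReal C₁ * (ENNReal.ofReal C₂ * hs σ f) := by gcongr; exact hvn f hf
    _ < ⊤ := ENNReal.mul_lt_top ENNReal.ofReal_lt_top (ENNReal.mul_lt_top ENNReal.ofReal_lt_top hfs)

lemma integrable_of_hs {σ : ℝ} (hσ : 5 / 2 < σ) {f : E3 → C3}
    (hf : Measurable f) (hfs : hs σ f < ⊤) : Integrable f := by
  obtain ⟨C₂, hC₂, hvn⟩ := exists_vn_le hσ
  refine ⟨hf.aestronglyMeasurable, ?_⟩
  calc ∫⁻ ξ, ‖f ξ‖ₑ ≤ yn f := by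
        unfold yn
        gcongr with ξ
        conv_lhs => rw [← one_mul (‖f ξ‖ₑ), ← ENNReal.ofReal_one]
        gcongr
        exact one_le_rho ξ
    _ ≤ vn σ f := yn_le_vn hσ f
    _ ≤ ENNReal.ofReal C₂ * hs σ f := hvn f hf
    _ < ⊤ := ENNReal.mul_lt_top ENNReal.ofReal_lt_top hfs

lemma ae_integrable_cross {a b : E3 → C3} (ha : Integrable a) (hb : Integrable b) :
    ∀ᵐ ξ, Integrable fun η => cross (a (ξ - η)) (b η) := by
  have := hb.ae_convolution_exists crossL.flip ha
  exact this

/-- Bilinearity is only almost everywhere, because the convolution integrals converge only for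
almost every `ξ`. -/
lemma quadHat_sub_left {γ : ℝ → ℝ} (hγ : AdmissibleSymbol γ) {σ : ℝ} (hσ : 5 / 2 < σ)
    {f f' g : E3 → C3} (hf : Measurable f) (hf' : Measurable f') (hg : Measurable g)
    (hfs : hs σ f < ⊤) (hfs' : hs σ f' < ⊤) (hgs : hs σ g < ⊤) :
    quadHat γ (f - f') g =ᵐ[volume] quadHat γ f g - quadHat γ f' g := by
  filter_upwards [ae_integrable_cross (integrable_kmul hγ hσ hf hfs) (integrable_of_hs hσ hg hgs),
    ae_integrable_cross (integrable_kmul hγ hσ hf' hfs') (integrable_of_hs hσ hg hgs)] with ξ h1 h2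
  simp only [quadHat, convCross, kmul_sub, Pi.sub_apply, cross_sub_left]
  rw [integral_sub h1 h2, cross_sub_right, smul_sub]

lemma quadHat_sub_right {γ : ℝ → ℝ} (hγ : AdmissibleSymbol γ) {σ : ℝ} (hσ : 5 / 2 < σ)
    {f g g' : E3 → C3} (hf : Measurable f) (hg : Measurable g) (hg' : Measurable g')
    (hfs : hs σ f < ⊤) (hgs : hs σ g < ⊤) (hgs' : hs σ g' < ⊤) :
    quadHat γ f (g - g') =ᵐ[volume] quadHat γ f g - quadHat γ f g' := by
  filter_upwards [ae_integrable_cross (integrable_kmul hγ hσ hf hfs) (integrable_of_hs hσ hg hgs),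
    ae_integrable_cross (integrable_kmul hγ hσ hf hfs) (integrable_of_hs hσ hg' hgs')] with ξ h1 h2
  simp only [quadHat, convCross, Pi.sub_apply, cross_sub_right]
  rw [integral_sub h1 h2, cross_sub_right, smul_sub]

/-! ### Solenoidal real fields and kernel bounds -/

/-- A representative of the Fourier transform of a real divergence-free field. -/
structure NiceField (f : E3 → C3) : Prop where
  meas : Measurable f
  herm : ∀ ξ, f (-ξ) = conjC3 (f ξ)
  div : ∀ ξ, dotC3 (toC3 ξ) (f ξ) = 0

lemma NiceField.kmul {γ : ℝ → ℝ} (hγ : AdmissibleSymbol γ) {f : E3 → C3} (hf : NiceField f) :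
    NiceField (kmul γ f) where
  meas := hγ.measurable_kmul hf.meas
  herm ξ := by
    rw [kmul_eq, kmul_eq, sym_neg, hf.herm, map_neg, cross_neg_left, conjC3_smul, conjC3_cross,
      conjC3_toC3]
    simp
  div ξ := by rw [ActiveVector.kmul, dotC3_smul_right, dotC3_cross_self, mul_zero]

lemma NiceField.sub {f g : E3 → C3} (hf : NiceField f) (hg : NiceField g) :
    NiceField (f - g) where
  meas := hf.meas.sub hg.meas
  herm ξ := by simp [hf.herm, hg.herm, conjC3_sub]
  div ξ := by
    have h1 := hf.div ξ
    have h2 := hg.div ξ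
    simp only [dotC3] at h1 h2 ⊢
    simp only [Pi.sub_apply, PiLp.sub_apply]
    linear_combination h1 - h2

/-- The divergence condition enters the estimates here: the derivative may be placed on either of
the two frequencies `ξ` and `η`. -/
lemma NiceField.dot_eq {f : E3 → C3} (hf : NiceField f) (ξ η : E3) :
    dotC3 (toC3 ξ) (f (ξ - η)) = dotC3 (toC3 η) (f (ξ - η)) := by
  have h := hf.div (ξ - η)
  rw [map_sub, dotC3_sub_left] at h
  exact sub_eq_zero.1 h

lemma NiceField.norm_dot_le {f : E3 → C3} (hf : NiceField f) (ξ η : E3) :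
    ‖dotC3 (toC3 ξ) (f (ξ - η))‖ ≤ ‖η‖ * ‖f (ξ - η)‖ := by
  rw [hf.dot_eq, ← norm_toC3 η]; exact norm_dotC3_le _ _

lemma NiceField.norm_dot_le' (f : E3 → C3) (ξ η : E3) :
    ‖dotC3 (toC3 ξ) (f (ξ - η))‖ ≤ ‖ξ‖ * ‖f (ξ - η)‖ := by
  rw [← norm_toC3 ξ]; exact norm_dotC3_le _ _

/-- The advecting factor is invariant under exchange of `ξ` and `η` followed by conjugation, so
symmetrization acts on the remaining factors alone. -/
lemma NiceField.conj_dot {f : E3 → C3} (hf : NiceField f) (ξ η : E3) :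
    (starRingEnd ℂ) (dotC3 (toC3 η) (f (η - ξ))) = dotC3 (toC3 ξ) (f (ξ - η)) := by
  rw [conj_dotC3, conjC3_toC3, ← hf.herm, neg_sub, hf.dot_eq]

/-- Bounded weights that vary slowly, with a constant `A` for the variation. -/
structure WeightBound (W : E3 → ℝ) (A : ℝ) : Prop where
  meas : Measurable W
  nonneg : ∀ ξ, 0 ≤ W ξ
  bdd : ∃ M : ℝ, ∀ ξ, W ξ ≤ M
  one_le : 1 ≤ A
  dbl : ∀ ξ η : E3, ‖ξ‖ ≤ 3 * ‖η‖ → W ξ ≤ A * W η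
  lip : ∀ ξ η : E3, ‖ξ - η‖ ≤ ‖η‖ / 2 → |W ξ - W η| * ‖η‖ ≤ A * ‖ξ - η‖ * W η

/-- The constant weight turns the weighted machinery into the `L²` estimate for differences. -/
lemma WeightBound.one : WeightBound (fun _ => 1) 1 where
  meas := measurable_const
  nonneg _ := zero_le_one
  bdd := ⟨1, fun _ => le_rfl⟩
  one_le := le_rfl
  dbl _ _ _ := by norm_num
  lip ξ η _ := by simp

/-- A bound for the symmetrized kernels, up to a constant. -/
noncomputable def kerBound (W : E3 → ℝ) (ξ η : E3) : ℝ :=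
  if ‖ξ - η‖ ≤ ‖η‖ / 2 then W η * rho (ξ - η) else W ξ * rho η + W η * rho ξ

lemma norm_le_of_far {ξ η : E3} (h : ¬ ‖ξ - η‖ ≤ ‖η‖ / 2) :
    ‖η‖ ≤ 2 * ‖ξ - η‖ ∧ ‖ξ‖ ≤ 3 * ‖ξ - η‖ ∧ 0 < ‖ξ - η‖ := by
  push Not at h
  have h1 : ‖ξ‖ ≤ ‖ξ - η‖ + ‖η‖ := by simpa using norm_add_le (ξ - η) η
  have h2 := norm_nonneg η
  exact ⟨by linarith, by linarith, by linarith⟩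

lemma norm_mul_kap_le' (ξ : E3) : ‖ξ‖ * kap ξ ≤ rho ξ := by
  have h := norm_mul_kap_le ξ
  have hpi := Real.pi_gt_three
  have : 0 ≤ ‖ξ‖ * kap ξ := mul_nonneg (norm_nonneg _) (kap_pos ξ).le
  nlinarith

/-- The divergence condition supplies the factor `‖η‖`. Near the diagonal, the commutator is split
into a difference of `W` and a difference of `sym`, and each gains back `‖η‖`. Far from it no
cancellation is used: `‖η‖` or `‖ξ‖`, whichever matches, absorbs the singularity of the symbol. -/
lemma stretching_kernel_le {γ : ℝ → ℝ} {C A : ℝ} (hC : SymbolBound γ C) {W : E3 → ℝ}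
    (hW : WeightBound W A) {g : E3 → C3} (hg : NiceField g) (ξ η : E3) :
    ‖W ξ • sym γ η - W η • sym γ ξ‖ * ‖dotC3 (toC3 ξ) (g (ξ - η))‖
      ≤ (A * C + C) * kerBound W ξ η * ‖g (ξ - η)‖ := by
  have hpi := Real.pi_gt_three
  have hCp := hC.pos
  have hA := hW.one_le
  have hWη := hW.nonneg η
  have hWξ := hW.nonneg ξ
  have hρ := rho_pos (ξ - η)
  unfold kerBound
  split_ifs with h
  -- Only `W η` is kept as the undifferentiated weight, since the bound near the diagonal involves
  -- `W η` alone.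
  · have e : W ξ • sym γ η - W η • sym γ ξ
        = (W ξ - W η) • sym γ η - W η • (sym γ ξ - sym γ η) := by module
    have h1 : ‖W ξ • sym γ η - W η • sym γ ξ‖
        ≤ |W ξ - W η| * (C * kap η) + W η * ‖sym γ ξ - sym γ η‖ := by
      rw [e]
      refine (norm_sub_le _ _).trans ?_
      rw [norm_smul, norm_smul, Real.norm_eq_abs, Real.norm_eq_abs, abs_of_nonneg hWη]
      gcongr
      exact hC.norm_le η
    have h2 := hC.norm_sub_le ξ η h
    have h3 := hW.lip ξ η h
    have h4 : ‖ξ - η‖ * kap η ≤ rho (ξ - η) := by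
      unfold kap rho
      rcases eq_or_ne η 0 with rfl | hη
      · simp only [norm_zero, mul_zero, inv_zero, add_zero, mul_one]
        have := norm_nonneg (ξ - 0)
        nlinarith
      · have hn := norm_pos_iff.2 hη
        have : ‖ξ - η‖ * (2 * Real.pi * ‖η‖)⁻¹ ≤ 1 := by
          rw [← div_eq_mul_inv, div_le_one (by positivity)]
          nlinarith
        have := norm_nonneg (ξ - η)
        nlinarith
    have hk := kap_pos η
    have hn := norm_nonneg η
    have hs := norm_nonneg (sym γ ξ - sym γ η)
    calc ‖W ξ • sym γ η - W η • sym γ ξ‖ * ‖dotC3 (toC3 ξ) (g (ξ - η))‖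
        ≤ (|W ξ - W η| * (C * kap η) + W η * ‖sym γ ξ - sym γ η‖) * (‖η‖ * ‖g (ξ - η)‖) := by
          gcongr
          exact hg.norm_dot_le ξ η
      _ = ((|W ξ - W η| * ‖η‖) * (C * kap η) + W η * (‖sym γ ξ - sym γ η‖ * ‖η‖))
            * ‖g (ξ - η)‖ := by ring
      _ ≤ ((A * ‖ξ - η‖ * W η) * (C * kap η) + W η * (C * rho (ξ - η))) * ‖g (ξ - η)‖ := by
          have h2' : ‖sym γ ξ - sym γ η‖ * ‖η‖ ≤ C * rho (ξ - η) := by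
            refine le_trans ?_ h2
            gcongr
            nlinarith
          exact mul_le_mul_of_nonneg_right (add_le_add
            (mul_le_mul_of_nonneg_right h3 (by positivity))
            (mul_le_mul_of_nonneg_left h2' hWη)) (norm_nonneg _)
      _ = (A * C * W η * (‖ξ - η‖ * kap η) + C * W η * rho (ξ - η)) * ‖g (ξ - η)‖ := by ring
      _ ≤ (A * C * W η * rho (ξ - η) + C * W η * rho (ξ - η)) * ‖g (ξ - η)‖ := by gcongr
      _ = _ := by ring
  · have h1 : ‖W ξ • sym γ η - W η • sym γ ξ‖ ≤ W ξ * (C * kap η) + W η * (C * kap ξ) := by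
      refine (norm_sub_le _ _).trans ?_
      rw [norm_smul, norm_smul, Real.norm_of_nonneg hWη, Real.norm_of_nonneg hWξ]
      gcongr
      · exact hC.norm_le η
      · exact hC.norm_le ξ
    have hk := kap_pos η
    have hk' := kap_pos ξ
    set d := ‖dotC3 (toC3 ξ) (g (ξ - η))‖ with hd
    have hd0 : 0 ≤ d := norm_nonneg _
    have d1 := hg.norm_dot_le ξ η
    have d2 := NiceField.norm_dot_le' g ξ η
    have hr1 := rho_pos ξ
    have hr2 := rho_pos η
    calc ‖W ξ • sym γ η - W η • sym γ ξ‖ * d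
        ≤ (W ξ * (C * kap η) + W η * (C * kap ξ)) * d := by gcongr
      _ = W ξ * (C * kap η) * d + W η * (C * kap ξ) * d := by ring
      _ ≤ W ξ * (C * kap η) * (‖η‖ * ‖g (ξ - η)‖) + W η * (C * kap ξ) * (‖ξ‖ * ‖g (ξ - η)‖) := by
          gcongr
      _ = C * (W ξ * (‖η‖ * kap η) + W η * (‖ξ‖ * kap ξ)) * ‖g (ξ - η)‖ := by ring
      _ ≤ C * (W ξ * rho η + W η * rho ξ) * ‖g (ξ - η)‖ := by
          gcongr
          · exact norm_mul_kap_le' η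
          · exact norm_mul_kap_le' ξ
      _ ≤ (A * C + C) * (W ξ * rho η + W η * rho ξ) * ‖g (ξ - η)‖ := by
          gcongr
          nlinarith

/-- The velocity may be singular at `ξ = η`. Near the diagonal the slow variation of `W` provides
the factor `‖ξ - η‖` that cancels `kap (ξ - η)`; far from it, `‖ξ‖` and `‖η‖` are themselves at most
a multiple of `‖ξ - η‖`. -/
lemma transport_kernel_le {γ : ℝ → ℝ} (hγ : AdmissibleSymbol γ) {C A : ℝ} (hC : SymbolBound γ C)
    {W : E3 → ℝ} (hW : WeightBound W A) {f : E3 → C3} (hf : NiceField f) (ξ η : E3) :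
    |W ξ - W η| * ‖dotC3 (toC3 ξ) (kmul γ f (ξ - η))‖
      ≤ (A * C + C) * kerBound W ξ η * ‖f (ξ - η)‖ := by
  have hpi := Real.pi_gt_three
  have hCp := hC.pos
  have hA := hW.one_le
  have hWη := hW.nonneg η
  have hWξ := hW.nonneg ξ
  have hρ := rho_pos (ξ - η)
  have hka := hC.norm_kmul_le f (ξ - η)
  have hk := kap_pos (ξ - η)
  have d1 := (hf.kmul hγ).norm_dot_le ξ η
  have d2 := NiceField.norm_dot_le' (kmul γ f) ξ η
  set d := ‖dotC3 (toC3 ξ) (kmul γ f (ξ - η))‖ with hd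
  unfold kerBound
  split_ifs with h
  · have h3 := hW.lip ξ η h
    calc |W ξ - W η| * d ≤ |W ξ - W η| * (‖η‖ * (C * kap (ξ - η) * ‖f (ξ - η)‖)) := by
          gcongr
          exact d1.trans (by gcongr)
      _ = (|W ξ - W η| * ‖η‖) * (C * kap (ξ - η) * ‖f (ξ - η)‖) := by ring
      _ ≤ (A * ‖ξ - η‖ * W η) * (C * kap (ξ - η) * ‖f (ξ - η)‖) := by gcongr
      _ = A * C * (W η * (‖ξ - η‖ * kap (ξ - η))) * ‖f (ξ - η)‖ := by ring
      _ ≤ A * C * (W η * rho (ξ - η)) * ‖f (ξ - η)‖ := by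
          gcongr; exact norm_mul_kap_le' _
      _ ≤ (A * C + C) * (W η * rho (ξ - η)) * ‖f (ξ - η)‖ := by
          gcongr; linarith
  · obtain ⟨h1, h2, h3⟩ := norm_le_of_far h
    have key : ∀ x : E3, ‖x‖ ≤ 3 * ‖ξ - η‖ → ‖x‖ * kap (ξ - η) ≤ rho x := by
      intro x hx
      unfold kap rho
      have : ‖x‖ * (2 * Real.pi * ‖ξ - η‖)⁻¹ ≤ 1 := by
        rw [← div_eq_mul_inv, div_le_one (by positivity)]
        nlinarith
      have := norm_nonneg x
      nlinarith
    have habs : |W ξ - W η| ≤ W ξ + W η := by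
      rw [abs_le]; constructor <;> linarith
    have hd0 : 0 ≤ d := norm_nonneg _
    calc |W ξ - W η| * d ≤ (W ξ + W η) * d := by gcongr
      _ = W ξ * d + W η * d := by ring
      _ ≤ W ξ * (‖η‖ * (C * kap (ξ - η) * ‖f (ξ - η)‖))
            + W η * (‖ξ‖ * (C * kap (ξ - η) * ‖f (ξ - η)‖)) := by
          gcongr
          · exact d1.trans (by gcongr)
          · exact d2.trans (by gcongr)
      _ = C * (W ξ * (‖η‖ * kap (ξ - η)) + W η * (‖ξ‖ * kap (ξ - η))) * ‖f (ξ - η)‖ := by ring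
      _ ≤ C * (W ξ * rho η + W η * rho ξ) * ‖f (ξ - η)‖ := by
          gcongr
          · exact key η (by linarith)
          · exact key ξ h2
      _ ≤ (A * C + C) * (W ξ * rho η + W η * rho ξ) * ‖f (ξ - η)‖ := by
          have := rho_pos ξ
          have := rho_pos η
          gcongr
          nlinarith

lemma WeightBound.le_sqrt_mul {W : E3 → ℝ} {A : ℝ} (hW : WeightBound W A) {ξ η : E3}
    (h : ‖ξ‖ ≤ 3 * ‖η‖) : W ξ ≤ A * (√(W ξ) * √(W η)) := by
  have h1 := hW.dbl ξ η h
  have hA := hW.one_le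
  have hWξ := hW.nonneg ξ
  have hWη := hW.nonneg η
  calc W ξ = √(W ξ) * √(W ξ) := (Real.mul_self_sqrt hWξ).symm
    _ ≤ √(W ξ) * √(A * W η) := by gcongr
    _ = √(W ξ) * (√A * √(W η)) := by rw [Real.sqrt_mul (by linarith)]
    _ ≤ √(W ξ) * (A * √(W η)) := by
        gcongr
        rw [Real.sqrt_le_left (by linarith)]
        nlinarith
    _ = _ := by ring

/-- In each term the weight is shared as square roots between two of the three frequencies, and the
derivative sits on the remaining one. Doubling permits this: near the diagonal `‖η‖ ≤ 2‖ξ‖`, and far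
from it `‖ξ‖, ‖η‖ ≤ 3‖ξ - η‖`. -/
lemma kerBound_le {W : E3 → ℝ} {A : ℝ} (hW : WeightBound W A) (ξ η : E3) :
    kerBound W ξ η ≤ A * (√(W ξ) * √(W η) * rho (ξ - η) + √(W ξ) * √(W (ξ - η)) * rho η
      + √(W η) * √(W (ξ - η)) * rho ξ) := by
  have hr0 := rho_pos (ξ - η)
  have hr1 := rho_pos ξ
  have hr2 := rho_pos η
  have hA := hW.one_le
  have t1 : 0 ≤ A * (√(W ξ) * √(W η) * rho (ξ - η)) := by positivity
  have t2 : 0 ≤ A * (√(W ξ) * √(W (ξ - η)) * rho η) := by positivity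
  have t3 : 0 ≤ A * (√(W η) * √(W (ξ - η)) * rho ξ) := by positivity
  unfold kerBound
  split_ifs with h
  · have h1 : ‖η‖ ≤ 3 * ‖ξ‖ := by
      have : ‖η‖ ≤ ‖ξ - η‖ + ‖ξ‖ := by
        have := norm_sub_le ξ (ξ - η)
        simp only [sub_sub_cancel] at this
        linarith
      have := norm_nonneg ξ
      linarith
    have := mul_le_mul_of_nonneg_right (hW.le_sqrt_mul h1) hr0.le
    nlinarith
  · obtain ⟨h1, h2, h3⟩ := norm_le_of_far h
    have e1 := mul_le_mul_of_nonneg_right (hW.le_sqrt_mul h2) hr2.le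
    have e2 := mul_le_mul_of_nonneg_right (hW.le_sqrt_mul (by linarith : ‖η‖ ≤ 3 * ‖ξ - η‖)) hr1.le
    nlinarith

/-- With a constant weight the derivative can always be put on `ξ - η`, so the difference, which
sits at `ξ` and `η`, is needed only in `L²`. -/
lemma kerBound_one_le (ξ η : E3) : kerBound (fun _ => 1) ξ η ≤ 6 * rho (ξ - η) := by
  have hr0 := one_le_rho (ξ - η)
  unfold kerBound
  split_ifs with h
  · linarith
  · obtain ⟨h1, h2, h3⟩ := norm_le_of_far h
    have hpi := Real.pi_pos
    unfold rho
    nlinarith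

/-! ### The energy estimate -/

/-- The stretching part of the energy pairing. -/
noncomputable def stretchForm (γ : ℝ → ℝ) (W : E3 → ℝ) (p f g : E3 → C3) (z : E3 × E3) : ℂ :=
  -(2 * Real.pi * Complex.I) * (W z.1 : ℂ) * inner ℂ (p z.1) (kmul γ f z.2) *
    dotC3 (toC3 z.1) (g (z.1 - z.2))

/-- The transport part of the energy pairing. -/
noncomputable def transportForm (γ : ℝ → ℝ) (W : E3 → ℝ) (p f g : E3 → C3) (z : E3 × E3) : ℂ :=
  (2 * Real.pi * Complex.I) * (W z.1 : ℂ) * inner ℂ (p z.1) (g z.2) *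
    dotC3 (toC3 z.1) (kmul γ f (z.1 - z.2))

lemma measurable_inner_C3 {α : Type*} [MeasurableSpace α] {f g : α → C3} (hf : Measurable f)
    (hg : Measurable g) : Measurable fun x => inner ℂ (f x) (g x) := by
  simp_rw [inner_eq_dotC3]
  exact measurable_dotC3 (measurable_conjC3.comp hf) hg

lemma measurable_stretchForm {γ : ℝ → ℝ} (hγ : AdmissibleSymbol γ) {W : E3 → ℝ}
    (hW : Measurable W) {p f g : E3 → C3} (hp : Measurable p) (hf : Measurable f)
    (hg : Measurable g) : Measurable (stretchForm γ W p f g) :=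
  (((Complex.measurable_ofReal.comp (hW.comp measurable_fst)).const_mul _).mul
    (measurable_inner_C3 (hp.comp measurable_fst)
      ((hγ.measurable_kmul hf).comp measurable_snd))).mul
    (measurable_dotC3 (measurable_toC3.comp measurable_fst)
      (hg.comp (measurable_fst.sub measurable_snd)))

lemma measurable_transportForm {γ : ℝ → ℝ} (hγ : AdmissibleSymbol γ) {W : E3 → ℝ}
    (hW : Measurable W) {p f g : E3 → C3} (hp : Measurable p) (hf : Measurable f)
    (hg : Measurable g) : Measurable (transportForm γ W p f g) :=
  (((Complex.measurable_ofReal.comp (hW.comp measurable_fst)).const_mul _).mul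
    (measurable_inner_C3 (hp.comp measurable_fst) (hg.comp measurable_snd))).mul
    (measurable_dotC3 (measurable_toC3.comp measurable_fst)
      ((hγ.measurable_kmul hf).comp (measurable_fst.sub measurable_snd)))

lemma norm_two_pi_I : ‖(2 * Real.pi * Complex.I : ℂ)‖ = 2 * Real.pi := by
  simp [abs_of_pos Real.pi_pos]

/-- A bound without symmetrization, with the whole derivative on `f`. It gives absolute convergence
for bounded weights, and suffices in the difference estimate when `f` is the smooth factor. -/
lemma norm_stretchForm_le {γ : ℝ → ℝ} {C : ℝ} (hC : SymbolBound γ C) {W : E3 → ℝ} {M : ℝ}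
    (hW0 : ∀ ξ, 0 ≤ W ξ) (hM : ∀ ξ, W ξ ≤ M) {p f g : E3 → C3} (hg : NiceField g) (ξ η : E3) :
    ‖stretchForm γ W p f g (ξ, η)‖ ≤ M * C * (‖p ξ‖ * (rho η * ‖f η‖ * ‖g (ξ - η)‖)) := by
  have hM0 : 0 ≤ M := (hW0 0).trans (hM 0)
  have hCp := hC.pos
  rw [stretchForm, norm_mul, norm_mul, norm_mul, norm_neg, norm_two_pi_I, Complex.norm_real,
    Real.norm_of_nonneg (hW0 _)]
  have h1 : ‖inner ℂ (p ξ) (kmul γ f η)‖ ≤ ‖p ξ‖ * (C * kap η * ‖f η‖) :=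
    (norm_inner_le_norm _ _).trans (by gcongr; exact hC.norm_kmul_le f η)
  have h2 := hg.norm_dot_le ξ η
  have hk := kap_pos η
  have hpi := Real.pi_pos
  calc 2 * Real.pi * W ξ * ‖inner ℂ (p ξ) (kmul γ f η)‖ * ‖dotC3 (toC3 ξ) (g (ξ - η))‖
      ≤ 2 * Real.pi * M * (‖p ξ‖ * (C * kap η * ‖f η‖)) * (‖η‖ * ‖g (ξ - η)‖) := by
        gcongr
        exact hM ξ
    _ = M * C * (‖p ξ‖ * ((2 * Real.pi * ‖η‖ * kap η) * ‖f η‖ * ‖g (ξ - η)‖)) := by ring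
    _ ≤ _ := by gcongr; exact norm_mul_kap_le η

lemma norm_transportForm_le {γ : ℝ → ℝ} (hγ : AdmissibleSymbol γ) {W : E3 → ℝ} {M : ℝ}
    (hW0 : ∀ ξ, 0 ≤ W ξ) (hM : ∀ ξ, W ξ ≤ M) {p f g : E3 → C3} (hf : NiceField f) (ξ η : E3) :
    ‖transportForm γ W p f g (ξ, η)‖ ≤ M * (‖p ξ‖ * (rho η * ‖g η‖ * ‖kmul γ f (ξ - η)‖)) := by
  have hM0 : 0 ≤ M := (hW0 0).trans (hM 0)
  rw [transportForm, norm_mul, norm_mul, norm_mul, norm_two_pi_I, Complex.norm_real,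
    Real.norm_of_nonneg (hW0 _)]
  have h1 : ‖inner ℂ (p ξ) (g η)‖ ≤ ‖p ξ‖ * ‖g η‖ := norm_inner_le_norm _ _
  have h2 := (hf.kmul hγ).norm_dot_le ξ η
  have hpi := Real.pi_pos
  calc 2 * Real.pi * W ξ * ‖inner ℂ (p ξ) (g η)‖ * ‖dotC3 (toC3 ξ) (kmul γ f (ξ - η))‖
      ≤ 2 * Real.pi * M * (‖p ξ‖ * ‖g η‖) * (‖η‖ * ‖kmul γ f (ξ - η)‖) := by
        gcongr
        exact hM ξ
    _ = M * (‖p ξ‖ * ((2 * Real.pi * ‖η‖) * ‖g η‖ * ‖kmul γ f (ξ - η)‖)) := by ring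
    _ ≤ _ := by gcongr; unfold rho; linarith

lemma l2_rho_mul_le {σ : ℝ} (hσ : 5 / 2 < σ) {f : E3 → C3} (hf : Measurable f) :
    l2 (fun η => ENNReal.ofReal (rho η) * ‖f η‖ₑ) ≤ ENNReal.ofReal (2 ^ (σ / 2)) * hs σ f := by
  rw [hs_eq_l2, ← l2_const_mul _ (by fun_prop)]
  apply l2_mono
  intro η
  rw [← mul_assoc, ← ENNReal.ofReal_mul (by positivity)]
  gcongr
  have := rho_rpow_le (τ := 1) (σ := σ) zero_le_one (by linarith) η
  rwa [Real.rpow_one] at this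

lemma lintegral_trilinear_lt_top {σ : ℝ} (hσ : 5 / 2 < σ) {p f a : E3 → C3} (hp : Measurable p)
    (hf : Measurable f) (ha : Measurable a) (hps : l2 (fun ξ => ‖p ξ‖ₑ) < ⊤) (hfs : hs σ f < ⊤)
    (hai : Integrable a) (c : ℝ) :
    ∫⁻ ξ, ∫⁻ η, ENNReal.ofReal (c * (‖p ξ‖ * (rho η * ‖f η‖ * ‖a (ξ - η)‖))) < ⊤ := by
  rcases le_or_gt c 0 with hc | hc
  · have : ∀ ξ η, ENNReal.ofReal (c * (‖p ξ‖ * (rho η * ‖f η‖ * ‖a (ξ - η)‖))) = 0 := by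
      intro ξ η
      apply ENNReal.ofReal_of_nonpos
      apply mul_nonpos_of_nonpos_of_nonneg hc
      have := rho_pos η
      positivity
    simp [this]
  have e : ∀ ξ η, ENNReal.ofReal (c * (‖p ξ‖ * (rho η * ‖f η‖ * ‖a (ξ - η)‖)))
      = (ENNReal.ofReal c * ‖p ξ‖ₑ) * ((ENNReal.ofReal (rho η) * ‖f η‖ₑ) * ‖a (ξ - η)‖ₑ) := by
    intro ξ η
    have := rho_pos η
    rw [ENNReal.ofReal_mul hc.le, ENNReal.ofReal_mul (norm_nonneg _),
      ENNReal.ofReal_mul (by positivity), ENNReal.ofReal_mul this.le, ofReal_norm, ofReal_norm,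
      ofReal_norm]
    ring
  simp_rw [e]
  refine (lintegral_trilinear_le_of_L1_third (F := fun ξ => ENNReal.ofReal c * ‖p ξ‖ₑ)
    (G := fun η => ENNReal.ofReal (rho η) * ‖f η‖ₑ) (K := fun ζ => ‖a ζ‖ₑ)
    (by fun_prop) (by fun_prop) (by fun_prop)).trans_lt ?_
  rw [l2_const_mul _ (by fun_prop)]
  refine ENNReal.mul_lt_top (ENNReal.mul_lt_top (ENNReal.mul_lt_top ENNReal.ofReal_lt_top hps)
    ((l2_rho_mul_le hσ hf).trans_lt (ENNReal.mul_lt_top ENNReal.ofReal_lt_top hfs))) hai.2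

lemma integrable_prod_of_le {J : E3 × E3 → ℂ} (hJ : Measurable J) {B : E3 → E3 → ℝ}
    (hB : ∀ ξ η, ‖J (ξ, η)‖ ≤ B ξ η) (hfin : ∫⁻ ξ, ∫⁻ η, ENNReal.ofReal (B ξ η) < ⊤) :
    Integrable J (volume.prod volume) := by
  refine ⟨hJ.aestronglyMeasurable, ?_⟩
  change ∫⁻ z, ‖J z‖ₑ ∂(volume.prod volume) < ⊤
  rw [lintegral_prod _ hJ.enorm.aemeasurable]
  refine lt_of_le_of_lt ?_ hfin
  gcongr with ξ η
  rw [← ofReal_norm]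
  exact ENNReal.ofReal_le_ofReal (hB ξ η)

lemma integrable_stretchForm {γ : ℝ → ℝ} (hγ : AdmissibleSymbol γ) {σ : ℝ} (hσ : 5 / 2 < σ)
    {W : E3 → ℝ} {A : ℝ} (hW : WeightBound W A) {p f g : E3 → C3} (hp : Measurable p)
    (hf : Measurable f) (hg : NiceField g) (hps : l2 (fun ξ => ‖p ξ‖ₑ) < ⊤) (hfs : hs σ f < ⊤)
    (hgs : hs σ g < ⊤) : Integrable (stretchForm γ W p f g) (volume.prod volume) := by
  obtain ⟨C, hC⟩ := hγ.exists_bound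
  obtain ⟨M, hM⟩ := hW.bdd
  exact integrable_prod_of_le (measurable_stretchForm hγ hW.meas hp hf hg.meas)
    (norm_stretchForm_le hC hW.nonneg hM hg)
    (lintegral_trilinear_lt_top hσ hp hf hg.meas hps hfs (integrable_of_hs hσ hg.meas hgs) _)

lemma integrable_transportForm {γ : ℝ → ℝ} (hγ : AdmissibleSymbol γ) {σ : ℝ} (hσ : 5 / 2 < σ)
    {W : E3 → ℝ} {A : ℝ} (hW : WeightBound W A) {p f g : E3 → C3} (hp : Measurable p)
    (hf : NiceField f) (hg : Measurable g) (hps : l2 (fun ξ => ‖p ξ‖ₑ) < ⊤) (hfs : hs σ f < ⊤)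
    (hgs : hs σ g < ⊤) : Integrable (transportForm γ W p f g) (volume.prod volume) := by
  obtain ⟨M, hM⟩ := hW.bdd
  exact integrable_prod_of_le (measurable_transportForm hγ hW.meas hp hf.meas hg)
    (norm_transportForm_le hγ hW.nonneg hM hf)
    (lintegral_trilinear_lt_top hσ hp hg (hγ.measurable_kmul hf.meas) hps hgs
      (integrable_kmul hγ hσ hf.meas hfs) _)

/-- The energy pairing splits into the stretching and the transport part. -/
lemma integral_weight_inner_quadHat {γ : ℝ → ℝ} (hγ : AdmissibleSymbol γ) {σ : ℝ}
    (hσ : 5 / 2 < σ) {W : E3 → ℝ} {A : ℝ} (hW : WeightBound W A) {p f g : E3 → C3}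
    (hp : Measurable p) (hf : NiceField f) (hg : NiceField g) (hps : l2 (fun ξ => ‖p ξ‖ₑ) < ⊤)
    (hfs : hs σ f < ⊤) (hgs : hs σ g < ⊤) :
    ∫ ξ, (W ξ : ℂ) * inner ℂ (p ξ) (quadHat γ f g ξ)
      = ∫ z, stretchForm γ W p f g z ∂(volume.prod volume)
        + ∫ z, transportForm γ W p f g z ∂(volume.prod volume) := by
  have i1 := integrable_stretchForm hγ hσ hW hp hf.meas hg hps hfs hgs
  have i2 := integrable_transportForm hγ hσ hW hp hf hg.meas hps hfs hgs
  rw [integral_prod _ i1, integral_prod _ i2, ← integral_add i1.integral_prod_left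
    i2.integral_prod_left]
  apply integral_congr_ae
  filter_upwards [i1.prod_right_ae, i2.prod_right_ae,
    ae_integrable_cross (integrable_kmul hγ hσ hf.meas hfs)
      (integrable_of_hs hσ hg.meas hgs)] with ξ h1 h2 h3
  -- The substitution `η ↦ ξ - η` in the stretching part alone puts the field to be estimated at `η`
  -- in both parts, ready for the exchange of `ξ` and `η`.
  have h1' : Integrable fun η => stretchForm γ W p f g (ξ, ξ - η) := h1.comp_sub_left ξ
  rw [← integral_sub_left_eq_self (fun η => stretchForm γ W p f g (ξ, η)) volume ξ,
    ← integral_add h1' h2]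
  have e : ∀ η, stretchForm γ W p f g (ξ, ξ - η) + transportForm γ W p f g (ξ, η)
      = ((W ξ : ℂ) * (-(2 * Real.pi * Complex.I))) *
        inner ℂ (p ξ) (crossL (toC3 ξ) (cross (kmul γ f (ξ - η)) (g η))) := by
    intro η
    rw [crossL_apply, cross_cross, inner_sub_right, inner_smul_right, inner_smul_right]
    simp only [stretchForm, transportForm, sub_sub_cancel]
    ring
  simp_rw [e]
  rw [integral_const_mul, integral_inner ((crossL (toC3 ξ)).integrable_comp h3),
    (crossL (toC3 ξ)).integral_comp_comm h3, quadHat, inner_smul_right, mul_assoc (W ξ : ℂ)]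
  rfl

/-- Symmetrization: `2 Re z = z + conj z`, and the integral is unchanged when the two variables are
exchanged. Absolute values are taken only after the cancellation. -/
lemma enorm_two_re_integral_le {J : E3 × E3 → ℂ} (hJ : Integrable J (volume.prod volume)) :
    ENNReal.ofReal |2 * (∫ z, J z ∂(volume.prod volume)).re|
      ≤ ∫⁻ ξ, ∫⁻ η, ‖J (ξ, η) + (starRingEnd ℂ) (J (η, ξ))‖ₑ := by
  have hswap : Integrable (fun z : E3 × E3 => (starRingEnd ℂ) (J z.swap)) (volume.prod volume) :=
    Complex.conjCLE.toContinuousLinearMap.integrable_comp hJ.swap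
  have h1 : ((2 * (∫ z, J z ∂(volume.prod volume)).re : ℝ) : ℂ)
      = ∫ z : E3 × E3, (J z + (starRingEnd ℂ) (J z.swap)) ∂(volume.prod volume) := by
    rw [integral_add hJ hswap, integral_conj (f := fun z : E3 × E3 => J z.swap),
      integral_prod_swap, Complex.add_conj]
  rw [← Real.norm_eq_abs, ← Complex.norm_real, h1, ofReal_norm]
  refine (enorm_integral_le_lintegral_enorm _).trans (le_of_eq ?_)
  rw [lintegral_prod (fun z : E3 × E3 => ‖J z + (starRingEnd ℂ) (J z.swap)‖ₑ)
    (hJ.add hswap).1.enorm]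
  rfl

/-- The cross product with a real vector is skew-Hermitian, so `i m ×` is Hermitian: this is the
self-adjointness of `∇ × Γ`. -/
lemma conj_inner_cross_toC3 (v w : C3) (m : E3) :
    (starRingEnd ℂ) (inner ℂ v (cross (toC3 m) w)) = -inner ℂ w (cross (toC3 m) v) := by
  simp only [inner_eq_dotC3, conj_dotC3, conjC3_conjC3, conjC3_cross, conjC3_toC3]
  rw [dotC3_comm (conjC3 w), dotC3_cross_right]

lemma stretchForm_symm {γ : ℝ → ℝ} {W : E3 → ℝ} {f g : E3 → C3} (hg : NiceField g) (ξ η : E3) :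
    stretchForm γ W f f g (ξ, η) + (starRingEnd ℂ) (stretchForm γ W f f g (η, ξ))
      = -(2 * Real.pi * Complex.I) *
        inner ℂ (f ξ) (Complex.I • cross (toC3 (W ξ • sym γ η - W η • sym γ ξ)) (f η)) *
        dotC3 (toC3 ξ) (g (ξ - η)) := by
  simp only [stretchForm, map_mul, hg.conj_dot, kmul_eq, map_sub, map_smul,
    cross_sub_left, smul_sub, inner_sub_right, map_neg, Complex.conj_ofReal, Complex.conj_I,
    map_ofNat (starRingEnd ℂ) 2, ← Complex.coe_smul, cross_smul_left, inner_smul_right,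
    conj_inner_cross_toC3]
  ring

lemma transportForm_symm {γ : ℝ → ℝ} (hγ : AdmissibleSymbol γ) {W : E3 → ℝ} {f g : E3 → C3}
    (hf : NiceField f) (ξ η : E3) :
    transportForm γ W g f g (ξ, η) + (starRingEnd ℂ) (transportForm γ W g f g (η, ξ))
      = (2 * Real.pi * Complex.I) * ((W ξ - W η : ℝ) : ℂ) * inner ℂ (g ξ) (g η) *
        dotC3 (toC3 ξ) (kmul γ f (ξ - η)) := by
  simp only [transportForm, map_mul, (hf.kmul hγ).conj_dot, Complex.conj_ofReal, Complex.conj_I,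
    map_ofNat (starRingEnd ℂ) 2, inner_conj_symm]
  push_cast
  ring

lemma norm_stretchForm_symm_le {γ : ℝ → ℝ} {C A : ℝ} (hC : SymbolBound γ C) {W : E3 → ℝ}
    (hW : WeightBound W A) {f g : E3 → C3} (hg : NiceField g) (ξ η : E3) :
    ‖stretchForm γ W f f g (ξ, η) + (starRingEnd ℂ) (stretchForm γ W f f g (η, ξ))‖
      ≤ 2 * Real.pi * (A * C + C) * (kerBound W ξ η * (‖f ξ‖ * ‖f η‖ * ‖g (ξ - η)‖)) := by
  have hpi := Real.pi_pos
  rw [stretchForm_symm hg, norm_mul, norm_mul, norm_neg, norm_two_pi_I]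
  have h1 : ‖inner ℂ (f ξ) (Complex.I • cross (toC3 (W ξ • sym γ η - W η • sym γ ξ)) (f η))‖
      ≤ ‖f ξ‖ * (‖W ξ • sym γ η - W η • sym γ ξ‖ * ‖f η‖) := by
    refine (norm_inner_le_norm _ _).trans ?_
    rw [norm_smul, Complex.norm_I, one_mul]
    gcongr
    refine (norm_cross_le _ _).trans ?_
    rw [norm_toC3]
  have h2 := stretching_kernel_le hC hW hg ξ η
  calc _ ≤ 2 * Real.pi * (‖f ξ‖ * (‖W ξ • sym γ η - W η • sym γ ξ‖ * ‖f η‖)) *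
        ‖dotC3 (toC3 ξ) (g (ξ - η))‖ := by gcongr
    _ = 2 * Real.pi * ‖f ξ‖ * ‖f η‖ * (‖W ξ • sym γ η - W η • sym γ ξ‖ *
          ‖dotC3 (toC3 ξ) (g (ξ - η))‖) := by ring
    _ ≤ 2 * Real.pi * ‖f ξ‖ * ‖f η‖ * ((A * C + C) * kerBound W ξ η * ‖g (ξ - η)‖) := by gcongr
    _ = _ := by ring

lemma norm_transportForm_symm_le {γ : ℝ → ℝ} (hγ : AdmissibleSymbol γ) {C A : ℝ}
    (hC : SymbolBound γ C) {W : E3 → ℝ} (hW : WeightBound W A) {f g : E3 → C3}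
    (hf : NiceField f) (ξ η : E3) :
    ‖transportForm γ W g f g (ξ, η) + (starRingEnd ℂ) (transportForm γ W g f g (η, ξ))‖
      ≤ 2 * Real.pi * (A * C + C) * (kerBound W ξ η * (‖g ξ‖ * ‖g η‖ * ‖f (ξ - η)‖)) := by
  have hpi := Real.pi_pos
  rw [transportForm_symm hγ hf, norm_mul, norm_mul, norm_mul, norm_two_pi_I, Complex.norm_real,
    Real.norm_eq_abs]
  have h1 : ‖inner ℂ (g ξ) (g η)‖ ≤ ‖g ξ‖ * ‖g η‖ := norm_inner_le_norm _ _
  have h2 := transport_kernel_le hγ hC hW hf ξ η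
  calc _ ≤ 2 * Real.pi * |W ξ - W η| * (‖g ξ‖ * ‖g η‖) *
        ‖dotC3 (toC3 ξ) (kmul γ f (ξ - η))‖ := by gcongr
    _ = 2 * Real.pi * ‖g ξ‖ * ‖g η‖ * (|W ξ - W η| *
          ‖dotC3 (toC3 ξ) (kmul γ f (ξ - η))‖) := by ring
    _ ≤ 2 * Real.pi * ‖g ξ‖ * ‖g η‖ * ((A * C + C) * kerBound W ξ η * ‖f (ξ - η)‖) := by gcongr
    _ = _ := by ring

lemma l2_enorm_le_hs {σ : ℝ} (hσ : 0 ≤ σ) (f : E3 → C3) : l2 (fun ξ => ‖f ξ‖ₑ) ≤ hs σ f := by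
  rw [hs_eq_l2]
  apply l2_mono
  intro ξ
  conv_lhs => rw [← one_mul (‖f ξ‖ₑ), ← ENNReal.ofReal_one]
  gcongr
  exact Real.one_le_rpow (one_le_jb ξ) (by linarith)

lemma ofReal_mul_mul {a b c : ℝ} (ha : 0 ≤ a) (hb : 0 ≤ b) :
    ENNReal.ofReal (a * (b * c)) = ENNReal.ofReal a * (ENNReal.ofReal b * ENNReal.ofReal c) := by
  rw [ENNReal.ofReal_mul ha, ENNReal.ofReal_mul hb]

/-- The weighted energy `∫ W |f|²`. -/
noncomputable def wEnergy (W : E3 → ℝ) (f : E3 → C3) : ℝ≥0∞ :=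
  ∫⁻ ξ, ENNReal.ofReal (W ξ) * ‖f ξ‖ₑ ^ 2

lemma l2_sqrt_weight {W : E3 → ℝ} (hW : ∀ ξ, 0 ≤ W ξ) (f : E3 → C3) :
    l2 (fun ξ => ENNReal.ofReal √(W ξ) * ‖f ξ‖ₑ) * l2 (fun ξ => ENNReal.ofReal √(W ξ) * ‖f ξ‖ₑ)
      = wEnergy W f := by
  rw [← sq, l2_sq, wEnergy]
  congr 1
  ext1 ξ
  rw [mul_pow, ← ENNReal.ofReal_pow (Real.sqrt_nonneg _), Real.sq_sqrt (hW ξ)]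

/-- Each of the three terms of `kerBound_le` is a trilinear form in `√W f`, `√W f` and `rho f`;
measuring the last in `L¹` produces the `𝒴¹` norm. -/
lemma lintegral_kerBound_le {W : E3 → ℝ} {A : ℝ} (hW : WeightBound W A) {f : E3 → C3}
    (hf : Measurable f) {c : ℝ} (hc : 0 ≤ c) :
    ∫⁻ ξ, ∫⁻ η, ENNReal.ofReal (c * (kerBound W ξ η * (‖f ξ‖ * ‖f η‖ * ‖f (ξ - η)‖)))
      ≤ ENNReal.ofReal (3 * (c * A)) * yn f * wEnergy W f := by
  have hA := hW.one_le
  have hWm := hW.meas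
  set F : E3 → ℝ≥0∞ := fun ξ => ENNReal.ofReal √(W ξ) * ‖f ξ‖ₑ with hF
  set R : E3 → ℝ≥0∞ := fun ξ => ENNReal.ofReal (rho ξ) * ‖f ξ‖ₑ with hR
  have hFm : Measurable F := by fun_prop
  have hRm : Measurable R := by fun_prop
  have hpt : ∀ ξ η, ENNReal.ofReal (c * (kerBound W ξ η * (‖f ξ‖ * ‖f η‖ * ‖f (ξ - η)‖)))
      ≤ ENNReal.ofReal (c * A) * (F ξ * (F η * R (ξ - η)) + F ξ * (R η * F (ξ - η))
        + R ξ * (F η * F (ξ - η))) := by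
    intro ξ η
    have h1 := kerBound_le hW ξ η
    have r0 := rho_pos (ξ - η)
    have r1 := rho_pos ξ
    have r2 := rho_pos η
    calc ENNReal.ofReal (c * (kerBound W ξ η * (‖f ξ‖ * ‖f η‖ * ‖f (ξ - η)‖)))
        ≤ ENNReal.ofReal (c * ((A * (√(W ξ) * √(W η) * rho (ξ - η)
            + √(W ξ) * √(W (ξ - η)) * rho η + √(W η) * √(W (ξ - η)) * rho ξ)) *
              (‖f ξ‖ * ‖f η‖ * ‖f (ξ - η)‖))) := by
          apply ENNReal.ofReal_le_ofReal
          gcongr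
      _ = ENNReal.ofReal ((c * A) * ((√(W ξ) * ‖f ξ‖) * ((√(W η) * ‖f η‖) *
            (rho (ξ - η) * ‖f (ξ - η)‖)) + (√(W ξ) * ‖f ξ‖) * ((rho η * ‖f η‖) *
            (√(W (ξ - η)) * ‖f (ξ - η)‖)) + (rho ξ * ‖f ξ‖) * ((√(W η) * ‖f η‖) *
            (√(W (ξ - η)) * ‖f (ξ - η)‖)))) := by congr 1; ring
      _ = _ := by
          have e1 : ∀ x, ENNReal.ofReal (√(W x) * ‖f x‖) = F x := fun x => by
            rw [ENNReal.ofReal_mul (Real.sqrt_nonneg _), ofReal_norm]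
          have e2 : ∀ x, ENNReal.ofReal (rho x * ‖f x‖) = R x := fun x => by
            rw [ENNReal.ofReal_mul (rho_pos x).le, ofReal_norm]
          rw [ENNReal.ofReal_mul (by positivity), ENNReal.ofReal_add (by positivity) (by positivity),
            ENNReal.ofReal_add (by positivity) (by positivity)]
          congr 1
          rw [ofReal_mul_mul (by positivity) (by positivity),
            ofReal_mul_mul (by positivity) (by positivity),
            ofReal_mul_mul (by positivity) (by positivity)]
          simp only [e1, e2]
  have hFs : Measurable fun p : E3 × E3 => F (p.1 - p.2) := measurable_comp_sub hFm
  have hRs : Measurable fun p : E3 × E3 => R (p.1 - p.2) := measurable_comp_sub hRm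
  calc _ ≤ ∫⁻ ξ, ∫⁻ η, ENNReal.ofReal (c * A) * (F ξ * (F η * R (ξ - η))
        + F ξ * (R η * F (ξ - η)) + R ξ * (F η * F (ξ - η))) := by
        gcongr with ξ η; exact hpt ξ η
    _ = ENNReal.ofReal (c * A) * ((∫⁻ ξ, ∫⁻ η, F ξ * (F η * R (ξ - η)))
        + (∫⁻ ξ, ∫⁻ η, F ξ * (R η * F (ξ - η))) + ∫⁻ ξ, ∫⁻ η, R ξ * (F η * F (ξ - η))) := by
        simp_rw [lintegral_const_mul' _ _ ENNReal.ofReal_ne_top]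
        congr 1
        rw [← lintegral_add_left, ← lintegral_add_left]
        · congr 1
          ext1 ξ
          rw [← lintegral_add_left (by fun_prop), ← lintegral_add_left (by fun_prop)]
        · exact (Measurable.lintegral_prod_right' (f := fun p : E3 × E3 =>
            F p.1 * (F p.2 * R (p.1 - p.2))) (by fun_prop)).add
            (Measurable.lintegral_prod_right' (f := fun p : E3 × E3 =>
              F p.1 * (R p.2 * F (p.1 - p.2))) (by fun_prop))
        · exact Measurable.lintegral_prod_right' (f := fun p : E3 × E3 =>
            F p.1 * (F p.2 * R (p.1 - p.2))) (by fun_prop)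
    _ ≤ ENNReal.ofReal (c * A) * (wEnergy W f * yn f + wEnergy W f * yn f
        + wEnergy W f * yn f) := by
        rw [← l2_sqrt_weight hW.nonneg f]
        gcongr
        · exact lintegral_trilinear_le_of_L1_third hFm hFm hRm
        · exact lintegral_trilinear_le_of_L1_second hFm hRm hFm
        · exact lintegral_trilinear_le_of_L1_first hRm hFm hFm
    _ = _ := by
        rw [ENNReal.ofReal_mul (by norm_num : (0 : ℝ) ≤ 3)]
        norm_num
        ring

/-- The energy estimate. -/
theorem exists_energy_bound {γ : ℝ → ℝ} (hγ : AdmissibleSymbol γ) {A : ℝ} (hA : 1 ≤ A) :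
    ∃ C : ℝ, 0 < C ∧ ∀ (W : E3 → ℝ), WeightBound W A → ∀ (σ : ℝ), 5 / 2 < σ → ∀ f : E3 → C3,
      NiceField f → hs σ f < ⊤ →
      ENNReal.ofReal |2 * (∫ ξ, (W ξ : ℂ) * inner ℂ (f ξ) (quadHat γ f f ξ)).re|
        ≤ ENNReal.ofReal C * yn f * wEnergy W f := by
  obtain ⟨C, hC⟩ := hγ.exists_bound
  have hCp := hC.pos
  have hpi := Real.pi_pos
  set c := 2 * Real.pi * (A * C + C) with hc
  have hc0 : 0 < c := by positivity
  -- Three terms of the kernel bound, for each of the two forms. Neither `W` nor `σ` enters except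
  -- through `A`.
  refine ⟨2 * (3 * (c * A)), by positivity, fun W hW σ hσ f hf hfs => ?_⟩
  have hps := (l2_enorm_le_hs (by linarith : 0 ≤ σ) f).trans_lt hfs
  rw [integral_weight_inner_quadHat hγ hσ hW hf.meas hf hf hps hfs hfs, Complex.add_re, mul_add]
  have i1 := integrable_stretchForm hγ hσ hW hf.meas hf.meas hf hps hfs hfs
  have i2 := integrable_transportForm hγ hσ hW hf.meas hf hf.meas hps hfs hfs
  have b1 : ENNReal.ofReal |2 * (∫ z, stretchForm γ W f f f z ∂(volume.prod volume)).re|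
      ≤ ENNReal.ofReal (3 * (c * A)) * yn f * wEnergy W f := by
    refine (enorm_two_re_integral_le i1).trans (le_trans ?_ (lintegral_kerBound_le hW hf.meas hc0.le))
    gcongr with ξ η
    rw [← ofReal_norm]
    exact ENNReal.ofReal_le_ofReal (norm_stretchForm_symm_le hC hW hf ξ η)
  have b2 : ENNReal.ofReal |2 * (∫ z, transportForm γ W f f f z ∂(volume.prod volume)).re|
      ≤ ENNReal.ofReal (3 * (c * A)) * yn f * wEnergy W f := by
    refine (enorm_two_re_integral_le i2).trans (le_trans ?_ (lintegral_kerBound_le hW hf.meas hc0.le))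
    gcongr with ξ η
    rw [← ofReal_norm]
    exact ENNReal.ofReal_le_ofReal (norm_transportForm_symm_le hγ hC hW hf ξ η)
  calc _ ≤ ENNReal.ofReal (|2 * (∫ z, stretchForm γ W f f f z ∂(volume.prod volume)).re|
        + |2 * (∫ z, transportForm γ W f f f z ∂(volume.prod volume)).re|) :=
        ENNReal.ofReal_le_ofReal (abs_add_le _ _)
    _ ≤ ENNReal.ofReal (3 * (c * A)) * yn f * wEnergy W f
        + ENNReal.ofReal (3 * (c * A)) * yn f * wEnergy W f := by
        rw [ENNReal.ofReal_add (abs_nonneg _) (abs_nonneg _)]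
        exact add_le_add b1 b2
    _ = _ := by
        rw [ENNReal.ofReal_mul (by norm_num : (0 : ℝ) ≤ 2)]
        norm_num
        ring

/-! ### The difference estimate -/

lemma lintegral_kerBound_one_le {D b : E3 → C3} (hD : Measurable D) (hb : Measurable b) {c : ℝ}
    (hc : 0 ≤ c) :
    ∫⁻ ξ, ∫⁻ η, ENNReal.ofReal (c * (kerBound (fun _ => 1) ξ η * (‖D ξ‖ * ‖D η‖ * ‖b (ξ - η)‖)))
      ≤ ENNReal.ofReal (6 * c) * (yn b * l2 (fun ξ => ‖D ξ‖ₑ) ^ 2) := by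
  have hpt : ∀ ξ η, ENNReal.ofReal (c * (kerBound (fun _ => 1) ξ η *
      (‖D ξ‖ * ‖D η‖ * ‖b (ξ - η)‖)))
      ≤ (ENNReal.ofReal (6 * c) * ‖D ξ‖ₑ) * (‖D η‖ₑ *
        (ENNReal.ofReal (rho (ξ - η)) * ‖b (ξ - η)‖ₑ)) := by
    intro ξ η
    have hr := rho_pos (ξ - η)
    calc _ ≤ ENNReal.ofReal (c * ((6 * rho (ξ - η)) * (‖D ξ‖ * ‖D η‖ * ‖b (ξ - η)‖))) := by
          apply ENNReal.ofReal_le_ofReal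
          gcongr
          exact kerBound_one_le ξ η
      _ = ENNReal.ofReal (((6 * c) * ‖D ξ‖) * (‖D η‖ * (rho (ξ - η) * ‖b (ξ - η)‖))) := by
          congr 1; ring
      _ = _ := by
          rw [ofReal_mul_mul (by positivity) (by positivity),
            ENNReal.ofReal_mul (by positivity : 0 ≤ 6 * c), ENNReal.ofReal_mul hr.le, ofReal_norm,
            ofReal_norm, ofReal_norm]
  calc _ ≤ ∫⁻ ξ, ∫⁻ η, (ENNReal.ofReal (6 * c) * ‖D ξ‖ₑ) * (‖D η‖ₑ *
        (ENNReal.ofReal (rho (ξ - η)) * ‖b (ξ - η)‖ₑ)) := by gcongr with ξ η; exact hpt ξ η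
    _ ≤ l2 (fun ξ => ENNReal.ofReal (6 * c) * ‖D ξ‖ₑ) * l2 (fun ξ => ‖D ξ‖ₑ) * yn b :=
        lintegral_trilinear_le_of_L1_third (F := fun ξ => ENNReal.ofReal (6 * c) * ‖D ξ‖ₑ)
          (G := fun ξ => ‖D ξ‖ₑ) (K := fun ζ => ENNReal.ofReal (rho ζ) * ‖b ζ‖ₑ)
          (by fun_prop) (by fun_prop) (by fun_prop)
    _ = _ := by rw [l2_const_mul _ (by fun_prop)]; ring

/-- The singular part of the symbol at low frequencies. -/
noncomputable def lowKap (ξ : E3) : ℝ := if 2 * Real.pi * ‖ξ‖ ≤ 1 then kap ξ else 0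

@[fun_prop] lemma measurable_lowKap : Measurable lowKap :=
  Measurable.ite (measurableSet_le (by fun_prop) measurable_const) measurable_kap measurable_const

lemma lowKap_nonneg (ξ : E3) : 0 ≤ lowKap ξ := by
  unfold lowKap; split_ifs
  · exact (kap_pos ξ).le
  · exact le_rfl

lemma kap_le_add_lowKap (ξ : E3) : kap ξ ≤ 2 + lowKap ξ := by
  unfold lowKap
  split_ifs with h
  · linarith
  · push Not at h
    have := inv_le_one_of_one_le₀ h.le
    unfold kap; linarith

/-- In three dimensions `|ζ|⁻²` is integrable near the origin; the computation is borrowed from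
`integrable_vwt_sq` at the arbitrary exponent `3`. -/
lemma l2_lowKap_ne_top : l2 (fun ξ => ENNReal.ofReal (lowKap ξ)) ≠ ⊤ := by
  unfold l2
  apply ENNReal.rpow_ne_top_of_nonneg (by norm_num)
  -- On `|ζ| ≤ 1` one has `jb ≤ 2`, so `8 = 2³` compensates `jb⁻³`.
  have h := ((integrable_vwt_sq (σ := 3) (by norm_num)).const_mul 8).lintegral_lt_top
  refine ne_of_lt (lt_of_le_of_lt ?_ h)
  gcongr with ξ
  rw [← ENNReal.ofReal_pow (lowKap_nonneg ξ)]
  apply ENNReal.ofReal_le_ofReal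
  have hv := vwt_pos 3 ξ
  have hj := jb_pos ξ
  unfold lowKap
  split_ifs with hlow
  · have h1 : kap ξ ≤ vwt 3 ξ := by
      unfold vwt
      exact le_mul_of_one_le_right (kap_pos ξ).le
        (Real.one_le_rpow (one_le_rho ξ) (by unfold marg; norm_num))
    have h2 : jb ξ ≤ 2 := by
      unfold jb
      have : 0 ≤ 2 * Real.pi * ‖ξ‖ := by have := Real.pi_pos; positivity
      nlinarith
    have h3 : (1 : ℝ) ≤ 8 * jb ξ ^ (-(3 : ℝ)) := by
      have : (2 : ℝ) ^ (-(3 : ℝ)) ≤ jb ξ ^ (-(3 : ℝ)) :=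
        Real.rpow_le_rpow_of_nonpos hj h2 (by norm_num)
      norm_num [Real.rpow_neg] at this ⊢
      linarith
    have hk := kap_pos ξ
    calc kap ξ ^ 2 ≤ vwt 3 ξ ^ 2 := by gcongr
      _ ≤ vwt 3 ξ ^ 2 * (8 * jb ξ ^ (-(3 : ℝ))) := le_mul_of_one_le_right (by positivity) h3
      _ = _ := by ring
  · have : 0 ≤ 8 * (vwt 3 ξ ^ 2 * jb ξ ^ (-(3 : ℝ))) := by positivity
    simpa using this

lemma exists_yn_le {σ : ℝ} (hσ : 5 / 2 < σ) :
    ∃ C : ℝ, 0 < C ∧ ∀ f : E3 → C3, Measurable f → yn f ≤ ENNReal.ofReal C * hs σ f := by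
  obtain ⟨C, hC, h⟩ := exists_vn_le hσ
  exact ⟨C, hC, fun f hf => (yn_le_vn hσ f).trans (h f hf)⟩

lemma ofReal_two_re_integral_le {J : E3 × E3 → ℂ} (hJ : Measurable J) :
    ENNReal.ofReal |2 * (∫ z, J z ∂(volume.prod volume)).re| ≤ 2 * ∫⁻ ξ, ∫⁻ η, ‖J (ξ, η)‖ₑ := by
  calc _ ≤ ENNReal.ofReal (2 * ‖∫ z, J z ∂(volume.prod volume)‖) := by
        apply ENNReal.ofReal_le_ofReal
        rw [abs_mul, abs_two]
        gcongr
        exact Complex.abs_re_le_norm _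
    _ = 2 * ‖∫ z, J z ∂(volume.prod volume)‖ₑ := by
        rw [ENNReal.ofReal_mul (by norm_num), ofReal_norm]; norm_num
    _ ≤ _ := by
        gcongr
        refine (enorm_integral_le_lintegral_enorm _).trans (le_of_eq ?_)
        rw [lintegral_prod _ hJ.enorm.aemeasurable]

/-- The difference acts as the stretched direction and the derivative falls on `b`, because `D` is
divergence free; no cancellation is needed. -/
lemma exists_stretch_difference_bound {γ : ℝ → ℝ} (hγ : AdmissibleSymbol γ) :
    ∃ C : ℝ, 0 < C ∧ ∀ D b : E3 → C3, NiceField D → Measurable b →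
      ENNReal.ofReal |2 * (∫ z, stretchForm γ (fun _ => 1) D b D z ∂(volume.prod volume)).re|
        ≤ ENNReal.ofReal C * (yn b * l2 (fun ξ => ‖D ξ‖ₑ) ^ 2) := by
  obtain ⟨C, hC⟩ := hγ.exists_bound
  have hCp := hC.pos
  refine ⟨2 * C, by positivity, fun D b hD hb => ?_⟩
  have hDm := hD.meas
  refine (ofReal_two_re_integral_le (measurable_stretchForm hγ measurable_const hDm hb hDm)).trans ?_
  have hpt : ∀ ξ η, ‖stretchForm γ (fun _ => 1) D b D (ξ, η)‖ₑ
      ≤ (ENNReal.ofReal C * ‖D ξ‖ₑ) * ((ENNReal.ofReal (rho η) * ‖b η‖ₑ) * ‖D (ξ - η)‖ₑ) := by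
    intro ξ η
    have hr := rho_pos η
    rw [← ofReal_norm]
    refine (ENNReal.ofReal_le_ofReal (norm_stretchForm_le hC (W := fun _ => 1) (M := 1)
      (fun _ => zero_le_one) (fun _ => le_rfl) hD ξ η)).trans (le_of_eq ?_)
    rw [one_mul, ENNReal.ofReal_mul hCp.le, ENNReal.ofReal_mul (by positivity),
      ENNReal.ofReal_mul (by positivity), ENNReal.ofReal_mul (by positivity), ofReal_norm,
      ofReal_norm, ofReal_norm]
    ring
  calc _ ≤ 2 * ∫⁻ ξ, ∫⁻ η, (ENNReal.ofReal C * ‖D ξ‖ₑ) *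
        ((ENNReal.ofReal (rho η) * ‖b η‖ₑ) * ‖D (ξ - η)‖ₑ) := by
        gcongr with ξ η; exact hpt ξ η
    _ ≤ 2 * (l2 (fun ξ => ENNReal.ofReal C * ‖D ξ‖ₑ) * l2 (fun ξ => ‖D ξ‖ₑ) * yn b) := by
        gcongr
        exact lintegral_trilinear_le_of_L1_second (F := fun ξ => ENNReal.ofReal C * ‖D ξ‖ₑ)
          (G := fun η => ENNReal.ofReal (rho η) * ‖b η‖ₑ) (K := fun ζ => ‖D ζ‖ₑ)
          (by fun_prop) (by fun_prop) (by fun_prop)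
    _ = _ := by
        rw [l2_const_mul _ (by fun_prop), ENNReal.ofReal_mul (by norm_num)]
        norm_num
        ring

/-- The velocity generated by `D` transports `b`. Its high-frequency part is in `L²` with `D`, so
`rho b` is taken in `L¹`. Its low-frequency part need not be in `L²`, but `lowKap` is, which places
that part in `L¹` and leaves `rho b` in `L²`. -/
lemma exists_transport_difference_bound {γ : ℝ → ℝ} (hγ : AdmissibleSymbol γ) {σ : ℝ}
    (hσ : 5 / 2 < σ) :
    ∃ C : ℝ, 0 < C ∧ ∀ D b : E3 → C3, NiceField D → Measurable b →
      ENNReal.ofReal |2 * (∫ z, transportForm γ (fun _ => 1) D D b z ∂(volume.prod volume)).re|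
        ≤ ENNReal.ofReal C * (hs σ b * l2 (fun ξ => ‖D ξ‖ₑ) ^ 2) := by
  obtain ⟨C, hC⟩ := hγ.exists_bound
  obtain ⟨Cy, hCy, hyn⟩ := exists_yn_le hσ
  have hCp := hC.pos
  set L := l2 (fun ξ => ENNReal.ofReal (lowKap ξ)) with hL
  have hLtop : L ≠ ⊤ := l2_lowKap_ne_top
  refine ⟨2 * (C * (2 * Cy + 2 ^ (σ / 2) * L.toReal)), by positivity, fun D b hD hb => ?_⟩
  have hDm := hD.meas
  set d := l2 (fun ξ => ‖D ξ‖ₑ) with hd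
  set R : E3 → ℝ≥0∞ := fun η => ENNReal.ofReal (rho η) * ‖b η‖ₑ with hR
  have hRm : Measurable R := by fun_prop
  set F : E3 → ℝ≥0∞ := fun ξ => ENNReal.ofReal C * ‖D ξ‖ₑ with hF
  have hFm : Measurable F := by fun_prop
  refine (ofReal_two_re_integral_le
    (measurable_transportForm hγ measurable_const hDm hDm hb)).trans ?_
  have hpt : ∀ ξ η, ‖transportForm γ (fun _ => 1) D D b (ξ, η)‖ₑ
      ≤ F ξ * (R η * (2 * ‖D (ξ - η)‖ₑ))
        + F ξ * (R η * (ENNReal.ofReal (lowKap (ξ - η)) * ‖D (ξ - η)‖ₑ)) := by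
    intro ξ η
    have hr := rho_pos η
    have hl := lowKap_nonneg (ξ - η)
    rw [← ofReal_norm]
    have h1 := norm_transportForm_le hγ (W := fun _ => 1) (M := 1)
      (fun _ => zero_le_one) (fun _ => le_rfl) (p := D) (g := b) hD ξ η
    have h2 : ‖kmul γ D (ξ - η)‖ ≤ C * (2 + lowKap (ξ - η)) * ‖D (ξ - η)‖ :=
      (hC.norm_kmul_le D _).trans (by gcongr; exact kap_le_add_lowKap _)
    have h3 : ‖transportForm γ (fun _ => 1) D D b (ξ, η)‖
        ≤ (C * ‖D ξ‖) * ((rho η * ‖b η‖) * (2 * ‖D (ξ - η)‖))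
          + (C * ‖D ξ‖) * ((rho η * ‖b η‖) * (lowKap (ξ - η) * ‖D (ξ - η)‖)) := by
      calc _ ≤ 1 * (‖D ξ‖ * (rho η * ‖b η‖ * (C * (2 + lowKap (ξ - η)) * ‖D (ξ - η)‖))) :=
            h1.trans (by gcongr)
        _ = _ := by ring
    refine (ENNReal.ofReal_le_ofReal h3).trans (le_of_eq ?_)
    rw [ENNReal.ofReal_add (by positivity) (by positivity),
      ofReal_mul_mul (by positivity) (by positivity), ofReal_mul_mul (by positivity) (by positivity),
      ENNReal.ofReal_mul hCp.le, ENNReal.ofReal_mul hr.le, ENNReal.ofReal_mul hl,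
      ENNReal.ofReal_mul zero_le_two, ofReal_norm, ofReal_norm, ofReal_norm, ENNReal.ofReal_ofNat]
  have hm1 : Measurable fun p : E3 × E3 => 2 * ‖D (p.1 - p.2)‖ₑ := by
    exact (hDm.comp (measurable_fst.sub measurable_snd)).enorm.const_mul 2
  calc _ ≤ 2 * ∫⁻ ξ, ∫⁻ η, (F ξ * (R η * (2 * ‖D (ξ - η)‖ₑ))
        + F ξ * (R η * (ENNReal.ofReal (lowKap (ξ - η)) * ‖D (ξ - η)‖ₑ))) := by
        gcongr with ξ η; exact hpt ξ η
    _ = 2 * ((∫⁻ ξ, ∫⁻ η, F ξ * (R η * (2 * ‖D (ξ - η)‖ₑ)))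
        + ∫⁻ ξ, ∫⁻ η, F ξ * (R η * (ENNReal.ofReal (lowKap (ξ - η)) * ‖D (ξ - η)‖ₑ))) := by
        rw [← lintegral_add_left]
        · congr 2
          ext1 ξ
          rw [← lintegral_add_left (by fun_prop)]
        · exact Measurable.lintegral_prod_right' (f := fun p : E3 × E3 =>
            F p.1 * (R p.2 * (2 * ‖D (p.1 - p.2)‖ₑ))) (by fun_prop)
    _ ≤ 2 * (l2 F * l2 (fun ζ => 2 * ‖D ζ‖ₑ) * (∫⁻ η, R η)
        + l2 F * l2 R * ∫⁻ ζ, ENNReal.ofReal (lowKap ζ) * ‖D ζ‖ₑ) := by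
        gcongr
        · exact lintegral_trilinear_le_of_L1_second (K := fun ζ => 2 * ‖D ζ‖ₑ) hFm hRm (by fun_prop)
        · exact lintegral_trilinear_le_of_L1_third
            (K := fun ζ => ENNReal.ofReal (lowKap ζ) * ‖D ζ‖ₑ) hFm hRm (by fun_prop)
    _ ≤ 2 * ((ENNReal.ofReal C * d) * (2 * d) * (ENNReal.ofReal Cy * hs σ b)
        + (ENNReal.ofReal C * d) * (ENNReal.ofReal (2 ^ (σ / 2)) * hs σ b) * (L * d)) := by
        rw [hF, l2_const_mul _ (by fun_prop), l2_const_mul _ (by fun_prop), ← hd]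
        gcongr
        · exact hyn b hb
        · exact l2_rho_mul_le hσ hb
        · exact lintegral_mul_le_l2 (by fun_prop) (by fun_prop)
    _ = _ := by
        rw [ENNReal.ofReal_mul (by norm_num), ENNReal.ofReal_mul hCp.le,
          ENNReal.ofReal_add (by positivity) (by positivity), ENNReal.ofReal_mul (by norm_num),
          ENNReal.ofReal_mul (by positivity), ENNReal.ofReal_toReal hLtop]
        norm_num
        ring

/-- The `L²` estimate for the difference of two solutions. -/
theorem exists_difference_bound {γ : ℝ → ℝ} (hγ : AdmissibleSymbol γ) {σ : ℝ} (hσ : 5 / 2 < σ) :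
    ∃ C : ℝ, 0 < C ∧ ∀ D b b' : E3 → C3, NiceField D → NiceField b → NiceField b' →
      hs σ D < ⊤ → hs σ b < ⊤ → hs σ b' < ⊤ →
      ENNReal.ofReal |2 * (∫ ξ, inner ℂ (D ξ) (quadHat γ D b ξ)).re
          + 2 * (∫ ξ, inner ℂ (D ξ) (quadHat γ b' D ξ)).re|
        ≤ ENNReal.ofReal C * ((hs σ b + hs σ b') * l2 (fun ξ => ‖D ξ‖ₑ) ^ 2) := by
  obtain ⟨C, hC⟩ := hγ.exists_bound
  obtain ⟨Cy, hCy, hyn⟩ := exists_yn_le hσ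
  obtain ⟨C₁, hC₁, h₁⟩ := exists_stretch_difference_bound hγ
  obtain ⟨C₂, hC₂, h₂⟩ := exists_transport_difference_bound hγ hσ
  have hCp := hC.pos
  have hpi := Real.pi_pos
  set c := 2 * Real.pi * (1 * C + C) with hc
  have hc0 : 0 < c := by positivity
  refine ⟨6 * c * Cy + C₂ + C₁ * Cy, by positivity, fun D b b' hD hb hb' hDs hbs hbs' => ?_⟩
  have hps := (l2_enorm_le_hs (by linarith : 0 ≤ σ) D).trans_lt hDs
  -- Four terms arise. In stretching along `b` and transport by `b'` the derivative falls on `D`,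
  -- and symmetrization removes it; in the other two it falls on `b` or `b'`.
  have e1 := integral_weight_inner_quadHat hγ hσ WeightBound.one hD.meas hD hb hps hDs hbs
  have e2 := integral_weight_inner_quadHat hγ hσ WeightBound.one hD.meas hb' hD hps hbs' hDs
  simp only [Complex.ofReal_one, one_mul] at e1 e2
  rw [e1, e2, Complex.add_re, Complex.add_re]
  have i1 := integrable_stretchForm hγ hσ WeightBound.one hD.meas hD.meas hb hps hDs hbs
  have i2 := integrable_transportForm hγ hσ WeightBound.one hD.meas hb' hD.meas hps hbs' hDs
  set d := l2 (fun ξ => ‖D ξ‖ₑ) with hd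
  have b1 : ENNReal.ofReal |2 * (∫ z, stretchForm γ (fun _ => 1) D D b z ∂(volume.prod volume)).re|
      ≤ ENNReal.ofReal (6 * c) * (yn b * d ^ 2) := by
    refine (enorm_two_re_integral_le i1).trans
      (le_trans ?_ (lintegral_kerBound_one_le hD.meas hb.meas hc0.le))
    gcongr with ξ η
    rw [← ofReal_norm]
    exact ENNReal.ofReal_le_ofReal (norm_stretchForm_symm_le hC WeightBound.one hb ξ η)
  have b2 : ENNReal.ofReal
      |2 * (∫ z, transportForm γ (fun _ => 1) D b' D z ∂(volume.prod volume)).re|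
      ≤ ENNReal.ofReal (6 * c) * (yn b' * d ^ 2) := by
    refine (enorm_two_re_integral_le i2).trans
      (le_trans ?_ (lintegral_kerBound_one_le hD.meas hb'.meas hc0.le))
    gcongr with ξ η
    rw [← ofReal_norm]
    exact ENNReal.ofReal_le_ofReal (norm_transportForm_symm_le hγ hC WeightBound.one hb' ξ η)
  have b3 := h₂ D b hD hb.meas
  have b4 := h₁ D b' hD hb'.meas
  set x1 := (∫ z, stretchForm γ (fun _ => 1) D D b z ∂(volume.prod volume)).re
  set x2 := (∫ z, transportForm γ (fun _ => 1) D b' D z ∂(volume.prod volume)).re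
  set x3 := (∫ z, transportForm γ (fun _ => 1) D D b z ∂(volume.prod volume)).re
  set x4 := (∫ z, stretchForm γ (fun _ => 1) D b' D z ∂(volume.prod volume)).re
  calc ENNReal.ofReal |2 * (x1 + x3) + 2 * (x4 + x2)|
      ≤ ENNReal.ofReal (|2 * x1| + |2 * x2| + |2 * x3| + |2 * x4|) := by
        apply ENNReal.ofReal_le_ofReal
        have e : 2 * (x1 + x3) + 2 * (x4 + x2) = 2 * x1 + 2 * x2 + 2 * x3 + 2 * x4 := by ring
        rw [e]
        have a1 := abs_add_le (2 * x1 + 2 * x2 + 2 * x3) (2 * x4)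
        have a2 := abs_add_le (2 * x1 + 2 * x2) (2 * x3)
        have a3 := abs_add_le (2 * x1) (2 * x2)
        linarith
    _ ≤ ENNReal.ofReal (6 * c) * ((ENNReal.ofReal Cy * hs σ b) * d ^ 2)
        + ENNReal.ofReal (6 * c) * ((ENNReal.ofReal Cy * hs σ b') * d ^ 2)
        + ENNReal.ofReal C₂ * ((hs σ b + hs σ b') * d ^ 2)
        + ENNReal.ofReal C₁ * ((ENNReal.ofReal Cy * (hs σ b + hs σ b')) * d ^ 2) := by
        rw [ENNReal.ofReal_add (by positivity) (abs_nonneg _),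
          ENNReal.ofReal_add (by positivity) (abs_nonneg _),
          ENNReal.ofReal_add (by positivity) (abs_nonneg _)]
        refine add_le_add (add_le_add (add_le_add (b1.trans ?_) (b2.trans ?_)) (b3.trans ?_))
          (b4.trans ?_)
        · gcongr; exact hyn b hb.meas
        · gcongr; exact hyn b' hb'.meas
        · gcongr; exact le_self_add
        · gcongr; exact (hyn b' hb'.meas).trans (by gcongr; exact le_add_self)
    _ = _ := by
        rw [ENNReal.ofReal_add (by positivity) (by positivity),
          ENNReal.ofReal_add (by positivity) (by positivity),
          ENNReal.ofReal_mul (by positivity : 0 ≤ 6 * c), ENNReal.ofReal_mul hC₁.le]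
        ring

/-! ### Multiplication operators on `L²` -/

lemma measurable_coe_HL2 (f : HL2) : Measurable f := (Lp.stronglyMeasurable f).measurable

lemma memLp_bdd_smul {w : E3 → ℝ} (hw : Measurable w) {M : ℝ} (hM : ∀ ξ, |w ξ| ≤ M) (f : HL2) :
    MemLp (fun ξ => w ξ • f ξ) 2 := by
  refine MemLp.of_le_mul (c := M) (Lp.memLp f) ?_ (ae_of_all _ fun ξ => ?_)
  · exact hw.aestronglyMeasurable.smul (Lp.aestronglyMeasurable f)
  · rw [norm_smul, Real.norm_eq_abs]
    gcongr
    exact hM ξ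

/-- A bounded measurable multiplier. -/
structure BddMul (w : E3 → ℝ) : Prop where
  meas : Measurable w
  bdd : ∃ M : ℝ, ∀ ξ, |w ξ| ≤ M

lemma BddMul.memLp {w : E3 → ℝ} (hw : BddMul w) (f : HL2) : MemLp (fun ξ => w ξ • f ξ) 2 :=
  let ⟨_, hM⟩ := hw.bdd
  memLp_bdd_smul hw.meas hM f

/-- Multiplication by a bounded function. -/
noncomputable def mulOp {w : E3 → ℝ} (hw : BddMul w) : HL2 →L[ℝ] HL2 :=
  LinearMap.mkContinuousOfExistsBound
    { toFun := fun f => (hw.memLp f).toLp _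
      map_add' := fun f g => by
        rw [← MemLp.toLp_add, MemLp.toLp_eq_toLp_iff]
        filter_upwards [Lp.coeFn_add f g] with ξ hξ
        rw [hξ, Pi.add_apply, Pi.add_apply, smul_add]
      map_smul' := fun c f => by
        rw [RingHom.id_apply, ← MemLp.toLp_const_smul, MemLp.toLp_eq_toLp_iff]
        filter_upwards [Lp.coeFn_smul c f] with ξ hξ
        rw [hξ, Pi.smul_apply, Pi.smul_apply, smul_comm] }
    (by
      obtain ⟨M, hM⟩ := hw.bdd
      refine ⟨M, fun f => ?_⟩
      have hM0 : 0 ≤ M := (abs_nonneg _).trans (hM 0)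
      refine Lp.norm_le_mul_norm_of_ae_le_mul ?_
      filter_upwards [(hw.memLp f).coeFn_toLp] with ξ hξ
      change ‖((hw.memLp f).toLp _ : HL2) ξ‖ ≤ _
      rw [hξ, norm_smul, Real.norm_eq_abs]
      gcongr
      exact hM ξ)

lemma mulOp_coe {w : E3 → ℝ} (hw : BddMul w) (f : HL2) :
    mulOp hw f =ᵐ[volume] fun ξ => w ξ • f ξ := (hw.memLp f).coeFn_toLp

lemma inner_mulOp_left {w : E3 → ℝ} (hw : BddMul w) (f g : HL2) :
    inner ℂ (mulOp hw f) g = ∫ ξ, (w ξ : ℂ) * inner ℂ (f ξ) (g ξ) := by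
  rw [L2.inner_def]
  apply integral_congr_ae
  filter_upwards [mulOp_coe hw f] with ξ hξ
  rw [hξ, ← Complex.coe_smul, inner_smul_left, Complex.conj_ofReal]

lemma inner_mulOp_right {w : E3 → ℝ} (hw : BddMul w) (f g : HL2) :
    inner ℂ f (mulOp hw g) = inner ℂ (mulOp hw f) g := by
  rw [inner_mulOp_left, L2.inner_def]
  apply integral_congr_ae
  filter_upwards [mulOp_coe hw g] with ξ hξ
  rw [hξ, ← Complex.coe_smul, inner_smul_right]

lemma mulOp_comm {w v : E3 → ℝ} (hw : BddMul w) (hv : BddMul v) (f : HL2) :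
    mulOp hw (mulOp hv f) = mulOp hv (mulOp hw f) := by
  ext1
  filter_upwards [mulOp_coe hw (mulOp hv f), mulOp_coe hv (mulOp hw f), mulOp_coe hw f,
    mulOp_coe hv f] with ξ h1 h2 h3 h4
  rw [h1, h2, h3, h4, smul_comm]

lemma re_inner_mulOp_self {w : E3 → ℝ} (hw : BddMul w) (f : HL2) :
    (inner ℂ (mulOp hw f) f).re = ∫ ξ, w ξ * ‖f ξ‖ ^ 2 := by
  have h : inner ℂ (mulOp hw f) f = ((∫ ξ, w ξ * ‖f ξ‖ ^ 2 : ℝ) : ℂ) := by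
    rw [inner_mulOp_left, ← integral_complex_ofReal]
    congr 1
    ext1 ξ
    rw [inner_self_eq_norm_sq_to_K]
    push_cast
    rfl
  rw [h, Complex.ofReal_re]

lemma ofReal_re_inner_mulOp {w : E3 → ℝ} (hw : BddMul w) (h0 : ∀ ξ, 0 ≤ w ξ) (f : HL2) :
    ENNReal.ofReal (inner ℂ (mulOp hw f) f).re = wEnergy w f := by
  have hfin_int : Integrable fun ξ => w ξ * ‖f ξ‖ ^ 2 := by
    obtain ⟨M, hM⟩ := hw.bdd
    exact ((Lp.memLp f).integrable_norm_pow two_ne_zero).bdd_mul (c := M)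
      hw.meas.aestronglyMeasurable (ae_of_all _ fun ξ => by simpa using hM ξ)
  rw [re_inner_mulOp_self, ofReal_integral_eq_lintegral_ofReal hfin_int
    (ae_of_all _ fun ξ => mul_nonneg (h0 ξ) (sq_nonneg _)), wEnergy]
  congr 1
  ext1 ξ
  rw [ENNReal.ofReal_mul (h0 ξ), ENNReal.ofReal_pow (norm_nonneg _), ofReal_norm]

/-! ### Hermitian solenoidal fields -/

/-- Convergence in `L²` yields almost everywhere convergence along a subsequence, and the condition
is pointwise and continuous. -/
lemma fourierDivFree_isClosed : IsClosed {g : HL2 | FourierDivFree g} := by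
  refine IsSeqClosed.isClosed fun u g hu hg => ?_
  have h1 := tendstoInMeasure_of_tendsto_Lp hg
  obtain ⟨ns, -, hns⟩ := h1.exists_seq_tendsto_ae
  have h2 : ∀ᵐ ξ, ∀ k, dotC3 (toC3 ξ) (u (ns k) ξ) = 0 := ae_all_iff.2 fun k => hu (ns k)
  filter_upwards [hns, h2] with ξ h3 h4
  have hc : Continuous fun v : C3 => dotC3 (toC3 ξ) v := by
    simp only [dotC3_eq_inner]; fun_prop
  have h5 := (hc.tendsto _).comp h3
  exact tendsto_nhds_unique h5 (by simp [Function.comp_def, h4])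

/-- The Hermitian solenoidal fields. -/
noncomputable def solenoidal : Submodule ℝ HL2 where
  carrier := {g | Hermitian g ∧ FourierDivFree g}
  add_mem' := by
    rintro f g ⟨h1, h2⟩ ⟨h3, h4⟩
    refine ⟨?_, ?_⟩
    · filter_upwards [h1, h3, Lp.coeFn_add f g, ae_comp_neg (Lp.coeFn_add f g)] with ξ a1 a2 a3 a4
      rw [a3, a4, Pi.add_apply, Pi.add_apply, a1, a2, conjC3_add]
    · filter_upwards [h2, h4, Lp.coeFn_add f g] with ξ a1 a2 a3
      rw [a3, Pi.add_apply, dotC3_add_right, a1, a2, add_zero]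
  zero_mem' := by
    refine ⟨?_, ?_⟩
    · filter_upwards [Lp.coeFn_zero C3 2 (volume : Measure E3),
        ae_comp_neg (Lp.coeFn_zero C3 2 (volume : Measure E3))] with ξ a1 a2
      rw [a1, a2, Pi.zero_apply, Pi.zero_apply, ← conjL_apply, map_zero]
    · filter_upwards [Lp.coeFn_zero C3 2 (volume : Measure E3)] with ξ a1
      rw [a1, dotC3_eq_inner, Pi.zero_apply, inner_zero_right]
  smul_mem' := by
    rintro c f ⟨h1, h2⟩
    refine ⟨?_, ?_⟩
    · filter_upwards [h1, Lp.coeFn_smul c f, ae_comp_neg (Lp.coeFn_smul c f)] with ξ a1 a2 a3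
      rw [a2, a3, Pi.smul_apply, Pi.smul_apply, a1, ← conjL_apply, ← conjL_apply, map_smul]
    · filter_upwards [h2, Lp.coeFn_smul c f] with ξ a1 a2
      rw [a2, Pi.smul_apply, ← Complex.coe_smul, dotC3_smul_right, a1, mul_zero]

lemma isClosed_solenoidal : IsClosed (solenoidal : Set HL2) := by
  have : (solenoidal : Set HL2) = {g | reflLp (conjL.compLp g) = g} ∩ {g | FourierDivFree g} := by
    ext g
    exact and_congr (hermitian_iff g) Iff.rfl
  rw [this]
  refine (isClosed_eq ?_ continuous_id).inter fourierDivFree_isClosed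
  exact continuous_reflLp.comp (conjL.compLpL 2 volume).continuous

/-- The representative is set to zero off the set where both conditions hold. That set is symmetric
under `ξ ↦ -ξ`, so Hermitian symmetry survives at every point. -/
lemma exists_niceField {g : HL2} (hg : g ∈ solenoidal) :
    ∃ f : E3 → C3, NiceField f ∧ g =ᵐ[volume] f := by
  obtain ⟨h1, h2⟩ := hg
  have hm := measurable_coe_HL2 g
  classical
  set S : Set E3 := {ξ | g (-ξ) = conjC3 (g ξ) ∧ dotC3 (toC3 ξ) (g ξ) = 0} with hS
  have hSm : MeasurableSet S := by
    refine (measurableSet_eq_fun (hm.comp measurable_neg) (measurable_conjC3.comp hm)).inter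
      (measurableSet_eq_fun (measurable_dotC3 measurable_toC3 hm) measurable_const)
  have hneg : ∀ ξ, ξ ∈ S → -ξ ∈ S := by
    rintro ξ ⟨a1, a2⟩
    refine ⟨by rw [neg_neg, a1, conjC3_conjC3], ?_⟩
    rw [a1, map_neg, dotC3_neg_left, ← conjC3_toC3 ξ, ← conj_dotC3, a2, map_zero, neg_zero]
  have h0 : conjC3 0 = 0 := by rw [← conjL_apply, map_zero]
  refine ⟨S.indicator g, ⟨hm.indicator hSm, fun ξ => ?_, fun ξ => ?_⟩, ?_⟩
  · by_cases h : ξ ∈ S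
    · rw [indicator_of_mem h, indicator_of_mem (hneg ξ h), h.1]
    · have h' : -ξ ∉ S := fun h' => h (by simpa using hneg _ h')
      rw [indicator_of_notMem h, indicator_of_notMem h', h0]
  · by_cases h : ξ ∈ S
    · rw [indicator_of_mem h, h.2]
    · rw [indicator_of_notMem h, dotC3_eq_inner, inner_zero_right]
  · filter_upwards [h1, h2] with ξ a1 a2
    have h : ξ ∈ S := ⟨a1, a2⟩
    rw [indicator_of_mem h]

lemma mem_solenoidal_of_niceField {g : HL2} {f : E3 → C3} (hf : NiceField f)
    (h : g =ᵐ[volume] f) : g ∈ solenoidal := by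
  refine ⟨?_, ?_⟩
  · filter_upwards [h, ae_comp_neg h] with ξ a1 a2
    rw [a1, a2, hf.herm]
  · filter_upwards [h] with ξ a1
    rw [a1, hf.div]

lemma mulOp_mem_solenoidal {w : E3 → ℝ} (hw : BddMul w) (heven : ∀ ξ, w (-ξ) = w ξ) {g : HL2}
    (hg : g ∈ solenoidal) : mulOp hw g ∈ solenoidal := by
  obtain ⟨f, hf, hgf⟩ := exists_niceField hg
  refine mem_solenoidal_of_niceField (f := fun ξ => w ξ • f ξ) ⟨hw.meas.smul hf.meas, ?_, ?_⟩ ?_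
  · intro ξ
    rw [heven, hf.herm, ← conjL_apply, ← conjL_apply, map_smul]
  · intro ξ
    rw [← Complex.coe_smul, dotC3_smul_right, hf.div, mul_zero]
  · filter_upwards [mulOp_coe hw g, hgf] with ξ a1 a2
    rw [a1, a2]

/-! ### The nonlinearity as a map of `L²` -/

lemma conjC3_integral (f : E3 → C3) : conjC3 (∫ ξ, f ξ) = ∫ ξ, conjC3 (f ξ) := by
  by_cases hf : Integrable f
  · exact (conjL.integral_comp_comm hf).symm
  · have hf' : ¬ Integrable (fun y => conjC3 (f y)) := by
      intro h
      apply hf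
      have := conjL.integrable_comp h
      simpa [conjC3_conjC3] using this
    rw [integral_undef hf, integral_undef hf', ← conjL_apply, map_zero]

lemma NiceField.quadHat {γ : ℝ → ℝ} (hγ : AdmissibleSymbol γ) {f g : E3 → C3} (hf : NiceField f)
    (hg : NiceField g) : NiceField (quadHat γ f g) where
  meas := hγ.measurable_quadHat hf.meas hg.meas
  herm ξ := by
    have h1 : convCross (ActiveVector.kmul γ f) g (-ξ)
        = conjC3 (convCross (ActiveVector.kmul γ f) g ξ) := by
      unfold convCross
      rw [conjC3_integral, ← integral_neg_eq_self]
      congr 1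
      ext1 η
      rw [conjC3_cross, ← (hf.kmul hγ).herm, ← hg.herm]
      congr 2
      abel
    unfold ActiveVector.quadHat
    rw [h1, map_neg, conjC3_smul, conjC3_cross, conjC3_toC3, cross_neg_left, smul_neg, ← neg_smul]
    congr 1
    simp [Complex.conj_ofReal, Complex.conj_ofNat]
  div ξ := by
    unfold ActiveVector.quadHat
    rw [dotC3_smul_right, dotC3_cross_self, mul_zero]

open Classical in
/-- The nonlinearity, with values in `L²`; it is zero where the quadratic expression is not
square-integrable. -/
noncomputable def nonlin (γ : ℝ → ℝ) (f : HL2) : HL2 :=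
  if h : MemLp (quadHat γ f f) 2 volume then h.toLp _ else 0

lemma memLp_quadHat {γ : ℝ → ℝ} (hγ : AdmissibleSymbol γ) {σ : ℝ} (hσ : 5 / 2 < σ)
    {f g : E3 → C3} (hf : Measurable f) (hg : Measurable g) (hfs : hs σ f < ⊤) (hgs : hs σ g < ⊤) :
    MemLp (quadHat γ f g) 2 := by
  obtain ⟨C, -, hC⟩ := exists_quadHat_bound hγ hσ
  refine ⟨(hγ.measurable_quadHat hf hg).aestronglyMeasurable, ?_⟩
  refine ((l2_quadHat_le hσ f g).trans (hC f g hf hg)).trans_lt ?_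
  exact ENNReal.mul_lt_top ENNReal.ofReal_lt_top (ENNReal.mul_lt_top hfs hgs)

lemma nonlin_coe {γ : ℝ → ℝ} (hγ : AdmissibleSymbol γ) {σ : ℝ} (hσ : 5 / 2 < σ) {f : HL2}
    (hfs : hs σ f < ⊤) : nonlin γ f =ᵐ[volume] quadHat γ f f := by
  have h := memLp_quadHat hγ hσ (measurable_coe_HL2 f) (measurable_coe_HL2 f) hfs hfs
  rw [nonlin, dif_pos h]
  exact h.coeFn_toLp

lemma nonlin_mem_solenoidal {γ : ℝ → ℝ} (hγ : AdmissibleSymbol γ) {σ : ℝ} (hσ : 5 / 2 < σ)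
    {f : HL2} (hf : f ∈ solenoidal) (hfs : hs σ f < ⊤) : nonlin γ f ∈ solenoidal := by
  obtain ⟨f', hf', h⟩ := exists_niceField hf
  refine mem_solenoidal_of_niceField (hf'.quadHat hγ hf') ?_
  rw [← quadHat_congr_ae h h]
  exact nonlin_coe hγ hσ hfs

lemma hs_sub_coe (σ : ℝ) (f g : HL2) : hs σ (f - g : HL2) = hs σ (⇑f - ⇑g) :=
  hs_congr_ae (Lp.coeFn_sub f g)

/-- The pairing of roles matters: `exists_difference_bound` treats exactly these two terms. -/
lemma quadHat_sub_quadHat {γ : ℝ → ℝ} (hγ : AdmissibleSymbol γ) {σ : ℝ} (hσ : 5 / 2 < σ)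
    {f g : E3 → C3} (hf : Measurable f) (hg : Measurable g) (hfs : hs σ f < ⊤) (hgs : hs σ g < ⊤) :
    quadHat γ f f - quadHat γ g g =ᵐ[volume] quadHat γ (f - g) f + quadHat γ g (f - g) := by
  filter_upwards [quadHat_sub_left hγ hσ hf hg hf hfs hgs hfs,
    quadHat_sub_right hγ hσ hg hf hg hgs hfs hgs] with ξ h1 h2
  rw [Pi.add_apply, h1, h2]
  simp

lemma exists_nonlin_sub_le {γ : ℝ → ℝ} (hγ : AdmissibleSymbol γ) {σ : ℝ} (hσ : 5 / 2 < σ) :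
    ∃ C : ℝ, 0 < C ∧ ∀ f g : HL2, hs σ f < ⊤ → hs σ g < ⊤ →
      ‖nonlin γ f - nonlin γ g‖ₑ
        ≤ ENNReal.ofReal C * (hs σ (f - g : HL2) * (hs σ f + hs σ g)) := by
  obtain ⟨C, hC0, hC⟩ := exists_quadHat_bound hγ hσ
  refine ⟨C, hC0, fun f g hf hg => ?_⟩
  have hfm := measurable_coe_HL2 f
  have hgm := measurable_coe_HL2 g
  have hdm := hfm.sub hgm
  rw [hs_sub_coe, Lp.enorm_def]
  have h1 : (nonlin γ f - nonlin γ g : HL2) =ᵐ[volume]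
      quadHat γ (⇑f - ⇑g) f + quadHat γ g (⇑f - ⇑g) := by
    filter_upwards [Lp.coeFn_sub (nonlin γ f) (nonlin γ g), nonlin_coe hγ hσ hf,
      nonlin_coe hγ hσ hg, quadHat_sub_quadHat hγ hσ hfm hgm hf hg] with ξ a1 a2 a3 a4
    rw [a1, ← a4, Pi.sub_apply, a2, a3, Pi.sub_apply]
  rw [eLpNorm_congr_ae h1]
  refine (eLpNorm_add_le (hγ.measurable_quadHat hdm hfm).aestronglyMeasurable
    (hγ.measurable_quadHat hgm hdm).aestronglyMeasurable (by norm_num)).trans ?_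
  calc _ ≤ ENNReal.ofReal C * (hs σ (⇑f - ⇑g) * hs σ f)
        + ENNReal.ofReal C * (hs σ g * hs σ (⇑f - ⇑g)) :=
        add_le_add ((l2_quadHat_le hσ _ _).trans (hC _ _ hdm hfm))
          ((l2_quadHat_le hσ _ _).trans (hC _ _ hgm hdm))
    _ = _ := by ring

/-! ### Frequency cut-offs -/

/-- The indicator of a ball. -/
noncomputable def cut (n : ℕ) : E3 → ℝ := (Metric.closedBall (0 : E3) n).indicator 1

lemma cut_nonneg (n : ℕ) (ξ : E3) : 0 ≤ cut n ξ := indicator_nonneg (fun _ _ => zero_le_one) ξ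

lemma cut_le_one (n : ℕ) (ξ : E3) : cut n ξ ≤ 1 := indicator_le_self' (fun _ _ => zero_le_one) ξ

lemma bddMul_cut (n : ℕ) : BddMul (cut n) :=
  ⟨measurable_one.indicator Metric.isClosed_closedBall.measurableSet,
    1, fun ξ => by rw [abs_of_nonneg (cut_nonneg n ξ)]; exact cut_le_one n ξ⟩

lemma cut_neg (n : ℕ) (ξ : E3) : cut n (-ξ) = cut n ξ := by
  by_cases h : ‖ξ‖ ≤ n <;> simp [cut, h]

/-- The restriction to low frequencies. -/
noncomputable abbrev lowPass (n : ℕ) : HL2 →L[ℝ] HL2 := mulOp (bddMul_cut n)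

lemma norm_lowPass_le (n : ℕ) (f : HL2) : ‖lowPass n f‖ ≤ ‖f‖ := by
  apply Lp.norm_le_norm_of_ae_le
  filter_upwards [mulOp_coe (bddMul_cut n) f] with ξ hξ
  rw [hξ, norm_smul, Real.norm_of_nonneg (cut_nonneg n ξ)]
  exact mul_le_of_le_one_left (norm_nonneg _) (cut_le_one n ξ)

lemma lowPass_lowPass (n : ℕ) (f : HL2) : lowPass n (lowPass n f) = lowPass n f := by
  ext1
  filter_upwards [mulOp_coe (bddMul_cut n) f, mulOp_coe (bddMul_cut n) (lowPass n f)] with ξ h1 h2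
  rw [h2, h1, smul_smul]
  by_cases h : ξ ∈ Metric.closedBall (0 : E3) n <;> simp [cut, h]

lemma hs_lowPass_le (σ : ℝ) (n : ℕ) (f : HL2) : hs σ (lowPass n f) ≤ hs σ f := by
  apply hs_mono_ae
  filter_upwards [mulOp_coe (bddMul_cut n) f] with ξ hξ
  rw [hξ, norm_smul, Real.norm_of_nonneg (cut_nonneg n ξ)]
  exact mul_le_of_le_one_left (norm_nonneg _) (cut_le_one n ξ)

/-- Bernstein's inequality: the weight is bounded on the ball that carries `f`. -/
lemma hs_le_of_lowPass {σ : ℝ} (hσ : 0 ≤ σ) {n : ℕ} {f : HL2} (hf : lowPass n f = f) :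
    hs σ f ≤ ENNReal.ofReal ((1 + (2 * Real.pi * n) ^ 2) ^ (σ / 2)) * ‖f‖ₑ := by
  have hpi := Real.pi_pos
  rw [Lp.enorm_def, hs, ← Real.enorm_of_nonneg (by positivity), ← eLpNorm_const_smul]
  apply eLpNorm_mono_ae
  have h := mulOp_coe (bddMul_cut n) f
  change (lowPass n f : E3 → C3) =ᵐ[volume] _ at h
  rw [hf] at h
  filter_upwards [h] with ξ hξ
  rw [Pi.smul_apply, norm_smul, norm_smul, Real.norm_of_nonneg (by have := jb_pos ξ; positivity),
    Real.norm_of_nonneg (by positivity)]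
  by_cases hb : ξ ∈ Metric.closedBall (0 : E3) n
  · rw [mem_closedBall_zero_iff] at hb
    gcongr
    · exact (jb_pos ξ).le
    · unfold jb; gcongr
  · rw [hξ]; simp [cut, hb]

/-- Outside the ball of radius `n` one has `rho ≥ 1 + n`, so the surplus weight in
`exists_quadHat_bound` becomes a rate. -/
lemma exists_tail_bound {γ : ℝ → ℝ} (hγ : AdmissibleSymbol γ) {σ : ℝ} (hσ : 5 / 2 < σ) :
    ∃ C : ℝ, 0 < C ∧ ∀ (n : ℕ) (f : HL2), hs σ f < ⊤ →
      ‖nonlin γ f - lowPass n (nonlin γ f)‖ₑ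
        ≤ ENNReal.ofReal ((1 + n : ℝ) ^ (-marg σ)) * (ENNReal.ofReal C * hs σ f ^ 2) := by
  obtain ⟨C, hC0, hC⟩ := exists_quadHat_bound hγ hσ
  refine ⟨C, hC0, fun n f hf => ?_⟩
  have hm : 0 < marg σ := by unfold marg; linarith
  have hfm := measurable_coe_HL2 f
  have hqm := hγ.measurable_quadHat hfm hfm
  rw [sq]
  refine le_trans ?_ (mul_le_mul_right (hC f f hfm hfm) _)
  rw [← l2_const_mul _ (by fun_prop), Lp.enorm_def, eLpNorm_eq_l2]
  have h1 : l2 (fun ξ => ‖(nonlin γ f - lowPass n (nonlin γ f) : HL2) ξ‖ₑ)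
      = l2 (fun ξ => ‖(1 - cut n ξ) • quadHat γ f f ξ‖ₑ) := by
    rw [← eLpNorm_eq_l2, ← eLpNorm_eq_l2]
    apply eLpNorm_congr_ae
    filter_upwards [Lp.coeFn_sub (nonlin γ f) (lowPass n (nonlin γ f)), nonlin_coe hγ hσ hf,
      mulOp_coe (bddMul_cut n) (nonlin γ f)] with ξ a1 a2 a3
    rw [a1, Pi.sub_apply, a3, a2, sub_smul, one_smul]
  rw [h1]
  apply l2_mono
  intro ξ
  by_cases hb : ξ ∈ Metric.closedBall (0 : E3) n
  · simp [cut, hb]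
  · rw [mem_closedBall_zero_iff, not_le] at hb
    have hr : (1 + n : ℝ) ≤ rho ξ := by
      unfold rho
      have := Real.pi_gt_three
      nlinarith [norm_nonneg ξ]
    have hb' : ¬ ‖ξ‖ ≤ n := not_le.2 hb
    have : cut n ξ = 0 := by simp [cut, hb']
    rw [this, sub_zero, one_smul, ← mul_assoc, ← ENNReal.ofReal_mul (by positivity)]
    conv_lhs => rw [← one_mul (‖quadHat γ f f ξ‖ₑ), ← ENNReal.ofReal_one]
    gcongr
    rw [Real.rpow_neg (by positivity), ← div_eq_inv_mul, one_le_div (by positivity)]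
    gcongr

/-! ### Truncated Sobolev weights -/

/-- The weight of `H^s`, truncated at height `n + 1`. -/
noncomputable def truncWeight (s : ℝ) (n : ℕ) (ξ : E3) : ℝ := min (jb ξ ^ s) (n + 1)

lemma truncWeight_nonneg (s : ℝ) (n : ℕ) (ξ : E3) : 0 ≤ truncWeight s n ξ :=
  le_min (Real.rpow_nonneg (jb_pos ξ).le _) (by positivity)

@[fun_prop] lemma measurable_truncWeight (s : ℝ) (n : ℕ) : Measurable (truncWeight s n) :=
  (measurable_jb.pow_const s).min measurable_const

lemma bddMul_truncWeight (s : ℝ) (n : ℕ) : BddMul (truncWeight s n) :=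
  ⟨measurable_truncWeight s n, n + 1, fun ξ => by
    rw [abs_of_nonneg (truncWeight_nonneg s n ξ)]; exact min_le_right _ _⟩

/-- Relative variation does not increase under truncation; hence the constants for `truncWeight` do
not depend on the height. -/
lemma abs_min_sub_min_mul_le {a b M : ℝ} (ha : 0 ≤ a) (hb : 0 ≤ b) (hM : 0 ≤ M) :
    |min a M - min b M| * b ≤ |a - b| * min b M := by
  rcases le_total b M with h | h
  · rw [min_eq_left h]
    refine mul_le_mul_of_nonneg_right ?_ hb
    rcases le_total a M with h' | h'
    · rw [min_eq_left h']
    · rw [min_eq_right h', abs_of_nonneg (by linarith), abs_of_nonneg (by linarith)]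
      linarith
  · rw [min_eq_right h]
    rcases le_total a M with h' | h'
    · rw [min_eq_left h', abs_of_nonpos (by linarith), abs_of_nonpos (by linarith)]
      nlinarith
    · rw [min_eq_right h', sub_self, abs_zero, zero_mul]
      positivity

/-- Bernoulli's inequality for `(b/a)^s`, multiplied by `a^s · a`. -/
lemma rpow_sub_rpow_mul_le {a b s : ℝ} (hs : 1 ≤ s) (hb : 0 < b) (h : b ≤ a) :
    (a ^ s - b ^ s) * a ≤ s * a ^ s * (a - b) := by
  have ha : 0 < a := hb.trans_le h
  have h1 := one_add_mul_self_le_rpow_one_add (s := b / a - 1)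
    (by have := div_pos hb ha; linarith) hs
  rw [add_sub_cancel, Real.div_rpow hb.le ha.le] at h1
  have has : 0 < a ^ s := Real.rpow_pos_of_pos ha s
  have h2 : (1 + s * (b / a - 1)) * (a ^ s * a) ≤ b ^ s / a ^ s * (a ^ s * a) := by gcongr
  have e1 : b ^ s / a ^ s * (a ^ s * a) = b ^ s * a := by field_simp
  have e2 : (1 + s * (b / a - 1)) * (a ^ s * a) = a ^ s * a + s * a ^ s * (b - a) := by
    field_simp
  rw [e1, e2] at h2
  linarith

lemma abs_rpow_sub_rpow_mul_le {a b K s : ℝ} (hs : 1 ≤ s) (ha : 0 < a) (hb : 0 < b) (hK : 1 ≤ K)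
    (h : a ≤ K * b) : |a ^ s - b ^ s| * b ≤ s * K ^ s * b ^ s * |a - b| := by
  have hbs : 0 < b ^ s := Real.rpow_pos_of_pos hb s
  have hKs : 1 ≤ K ^ s := Real.one_le_rpow hK (by linarith)
  rcases le_total b a with h' | h'
  · have hm : b ^ s ≤ a ^ s := Real.rpow_le_rpow hb.le h' (by linarith)
    rw [abs_of_nonneg (by linarith), abs_of_nonneg (by linarith)]
    have h1 := rpow_sub_rpow_mul_le hs hb h'
    have h2 : a ^ s ≤ K ^ s * b ^ s := by
      rw [← Real.mul_rpow (by linarith) hb.le]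
      exact Real.rpow_le_rpow ha.le h (by linarith)
    calc (a ^ s - b ^ s) * b ≤ (a ^ s - b ^ s) * a := by
          apply mul_le_mul_of_nonneg_left h'; linarith
      _ ≤ s * a ^ s * (a - b) := h1
      _ ≤ s * (K ^ s * b ^ s) * (a - b) := by
          apply mul_le_mul_of_nonneg_right _ (by linarith)
          gcongr
      _ = _ := by ring
  · have hm : a ^ s ≤ b ^ s := Real.rpow_le_rpow ha.le h' (by linarith)
    rw [abs_of_nonpos (by linarith), abs_of_nonpos (by linarith)]
    have h1 := rpow_sub_rpow_mul_le hs ha h'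
    have h3 : s * b ^ s * (b - a) ≤ s * K ^ s * b ^ s * (b - a) := by
      apply mul_le_mul_of_nonneg_right _ (by linarith)
      gcongr
      nlinarith
    linarith

lemma jb_le_of_norm_le {ξ η : E3} (h : ‖ξ‖ ≤ 3 * ‖η‖) : jb ξ ≤ 9 * jb η := by
  unfold jb
  have hpi := Real.pi_pos
  have h1 : 2 * Real.pi * ‖ξ‖ ≤ 3 * (2 * Real.pi * ‖η‖) := by nlinarith
  have h0 : 0 ≤ 2 * Real.pi * ‖ξ‖ := by positivity
  nlinarith

lemma abs_jb_sub_mul_le {ξ η : E3} (h : ‖ξ - η‖ ≤ ‖η‖ / 2) :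
    |jb ξ - jb η| * ‖η‖ ≤ 3 * ‖ξ - η‖ * jb η := by
  have h1 : |‖ξ‖ - ‖η‖| ≤ ‖ξ - η‖ := abs_norm_sub_norm_le ξ η
  have h2 : ‖ξ‖ + ‖η‖ ≤ 3 * ‖η‖ := by
    have := abs_le.1 h1
    have := norm_nonneg η
    linarith
  have e : jb ξ - jb η = (2 * Real.pi) ^ 2 * ((‖ξ‖ - ‖η‖) * (‖ξ‖ + ‖η‖)) := by unfold jb; ring
  rw [e, abs_mul, abs_mul, abs_of_nonneg (by positivity : 0 ≤ (2 * Real.pi) ^ 2),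
    abs_of_nonneg (by positivity : 0 ≤ ‖ξ‖ + ‖η‖)]
  calc (2 * Real.pi) ^ 2 * (|‖ξ‖ - ‖η‖| * (‖ξ‖ + ‖η‖)) * ‖η‖
      ≤ (2 * Real.pi) ^ 2 * (‖ξ - η‖ * (3 * ‖η‖)) * ‖η‖ := by gcongr
    _ = 3 * ‖ξ - η‖ * (2 * Real.pi * ‖η‖) ^ 2 := by ring
    _ ≤ 3 * ‖ξ - η‖ * jb η := by
        gcongr
        unfold jb
        linarith

lemma exists_weightBound {s : ℝ} (hs : 1 ≤ s) :
    ∃ A : ℝ, 1 ≤ A ∧ ∀ n : ℕ, WeightBound (truncWeight s n) A := by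
  have h9 : (1 : ℝ) ≤ 9 ^ s := Real.one_le_rpow (by norm_num) (by linarith)
  have hA : 1 ≤ 3 * s * (9 : ℝ) ^ s := by nlinarith
  -- The `9` is the doubling constant of `jb` for `‖ξ‖ ≤ 3‖η‖`, the factor `s` comes from
  -- differentiating the power, and `3` from `‖ξ‖ + ‖η‖ ≤ 3‖η‖`.
  refine ⟨3 * s * 9 ^ s, hA, fun n => ?_⟩
  refine ⟨measurable_truncWeight s n, truncWeight_nonneg s n, ⟨n + 1, fun ξ => min_le_right _ _⟩,
    hA, fun ξ η h => ?_, fun ξ η h => ?_⟩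
  · have h1 : jb ξ ^ s ≤ 9 ^ s * jb η ^ s := by
      rw [← Real.mul_rpow (by norm_num) (jb_pos η).le]
      exact Real.rpow_le_rpow (jb_pos ξ).le (jb_le_of_norm_le h) (by linarith)
    have h2 : truncWeight s n ξ ≤ 9 ^ s * truncWeight s n η := by
      unfold truncWeight
      rw [mul_min_of_nonneg _ _ (by linarith)]
      refine min_le_min h1 ?_
      exact le_mul_of_one_le_left (by positivity) h9
    refine h2.trans ?_
    gcongr
    · exact truncWeight_nonneg s n η
    · nlinarith
  · have hjξ := jb_pos ξ
    have hjη := jb_pos η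
    have hW := truncWeight_nonneg s n η
    have hξ : ‖ξ‖ ≤ 3 * ‖η‖ := by
      have := norm_le_norm_add_norm_sub' ξ η
      have := norm_nonneg η
      linarith
    have b0 : 0 < jb η ^ s := Real.rpow_pos_of_pos hjη s
    have h1 : |truncWeight s n ξ - truncWeight s n η| * jb η ^ s
        ≤ |jb ξ ^ s - jb η ^ s| * truncWeight s n η :=
      abs_min_sub_min_mul_le (by positivity) b0.le (by positivity)
    have h2 := abs_rpow_sub_rpow_mul_le hs hjξ hjη (by norm_num : (1 : ℝ) ≤ 9)
      (jb_le_of_norm_le hξ)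
    have h3 := abs_jb_sub_mul_le h
    have h4 : (|truncWeight s n ξ - truncWeight s n η| * ‖η‖) * (jb η ^ s * jb η)
        ≤ (3 * s * 9 ^ s * ‖ξ - η‖ * truncWeight s n η) * (jb η ^ s * jb η) := by
      calc _ = (|truncWeight s n ξ - truncWeight s n η| * jb η ^ s) * jb η * ‖η‖ := by ring
        _ ≤ (|jb ξ ^ s - jb η ^ s| * truncWeight s n η) * jb η * ‖η‖ := by gcongr
        _ = (|jb ξ ^ s - jb η ^ s| * jb η) * truncWeight s n η * ‖η‖ := by ring
        _ ≤ (s * 9 ^ s * jb η ^ s * |jb ξ - jb η|) * truncWeight s n η * ‖η‖ := by gcongr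
        _ = (s * 9 ^ s * jb η ^ s) * truncWeight s n η * (|jb ξ - jb η| * ‖η‖) := by ring
        _ ≤ (s * 9 ^ s * jb η ^ s) * truncWeight s n η * (3 * ‖ξ - η‖ * jb η) := by gcongr
        _ = _ := by ring
    exact le_of_mul_le_mul_right h4 (by positivity)

/-- The energy of a field with respect to the truncated weight. -/
noncomputable def energy (s : ℝ) (n : ℕ) (f : HL2) : ℝ :=
  (inner ℂ (mulOp (bddMul_truncWeight s n) f) f).re

lemma ofReal_energy (s : ℝ) (n : ℕ) (f : HL2) :
    ENNReal.ofReal (energy s n f) = wEnergy (truncWeight s n) f :=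
  ofReal_re_inner_mulOp _ (truncWeight_nonneg s n) f

lemma energy_nonneg (s : ℝ) (n : ℕ) (f : HL2) : 0 ≤ energy s n f := by
  rw [energy, re_inner_mulOp_self]
  exact integral_nonneg fun ξ => mul_nonneg (truncWeight_nonneg s n ξ) (sq_nonneg _)

lemma continuous_energy (s : ℝ) (n : ℕ) : Continuous (energy s n) := by
  unfold energy
  exact Complex.continuous_re.comp (((mulOp (bddMul_truncWeight s n)).continuous).inner continuous_id)

lemma iSup_wEnergy (s : ℝ) (f : HL2) : ⨆ n, wEnergy (truncWeight s n) f = hs s f ^ 2 := by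
  rw [hs_sq]
  unfold wEnergy
  have hfm := measurable_coe_HL2 f
  rw [← lintegral_iSup]
  · congr 1
    ext1 ξ
    rw [← ENNReal.iSup_mul]
    congr 1
    apply le_antisymm
    · exact iSup_le fun n => ENNReal.ofReal_le_ofReal (min_le_left _ _)
    · obtain ⟨n, hn⟩ := exists_nat_ge (jb ξ ^ s)
      refine le_iSup_of_le n (ENNReal.ofReal_le_ofReal (le_min le_rfl ?_))
      linarith
  · intro n
    fun_prop
  · intro n m hnm ξ
    dsimp only
    gcongr
    exact min_le_min le_rfl (by gcongr)

lemma hs_sq_le_iff {s : ℝ} {f : HL2} {K : ℝ} (hK : 0 ≤ K) :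
    hs s f ^ 2 ≤ ENNReal.ofReal K ↔ ∀ n, energy s n f ≤ K := by
  rw [← iSup_wEnergy, iSup_le_iff]
  refine forall_congr' fun n => ?_
  rw [← ofReal_energy, ENNReal.ofReal_le_ofReal_iff hK]

/-- The norm of `H^σ` on the Fourier side, as a real number. -/
noncomputable def hn (σ : ℝ) (f : HL2) : ℝ := (hs σ f).toReal

lemma hn_nonneg (σ : ℝ) (f : HL2) : 0 ≤ hn σ f := ENNReal.toReal_nonneg

lemma ofReal_hn {σ : ℝ} {f : HL2} (h : hs σ f < ⊤) : ENNReal.ofReal (hn σ f) = hs σ f :=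
  ENNReal.ofReal_toReal h.ne

lemma energy_le {s : ℝ} {f : HL2} (h : hs s f < ⊤) (n : ℕ) : energy s n f ≤ hn s f ^ 2 := by
  refine (hs_sq_le_iff (sq_nonneg _)).1 ?_ n
  rw [ENNReal.ofReal_pow (hn_nonneg s f), ofReal_hn h]

/-- Monotone convergence in the truncation height. Finiteness is part of the conclusion because `hn`
takes the default value `0` when `hs` is infinite. -/
lemma hs_lt_top_of_energy_le {s : ℝ} {f : HL2} {K : ℝ} (hK : 0 ≤ K)
    (h : ∀ n, energy s n f ≤ K ^ 2) : hs s f < ⊤ ∧ hn s f ≤ K := by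
  have h1 := (hs_sq_le_iff (sq_nonneg K)).2 h
  rw [ENNReal.ofReal_pow hK, ENNReal.pow_le_pow_left_iff two_ne_zero] at h1
  exact ⟨h1.trans_lt ENNReal.ofReal_lt_top, ENNReal.toReal_le_of_le_ofReal hK h1⟩

lemma tendsto_energy {s : ℝ} {f : HL2} (h : hs s f < ⊤) :
    Tendsto (fun n => energy s n f) atTop (𝓝 (hn s f ^ 2)) := by
  have hmono : Monotone fun n => wEnergy (truncWeight s n) f := by
    intro n m hnm
    refine lintegral_mono fun ξ => ?_
    dsimp only
    gcongr
    exact min_le_min le_rfl (by gcongr)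
  have h1 := tendsto_atTop_iSup hmono
  rw [iSup_wEnergy] at h1
  have h2 := (ENNReal.tendsto_toReal (ENNReal.pow_ne_top h.ne)).comp h1
  rw [ENNReal.toReal_pow] at h2
  refine h2.congr fun n => ?_
  rw [Function.comp_apply, ← ofReal_energy, ENNReal.toReal_ofReal (energy_nonneg s n f)]

lemma energy_le_norm_sq (s : ℝ) (n : ℕ) (f : HL2) : energy s n f ≤ (n + 1) * ‖f‖ ^ 2 := by
  rw [← ENNReal.ofReal_le_ofReal_iff (by positivity), ofReal_energy,
    ENNReal.ofReal_mul (by positivity), ENNReal.ofReal_pow (norm_nonneg _), ofReal_norm,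
    Lp.enorm_def, eLpNorm_eq_l2, l2_sq, wEnergy,
    ← lintegral_const_mul' _ _ ENNReal.ofReal_ne_top]
  gcongr with ξ
  exact min_le_right _ _

/-- On a fixed frequency ball a high enough truncation is inactive, so the Galerkin approximations
can be measured in the true `H^s` norm. -/
lemma exists_energy_eq_of_lowPass {s : ℝ} (hs0 : 0 ≤ s) (m : ℕ) :
    ∃ n : ℕ, ∀ f : HL2, lowPass m f = f → energy s n f = hn s f ^ 2 := by
  have hpi := Real.pi_pos
  obtain ⟨n, hn'⟩ := exists_nat_ge ((1 + (2 * Real.pi * m) ^ 2) ^ s)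
  refine ⟨n, fun f hf => ?_⟩
  have h := mulOp_coe (bddMul_cut m) f
  change (lowPass m f : E3 → C3) =ᵐ[volume] _ at h
  rw [hf] at h
  have h1 : wEnergy (truncWeight s n) f = hs s f ^ 2 := by
    rw [hs_sq, wEnergy]
    apply lintegral_congr_ae
    filter_upwards [h] with ξ hξ
    by_cases hb : ξ ∈ Metric.closedBall (0 : E3) m
    · rw [mem_closedBall_zero_iff] at hb
      congr 2
      apply min_eq_left
      have : jb ξ ^ s ≤ (1 + (2 * Real.pi * m) ^ 2) ^ s := by
        apply Real.rpow_le_rpow (jb_pos ξ).le _ hs0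
        unfold jb; gcongr
      linarith
    · rw [hξ]; simp [cut, hb]
  rw [← ENNReal.toReal_ofReal (energy_nonneg s n f), ofReal_energy, h1, ENNReal.toReal_pow, hn]

/-- Interpolation between `L²` and `H^s`. -/
lemma hn_sq_le {σ s : ℝ} (hσ : 0 ≤ σ) (hσs : σ ≤ s) {f : HL2} (hf : hs s f < ⊤) {Λ : ℝ}
    (hΛ : 1 ≤ Λ) : hn σ f ^ 2 ≤ Λ ^ (σ - s) * hn s f ^ 2 + Λ ^ σ * ‖f‖ ^ 2 := by
  have hΛ0 : 0 < Λ := by linarith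
  have hfσ := (hs_mono_exponent hσs f).trans_lt hf
  rw [← ENNReal.ofReal_le_ofReal_iff (by positivity), ENNReal.ofReal_add (by positivity)
    (by positivity), ENNReal.ofReal_mul (by positivity), ENNReal.ofReal_mul (by positivity),
    ENNReal.ofReal_pow (hn_nonneg _ _), ENNReal.ofReal_pow (hn_nonneg _ _),
    ENNReal.ofReal_pow (norm_nonneg _), ofReal_hn hf, ofReal_hn hfσ, ofReal_norm,
    Lp.enorm_def, eLpNorm_eq_l2, l2_sq, hs_sq, hs_sq, ← lintegral_const_mul' _ _ ENNReal.ofReal_ne_top,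
    ← lintegral_const_mul' _ _ ENNReal.ofReal_ne_top]
  have hfm := measurable_coe_HL2 f
  rw [← lintegral_add_left (by fun_prop)]
  gcongr with ξ
  rw [← mul_assoc, ← add_mul, ← ENNReal.ofReal_mul (by positivity), ← ENNReal.ofReal_add
    (by have := jb_pos ξ; positivity) (by positivity)]
  gcongr
  have hj := jb_pos ξ
  rcases le_total (jb ξ) Λ with h | h
  · have : jb ξ ^ σ ≤ Λ ^ σ := Real.rpow_le_rpow hj.le h hσ
    have : 0 ≤ Λ ^ (σ - s) * jb ξ ^ s := by positivity
    linarith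
  · have h1 : jb ξ ^ (σ - s) ≤ Λ ^ (σ - s) := Real.rpow_le_rpow_of_nonpos hΛ0 h (by linarith)
    have h2 : jb ξ ^ σ = jb ξ ^ (σ - s) * jb ξ ^ s := by
      rw [← Real.rpow_add hj, sub_add_cancel]
    rw [h2]
    have : jb ξ ^ (σ - s) * jb ξ ^ s ≤ Λ ^ (σ - s) * jb ξ ^ s := by gcongr
    have : 0 ≤ Λ ^ σ := by positivity
    linarith

lemma norm_le_hn {σ : ℝ} (hσ : 0 ≤ σ) {f : HL2} (hf : hs σ f < ⊤) : ‖f‖ ≤ hn σ f := by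
  rw [← ENNReal.ofReal_le_ofReal_iff (hn_nonneg _ _), ofReal_hn hf, ofReal_norm, Lp.enorm_def,
    eLpNorm_eq_l2]
  exact l2_enorm_le_hs hσ f

lemma hs_sub_lt_top {σ : ℝ} {f g : HL2} (hf : hs σ f < ⊤) (hg : hs σ g < ⊤) :
    hs σ (f - g : HL2) < ⊤ := by
  rw [hs_sub_coe]
  exact (hs_sub_le σ (Lp.aestronglyMeasurable f) (Lp.aestronglyMeasurable g)).trans_lt
    (ENNReal.add_lt_top.2 ⟨hf, hg⟩)

lemma hn_sub_le {σ : ℝ} {f g : HL2} (hf : hs σ f < ⊤) (hg : hs σ g < ⊤) :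
    hn σ (f - g) ≤ hn σ f + hn σ g := by
  rw [hn, hs_sub_coe, hn, hn, ← ENNReal.toReal_add hf.ne hg.ne]
  exact ENNReal.toReal_mono (ENNReal.add_ne_top.2 ⟨hf.ne, hg.ne⟩)
    (hs_sub_le σ (Lp.aestronglyMeasurable f) (Lp.aestronglyMeasurable g))

lemma hn_sub_comm (σ : ℝ) (f g : HL2) : hn σ (f - g) = hn σ (g - f) := by
  unfold hn
  congr 1
  apply le_antisymm <;>
  · apply hs_mono_ae
    filter_upwards [Lp.coeFn_sub f g, Lp.coeFn_sub g f] with ξ h1 h2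
    rw [h1, h2, Pi.sub_apply, Pi.sub_apply, norm_sub_rev]

lemma hn_le_add_hn_sub {σ : ℝ} {f g : HL2} (hf : hs σ f < ⊤) (hg : hs σ g < ⊤) :
    hn σ f ≤ hn σ g + hn σ (f - g) := by
  have h := hn_sub_le hg (hs_sub_lt_top hg hf)
  rw [sub_sub_cancel, hn_sub_comm σ g f] at h
  exact h

lemma abs_hn_sub_hn_le {σ : ℝ} {f g : HL2} (hf : hs σ f < ⊤) (hg : hs σ g < ⊤) :
    |hn σ f - hn σ g| ≤ hn σ (f - g) := by
  have h1 := hn_le_add_hn_sub hf hg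
  have h2 := hn_le_add_hn_sub hg hf
  rw [hn_sub_comm] at h2
  exact abs_le.2 ⟨by linarith, by linarith⟩

lemma hn_mono_exponent {τ σ : ℝ} (h : τ ≤ σ) {f : HL2} (hf : hs σ f < ⊤) : hn τ f ≤ hn σ f :=
  ENNReal.toReal_mono hf.ne (hs_mono_exponent h f)

/-! ### The estimates for elements of `L²` -/

lemma exists_norm_nonlin_sub_le {γ : ℝ → ℝ} (hγ : AdmissibleSymbol γ) {σ : ℝ} (hσ : 5 / 2 < σ) :
    ∃ C : ℝ, 0 < C ∧ ∀ f g : HL2, hs σ f < ⊤ → hs σ g < ⊤ →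
      ‖nonlin γ f - nonlin γ g‖ ≤ C * (hn σ (f - g) * (hn σ f + hn σ g)) := by
  obtain ⟨C, hC0, hC⟩ := exists_nonlin_sub_le hγ hσ
  refine ⟨C, hC0, fun f g hf hg => ?_⟩
  have h := hC f g hf hg
  have h1 := hn_nonneg σ f
  have h2 := hn_nonneg σ g
  have h3 := hn_nonneg σ (f - g)
  rw [← ofReal_hn hf, ← ofReal_hn hg, ← ofReal_hn (hs_sub_lt_top hf hg),
    ← ENNReal.ofReal_add h1 h2, ← ENNReal.ofReal_mul h3, ← ENNReal.ofReal_mul hC0.le,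
    ← ofReal_norm, ENNReal.ofReal_le_ofReal_iff (by positivity)] at h
  exact h

lemma exists_norm_tail_le {γ : ℝ → ℝ} (hγ : AdmissibleSymbol γ) {σ : ℝ} (hσ : 5 / 2 < σ) :
    ∃ C : ℝ, 0 < C ∧ ∀ (n : ℕ) (f : HL2), hs σ f < ⊤ →
      ‖nonlin γ f - lowPass n (nonlin γ f)‖ ≤ (1 + n : ℝ) ^ (-marg σ) * (C * hn σ f ^ 2) := by
  obtain ⟨C, hC0, hC⟩ := exists_tail_bound hγ hσ
  refine ⟨C, hC0, fun n f hf => ?_⟩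
  have h := hC n f hf
  have h1 := hn_nonneg σ f
  rw [← ofReal_hn hf, ← ENNReal.ofReal_pow h1, ← ENNReal.ofReal_mul hC0.le,
    ← ENNReal.ofReal_mul (by positivity), ← ofReal_norm,
    ENNReal.ofReal_le_ofReal_iff (by positivity)] at h
  exact h

lemma exists_toReal_yn_le {s : ℝ} (hs' : 5 / 2 < s) :
    ∃ C : ℝ, 0 < C ∧ ∀ f : HL2, hs s f < ⊤ → yn f < ⊤ ∧ (yn f).toReal ≤ C * hn s f := by
  obtain ⟨C, hC0, hC⟩ := exists_yn_le hs'
  refine ⟨C, hC0, fun f hf => ?_⟩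
  have h := hC f (measurable_coe_HL2 f)
  have h1 := hn_nonneg s f
  rw [← ofReal_hn hf, ← ENNReal.ofReal_mul hC0.le] at h
  exact ⟨h.trans_lt ENNReal.ofReal_lt_top, ENNReal.toReal_le_of_le_ofReal (by positivity) h⟩

lemma yn_congr_ae {f g : E3 → C3} (h : f =ᵐ[volume] g) : yn f = yn g := by
  apply lintegral_congr_ae
  filter_upwards [h] with ξ hξ
  rw [hξ]

lemma wEnergy_congr_ae {W : E3 → ℝ} {f g : E3 → C3} (h : f =ᵐ[volume] g) :
    wEnergy W f = wEnergy W g := by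
  apply lintegral_congr_ae
  filter_upwards [h] with ξ hξ
  rw [hξ]

/-- The left side is the derivative of `energy s n` along a solution. Uniformity in `n` lets the
truncation be removed after integration in time. -/
theorem exists_energy_deriv_le {γ : ℝ → ℝ} (hγ : AdmissibleSymbol γ) {s : ℝ} (hs' : 5 / 2 < s) :
    ∃ C : ℝ, 0 < C ∧ ∀ (n : ℕ) (f : HL2), f ∈ solenoidal → hs s f < ⊤ →
      |2 * (inner ℂ (mulOp (bddMul_truncWeight s n) f) (nonlin γ f)).re|
        ≤ C * (yn f).toReal * energy s n f := by
  obtain ⟨A, hA, hW⟩ := exists_weightBound (by linarith : 1 ≤ s)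
  obtain ⟨C, hC0, hC⟩ := exists_energy_bound hγ hA
  obtain ⟨_, -, hy⟩ := exists_toReal_yn_le hs'
  refine ⟨C, hC0, fun n f hf hfs => ?_⟩
  obtain ⟨g, hg, hfg⟩ := exists_niceField hf
  have h := hC _ (hW n) s hs' g hg (by rwa [← hs_congr_ae hfg])
  rw [← yn_congr_ae hfg, ← wEnergy_congr_ae hfg, ← ofReal_energy,
    ← ENNReal.ofReal_toReal (a := yn f) (hy f hfs).1.ne, ← ENNReal.ofReal_mul hC0.le,
    ← ENNReal.ofReal_mul (by positivity), ENNReal.ofReal_le_ofReal_iff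
      (mul_nonneg (by positivity) (energy_nonneg s n f))] at h
  rw [inner_mulOp_left]
  convert h using 4
  apply integral_congr_ae
  filter_upwards [hfg, nonlin_coe hγ hs' hfs] with ξ h1 h2
  rw [h2, h1, quadHat_congr_ae hfg hfg]

lemma integrable_inner_of_memLp {f g : E3 → C3} (hf : MemLp f 2) (hg : MemLp g 2) :
    Integrable fun ξ => inner ℂ (f ξ) (g ξ) := by
  refine (L2.integrable_inner (𝕜 := ℂ) (hf.toLp f) (hg.toLp g)).congr ?_
  filter_upwards [hf.coeFn_toLp, hg.coeFn_toLp] with ξ h1 h2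
  rw [h1, h2]

theorem exists_norm_sub_sq_deriv_le {γ : ℝ → ℝ} (hγ : AdmissibleSymbol γ) {σ : ℝ}
    (hσ : 5 / 2 < σ) :
    ∃ C : ℝ, 0 < C ∧ ∀ f g : HL2, f ∈ solenoidal → g ∈ solenoidal → hs σ f < ⊤ → hs σ g < ⊤ →
      |2 * (inner ℂ (f - g) (nonlin γ f - nonlin γ g)).re|
        ≤ C * (hn σ f + hn σ g) * ‖f - g‖ ^ 2 := by
  obtain ⟨C, hC0, hC⟩ := exists_difference_bound hγ hσ
  refine ⟨C, hC0, fun f g hf hg hfs hgs => ?_⟩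
  obtain ⟨f', hf', hff⟩ := exists_niceField hf
  obtain ⟨g', hg', hgg⟩ := exists_niceField hg
  have hfs' : hs σ f' < ⊤ := by rwa [← hs_congr_ae hff]
  have hgs' : hs σ g' < ⊤ := by rwa [← hs_congr_ae hgg]
  have hd := hf'.sub hg'
  have hds : hs σ (f' - g') < ⊤ :=
    (hs_sub_le σ hf'.meas.aestronglyMeasurable hg'.meas.aestronglyMeasurable).trans_lt
      (ENNReal.add_lt_top.2 ⟨hfs', hgs'⟩)
  have hdd : (f - g : HL2) =ᵐ[volume] f' - g' :=
    (Lp.coeFn_sub f g).trans (hff.sub hgg)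
  have h := hC (f' - g') f' g' hd hf' hg' hds hfs' hgs'
  have e1 : l2 (fun ξ => ‖(f' - g') ξ‖ₑ) = ENNReal.ofReal ‖f - g‖ := by
    rw [ofReal_norm, Lp.enorm_def, eLpNorm_congr_ae hdd, eLpNorm_eq_l2]
  have h1 := hn_nonneg σ f
  have h2 := hn_nonneg σ g
  rw [e1, ← hs_congr_ae hff, ← hs_congr_ae hgg, ← ofReal_hn hfs, ← ofReal_hn hgs,
    ← ENNReal.ofReal_add h1 h2, ← ENNReal.ofReal_pow (norm_nonneg _),
    ← ENNReal.ofReal_mul (by positivity), ← ENNReal.ofReal_mul (by positivity),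
    ENNReal.ofReal_le_ofReal_iff (by positivity), ← mul_assoc] at h
  have hm1 := memLp_quadHat hγ hσ hd.meas hf'.meas hds hfs'
  have hm2 := memLp_quadHat hγ hσ hg'.meas hd.meas hgs' hds
  have hm0 : MemLp (f' - g') 2 := (memLp_congr_ae hdd).1 (Lp.memLp _)
  have e2 : inner ℂ (f - g) (nonlin γ f - nonlin γ g)
      = (∫ ξ, inner ℂ ((f' - g') ξ) (quadHat γ (f' - g') f' ξ))
        + ∫ ξ, inner ℂ ((f' - g') ξ) (quadHat γ g' (f' - g') ξ) := by
    rw [← integral_add]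
    · rw [L2.inner_def]
      apply integral_congr_ae
      filter_upwards [hdd, Lp.coeFn_sub (nonlin γ f) (nonlin γ g), nonlin_coe hγ hσ hfs,
        nonlin_coe hγ hσ hgs, quadHat_sub_quadHat hγ hσ hf'.meas hg'.meas hfs' hgs']
        with ξ a1 a2 a3 a4 a5
      rw [a1, a2, Pi.sub_apply (f := nonlin γ f) (g := nonlin γ g), a3, a4, quadHat_congr_ae hff hff, quadHat_congr_ae hgg hgg,
        ← inner_add_right, ← Pi.add_apply, ← a5]
      rfl
    · exact integrable_inner_of_memLp hm0 hm1
    · exact integrable_inner_of_memLp hm0 hm2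
  rw [e2, Complex.add_re, mul_add]
  exact h

/-! ### Solutions on the Fourier side -/

/-- Solutions of the equation in terms of the Fourier transform. -/
structure FourierSolution (γ : ℝ → ℝ) (s : ℝ) (I : Set ℝ) (b : ℝ → HL2) : Prop where
  memHs : ∀ t ∈ I, hs s (b t) < ⊤
  continuousHs : ∀ t ∈ I, Tendsto (fun τ => hn s (b τ - b t)) (𝓝[I] t) (𝓝 0)
  solenoidal : ∀ t ∈ I, b t ∈ solenoidal
  hasDeriv : ∀ t ∈ I, HasDerivWithinAt b (nonlin γ (b t)) I t

lemma FourierSolution.mono {γ : ℝ → ℝ} {s : ℝ} {I J : Set ℝ} {b : ℝ → HL2}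
    (h : FourierSolution γ s I b) (hJ : J ⊆ I) : FourierSolution γ s J b where
  memHs t ht := h.memHs t (hJ ht)
  continuousHs t ht := (h.continuousHs t (hJ ht)).mono_left (nhdsWithin_mono _ hJ)
  solenoidal t ht := h.solenoidal t (hJ ht)
  hasDeriv t ht := (h.hasDeriv t (hJ ht)).mono hJ

lemma hasDerivWithinAt_re_inner_mulOp {w : E3 → ℝ} (hw : BddMul w) {b : ℝ → HL2} {b' : HL2}
    {I : Set ℝ} {t : ℝ} (h : HasDerivWithinAt b b' I t) :
    HasDerivWithinAt (fun τ => (inner ℂ (mulOp hw (b τ)) (b τ)).re)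
      (2 * (inner ℂ (mulOp hw (b t)) b').re) I t := by
  have h1 := ((mulOp hw).hasFDerivAt (x := b t)).comp_hasDerivWithinAt t h
  have h2 := h1.inner ℂ h
  have h3 := (Complex.reCLM.hasFDerivAt).comp_hasDerivWithinAt t h2
  refine h3.congr_deriv ?_
  rw [map_add, Complex.reCLM_apply, Complex.reCLM_apply, ← inner_mulOp_right,
    ← inner_conj_symm b' (mulOp hw (b t)), Complex.conj_re, Function.comp_apply]
  ring

lemma hasDerivWithinAt_energy (s : ℝ) (n : ℕ) {b : ℝ → HL2} {b' : HL2} {I : Set ℝ} {t : ℝ}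
    (h : HasDerivWithinAt b b' I t) :
    HasDerivWithinAt (fun τ => energy s n (b τ))
      (2 * (inner ℂ (mulOp (bddMul_truncWeight s n) (b t)) b').re) I t :=
  hasDerivWithinAt_re_inner_mulOp _ h

lemma hasDerivWithinAt_norm_sq {b : ℝ → HL2} {b' : HL2} {I : Set ℝ} {t : ℝ}
    (h : HasDerivWithinAt b b' I t) :
    HasDerivWithinAt (fun τ => ‖b τ‖ ^ 2) (2 * (inner ℂ (b t) b').re) I t := by
  have h3 := (Complex.reCLM.hasFDerivAt).comp_hasDerivWithinAt t (h.inner ℂ h)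
  have e : (fun τ => ‖b τ‖ ^ 2) = Complex.reCLM ∘ fun τ => inner ℂ (b τ) (b τ) := by
    ext1 τ
    simp only [Function.comp_apply, Complex.reCLM_apply]
    rw [inner_self_eq_norm_sq_to_K]
    norm_cast
  rw [e]
  refine h3.congr_deriv ?_
  rw [map_add, Complex.reCLM_apply, Complex.reCLM_apply, ← inner_conj_symm b' (b t),
    Complex.conj_re]
  ring

lemma FourierSolution.continuousOn_hn {γ : ℝ → ℝ} {s : ℝ} {I : Set ℝ} {b : ℝ → HL2}
    (h : FourierSolution γ s I b) : ContinuousOn (fun t => hn s (b t)) I := by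
  intro t ht
  rw [ContinuousWithinAt, tendsto_iff_dist_tendsto_zero]
  refine squeeze_zero' (Eventually.of_forall fun _ => dist_nonneg) ?_ (h.continuousHs t ht)
  filter_upwards [self_mem_nhdsWithin] with τ hτ
  exact abs_hn_sub_hn_le (h.memHs τ hτ) (h.memHs t ht)

lemma FourierSolution.exists_hn_le {γ : ℝ → ℝ} {s T : ℝ} {b : ℝ → HL2}
    (h : FourierSolution γ s (Icc 0 T) b) : ∃ K : ℝ, 0 < K ∧ ∀ t ∈ Icc 0 T, hn s (b t) ≤ K := by
  obtain ⟨K, hK⟩ := isCompact_Icc.exists_bound_of_continuousOn h.continuousOn_hn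
  refine ⟨max K 1, by positivity, fun t ht => ?_⟩
  exact (le_abs_self _).trans ((hK t ht).trans (le_max_left _ _))

lemma hasDerivWithinAt_Ici {E : Type*} [NormedAddCommGroup E] [NormedSpace ℝ E] {f : ℝ → E}
    {f' : E} {a T t : ℝ} (ht : t ∈ Ico a T) (h : HasDerivWithinAt f f' (Icc a T) t) :
    HasDerivWithinAt f f' (Ici t) t := by
  have h1 := h.mono (Icc_subset_Icc_left ht.1)
  exact h1.mono_of_mem_nhdsWithin (Icc_mem_nhdsGE ht.2)

/-- Uniqueness. -/
theorem FourierSolution.eqOn {γ : ℝ → ℝ} (hγ : AdmissibleSymbol γ) {s : ℝ} (hs' : 5 / 2 < s)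
    {T : ℝ} {b c : ℝ → HL2} (hb : FourierSolution γ s (Icc 0 T) b)
    (hc : FourierSolution γ s (Icc 0 T) c) (h0 : b 0 = c 0) : EqOn b c (Icc 0 T) := by
  obtain ⟨C, hC0, hC⟩ := exists_norm_sub_sq_deriv_le hγ hs'
  obtain ⟨K, hK0, hK⟩ := hb.exists_hn_le
  obtain ⟨L, hL0, hL⟩ := hc.exists_hn_le
  have hd : ∀ t ∈ Icc 0 T, HasDerivWithinAt (fun τ => ‖(b - c) τ‖ ^ 2)
      (2 * (inner ℂ (b t - c t) (nonlin γ (b t) - nonlin γ (c t))).re) (Icc 0 T) t := fun t ht =>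
    hasDerivWithinAt_norm_sq ((hb.hasDeriv t ht).sub (hc.hasDeriv t ht))
  -- Both `H^s` norms are bounded on the compact interval, so Grönwall's inequality applies to the
  -- squared `L²` distance, which starts at zero.
  have key := eq_zero_of_abs_deriv_le_mul_abs_self_of_eq_zero_right (K := C * (K + L))
    (f := fun τ => ‖(b - c) τ‖ ^ 2) (a := 0) (b := T)
    (fun t ht => (hd t ht).continuousWithinAt)
    (fun t ht => hasDerivWithinAt_Ici ht (hd t (Ico_subset_Icc_self ht))) (by simp [h0])
    (fun t ht => by
      have ht' := Ico_subset_Icc_self ht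
      rw [Real.norm_eq_abs, Real.norm_of_nonneg (sq_nonneg _)]
      refine (hC _ _ (hb.solenoidal t ht') (hc.solenoidal t ht') (hb.memHs t ht')
        (hc.memHs t ht')).trans ?_
      rw [Pi.sub_apply]
      gcongr
      · exact hK t ht'
      · exact hL t ht')
  intro t ht
  have := key t ht
  simpa [sub_eq_zero] using this

/-! ### Growth of the Sobolev norm -/

lemma yn_le_add_yn_sub (f g : HL2) : yn f ≤ yn g + yn (f - g : HL2) := by
  unfold yn
  have hg := measurable_coe_HL2 g
  rw [← lintegral_add_left (by fun_prop)]
  apply lintegral_mono_ae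
  filter_upwards [Lp.coeFn_sub f g] with ξ hξ
  rw [hξ, ← mul_add]
  gcongr
  calc ‖f ξ‖ₑ = ‖g ξ + (⇑f - ⇑g) ξ‖ₑ := by simp
    _ ≤ _ := enorm_add_le _ _

lemma FourierSolution.continuousOn_yn {γ : ℝ → ℝ} {s : ℝ} (hs' : 5 / 2 < s) {I : Set ℝ}
    {b : ℝ → HL2} (h : FourierSolution γ s I b) : ContinuousOn (fun t => (yn (b t)).toReal) I := by
  obtain ⟨C, hC0, hC⟩ := exists_toReal_yn_le hs'
  have key : ∀ f g : HL2, hs s f < ⊤ → hs s g < ⊤ →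
      (yn f).toReal - (yn g).toReal ≤ C * hn s (f - g) := by
    intro f g hf hg
    have hfg := hC _ (hs_sub_lt_top hf hg)
    have h1 := ENNReal.toReal_mono (ENNReal.add_ne_top.2 ⟨(hC g hg).1.ne, hfg.1.ne⟩)
      (yn_le_add_yn_sub f g)
    rw [ENNReal.toReal_add (hC g hg).1.ne hfg.1.ne] at h1
    linarith [hfg.2]
  intro t ht
  rw [ContinuousWithinAt, tendsto_iff_dist_tendsto_zero]
  have h0 := (h.continuousHs t ht).const_mul C
  rw [mul_zero] at h0
  refine squeeze_zero' (Eventually.of_forall fun _ => dist_nonneg) ?_ h0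
  filter_upwards [self_mem_nhdsWithin] with τ hτ
  have h1 := key _ _ (h.memHs τ hτ) (h.memHs t ht)
  have h2 := key _ _ (h.memHs t ht) (h.memHs τ hτ)
  rw [hn_sub_comm] at h2
  exact abs_le.2 ⟨by linarith, by linarith⟩

/-- Grönwall's inequality with a variable coefficient. -/
lemma le_mul_exp_of_deriv_le {T : ℝ} (hT : 0 ≤ T) {E E' y : ℝ → ℝ} (hy : Continuous y)
    (hE : ∀ t ∈ Icc 0 T, HasDerivWithinAt E (E' t) (Icc 0 T) t)
    (hle : ∀ t ∈ Icc 0 T, E' t ≤ y t * E t) : E T ≤ E 0 * Real.exp (∫ t in 0..T, y t) := by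
  set Y : ℝ → ℝ := fun t => ∫ τ in 0..t, y τ with hY
  have hYd : ∀ t, HasDerivAt Y (y t) t := fun t =>
    intervalIntegral.integral_hasDerivAt_right (hy.intervalIntegrable _ _)
      (hy.stronglyMeasurableAtFilter _ _) hy.continuousAt
  have hF : ∀ t ∈ Icc 0 T, HasDerivWithinAt (fun t => E t * Real.exp (-Y t))
      (E' t * Real.exp (-Y t) + E t * (Real.exp (-Y t) * -y t)) (Icc 0 T) t := fun t ht =>
    (hE t ht).mul ((hYd t).neg.exp.hasDerivWithinAt)
  have hanti : AntitoneOn (fun t => E t * Real.exp (-Y t)) (Icc 0 T) := by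
    refine antitoneOn_of_hasDerivWithinAt_nonpos (convex_Icc 0 T)
      (fun t ht => (hF t ht).continuousWithinAt)
      (fun t ht => (hF t (interior_subset ht)).mono interior_subset) (fun t ht => ?_)
    have h1 := hle t (interior_subset ht)
    have h2 := Real.exp_pos (-Y t)
    nlinarith
  have h := hanti (left_mem_Icc.2 hT) (right_mem_Icc.2 hT) hT
  have h0 : Y 0 = 0 := by simp [hY]
  simp only [h0, neg_zero, Real.exp_zero, mul_one] at h
  calc E T = E T * Real.exp (-Y T) * Real.exp (Y T) := by
        rw [mul_assoc, ← Real.exp_add, neg_add_cancel, Real.exp_zero, mul_one]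
    _ ≤ _ := by gcongr

/-- The Sobolev norm of a solution is controlled by the time integral of its `𝒴¹` norm. -/
theorem exists_hn_sq_le_exp {γ : ℝ → ℝ} (hγ : AdmissibleSymbol γ) {s : ℝ} (hs' : 5 / 2 < s) :
    ∃ C : ℝ, 0 < C ∧ ∀ (T : ℝ), 0 ≤ T → ∀ b : ℝ → HL2, FourierSolution γ s (Icc 0 T) b →
      ∀ K : ℝ, 0 ≤ K → ∫⁻ t in Ioo 0 T, yn (b t) ≤ ENNReal.ofReal K →
      hn s (b T) ^ 2 ≤ hn s (b 0) ^ 2 * Real.exp (C * K) := by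
  obtain ⟨C, hC0, hC⟩ := exists_energy_deriv_le hγ hs'
  obtain ⟨_, -, hyC⟩ := exists_toReal_yn_le hs'
  refine ⟨C, hC0, fun T hT b hb K hK hfin_int => ?_⟩
  -- A continuous extension to the line, so that its primitive is differentiable everywhere, the
  -- endpoints included.
  set y : ℝ → ℝ := IccExtend hT ((Icc 0 T).domRestrict fun t => (yn (b t)).toReal) with hy
  have hyc : Continuous y :=
    (continuousOn_iff_continuous_domRestrict.1 (hb.continuousOn_yn hs')).Icc_extend'
  have hyv : ∀ t ∈ Icc 0 T, y t = (yn (b t)).toReal := fun t ht => by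
    rw [hy, IccExtend_of_mem _ _ ht, domRestrict_apply]
  have hy0 : ∀ t, 0 ≤ y t := fun t => ENNReal.toReal_nonneg
  have hI : ∫ t in 0..T, y t ≤ K := by
    rw [intervalIntegral.integral_of_le hT, integral_Ioc_eq_integral_Ioo,
      integral_eq_lintegral_of_nonneg_ae (ae_of_all _ hy0) hyc.aestronglyMeasurable]
    refine ENNReal.toReal_le_of_le_ofReal hK (le_trans (le_of_eq ?_) hfin_int)
    refine setLIntegral_congr_fun measurableSet_Ioo fun t ht => ?_
    have ht' := Ioo_subset_Icc_self ht
    rw [hyv t ht', ENNReal.ofReal_toReal (hyC _ (hb.memHs t ht')).1.ne]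
  have h0 := hb.memHs 0 (left_mem_Icc.2 hT)
  have key : ∀ n, energy s n (b T) ≤ hn s (b 0) ^ 2 * Real.exp (C * K) := by
    intro n
    have h1 := le_mul_exp_of_deriv_le hT (hyc.const_mul C)
      (fun t ht => hasDerivWithinAt_energy s n (hb.hasDeriv t ht)) (fun t ht => by
        rw [hyv t ht]
        exact (le_abs_self _).trans (hC n _ (hb.solenoidal t ht) (hb.memHs t ht)))
    refine h1.trans ?_
    rw [intervalIntegral.integral_const_mul]
    gcongr
    exact energy_le h0 n
  have h2 := (hs_lt_top_of_energy_le (K := √(hn s (b 0) ^ 2 * Real.exp (C * K)))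
    (Real.sqrt_nonneg _) (fun n => by rw [Real.sq_sqrt (by positivity)]; exact key n)).2
  have h3 := hn_nonneg s (b T)
  calc hn s (b T) ^ 2 ≤ (√(hn s (b 0) ^ 2 * Real.exp (C * K))) ^ 2 := by gcongr
    _ = _ := Real.sq_sqrt (by positivity)

/-! ### The Galerkin approximation -/

/-- A global bound on `G` keeps solutions in the ball of radius `L T`, so Picard–Lindelöf gives the
whole interval at once. -/
lemma exists_solution_of_lipschitz {X : Type*} [NormedAddCommGroup X] [NormedSpace ℝ X]
    [CompleteSpace X] {G : X → X} {K L : ℝ} (hL : ∀ x, ‖G x‖ ≤ L)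
    (hK : ∀ x y, ‖G x - G y‖ ≤ K * ‖x - y‖) {T : ℝ} (hT : 0 ≤ T) (x₀ : X) :
    ∃ x : ℝ → X, x 0 = x₀ ∧ ∀ t ∈ Icc 0 T, HasDerivWithinAt x (G (x t)) (Icc 0 T) t := by
  have hL0 : 0 ≤ L := (norm_nonneg _).trans (hL x₀)
  have hlip : LipschitzWith K.toNNReal G := LipschitzWith.of_dist_le_mul fun x y => by
    rw [dist_eq_norm, dist_eq_norm]
    exact (hK x y).trans (by gcongr; exact Real.le_coe_toNNReal K)
  have h : IsPicardLindelof (fun _ => G) (tmin := 0) (tmax := T) ⟨0, left_mem_Icc.2 hT⟩ x₀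
      (L * T).toNNReal 0 L.toNNReal K.toNNReal := by
    refine ⟨fun _ _ => hlip.lipschitzOnWith, fun _ _ => continuousOn_const, fun _ _ x _ => ?_, ?_⟩
    · rw [Real.coe_toNNReal _ hL0]; exact hL x
    · rw [Real.coe_toNNReal _ hL0, Real.coe_toNNReal _ (by positivity)]
      simp [hT]
  exact h.exists_eq_forall_mem_Icc_hasDerivWithinAt₀

/-- The radial retraction onto a ball. -/
noncomputable def retract {X : Type*} [NormedAddCommGroup X] [NormedSpace ℝ X] (R : ℝ) (x : X) : X :=
  (R / max R ‖x‖) • x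

section Retract

variable {X : Type*} [NormedAddCommGroup X] [NormedSpace ℝ X] {R : ℝ}

lemma retract_of_norm_le (hR : 0 < R) {x : X} (h : ‖x‖ ≤ R) : retract R x = x := by
  rw [retract, max_eq_left h, div_self hR.ne', one_smul]

lemma norm_retract_le (hR : 0 < R) (x : X) : ‖retract R x‖ ≤ R := by
  have hm : 0 < max R ‖x‖ := lt_max_of_lt_left hR
  rw [retract, norm_smul, Real.norm_of_nonneg (by positivity), div_mul_eq_mul_div,
    div_le_iff₀ hm]
  gcongr
  exact le_max_right _ _

lemma norm_retract_sub_le (hR : 0 < R) (x y : X) : ‖retract R x - retract R y‖ ≤ 2 * ‖x - y‖ := by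
  have hx : 0 < max R ‖x‖ := lt_max_of_lt_left hR
  have hy : 0 < max R ‖y‖ := lt_max_of_lt_left hR
  have e : retract R x - retract R y
      = (R / max R ‖x‖) • (x - y) + (R / max R ‖x‖ - R / max R ‖y‖) • y := by
    unfold retract; module
  have h1 : R / max R ‖x‖ ≤ 1 := (div_le_one hx).2 (le_max_left _ _)
  have h2 : |max R ‖y‖ - max R ‖x‖| ≤ ‖x - y‖ := by
    rw [norm_sub_rev, max_comm R, max_comm R]
    exact (abs_max_sub_max_le_abs _ _ R).trans (abs_norm_sub_norm_le y x)
  have h3 : ‖(R / max R ‖x‖ - R / max R ‖y‖) • y‖ ≤ ‖x - y‖ := by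
    have e2 : R / max R ‖x‖ - R / max R ‖y‖
        = (R / max R ‖x‖) * ((max R ‖y‖ - max R ‖x‖) / max R ‖y‖) := by
      field_simp
    rw [norm_smul, e2, norm_mul, Real.norm_of_nonneg (by positivity : 0 ≤ R / max R ‖x‖),
      norm_div, Real.norm_of_nonneg hy.le, Real.norm_eq_abs, mul_assoc]
    calc R / max R ‖x‖ * (|max R ‖y‖ - max R ‖x‖| / max R ‖y‖ * ‖y‖)
        ≤ 1 * (‖x - y‖ / max R ‖y‖ * max R ‖y‖) := by
          gcongr
          exact le_max_right _ _
      _ = ‖x - y‖ := by rw [one_mul, div_mul_cancel₀ _ hy.ne']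
  rw [e]
  calc _ ≤ ‖(R / max R ‖x‖) • (x - y)‖ + ‖(R / max R ‖x‖ - R / max R ‖y‖) • y‖ := norm_add_le _ _
    _ ≤ 1 * ‖x - y‖ + ‖x - y‖ := by
        gcongr
        rw [norm_smul, Real.norm_of_nonneg (by positivity)]
        gcongr
    _ = _ := by ring

end Retract

/-- The solenoidal fields with frequencies in a ball. -/
noncomputable def galerkinSpace (n : ℕ) : Submodule ℝ HL2 :=
  solenoidal ⊓ LinearMap.ker ((lowPass n - ContinuousLinearMap.id ℝ HL2 : HL2 →L[ℝ] HL2) :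
    HL2 →ₗ[ℝ] HL2)

lemma mem_galerkinSpace {n : ℕ} {f : HL2} :
    f ∈ galerkinSpace n ↔ f ∈ solenoidal ∧ lowPass n f = f := by
  simp [galerkinSpace, sub_eq_zero]

lemma isClosed_galerkinSpace (n : ℕ) : IsClosed (galerkinSpace n : Set HL2) :=
  isClosed_solenoidal.inter (ContinuousLinearMap.isClosed_ker _)

lemma lowPass_mem_galerkinSpace {n : ℕ} {f : HL2} (hf : f ∈ solenoidal) :
    lowPass n f ∈ galerkinSpace n :=
  mem_galerkinSpace.2 ⟨mulOp_mem_solenoidal _ (cut_neg n) hf, lowPass_lowPass n f⟩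

lemma exists_hn_le_of_galerkin (σ : ℝ) (hσ : 0 ≤ σ) (n : ℕ) :
    ∃ c : ℝ, 0 ≤ c ∧ ∀ f ∈ galerkinSpace n, hs σ f < ⊤ ∧ hn σ f ≤ c * ‖f‖ := by
  have hpi := Real.pi_pos
  refine ⟨(1 + (2 * Real.pi * n) ^ 2) ^ (σ / 2), by positivity, fun f hf => ?_⟩
  have h := hs_le_of_lowPass hσ (mem_galerkinSpace.1 hf).2
  rw [← ofReal_norm, ← ENNReal.ofReal_mul (by positivity)] at h
  exact ⟨h.trans_lt ENNReal.ofReal_lt_top, ENNReal.toReal_le_of_le_ofReal (by positivity) h⟩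

/-- On band-limited fields every Sobolev norm is controlled by the `L²` norm; the exponent `3` is
any number above `5/2`. -/
lemma exists_norm_nonlin_sub_le_of_galerkin {γ : ℝ → ℝ} (hγ : AdmissibleSymbol γ) {R : ℝ}
    (hR : 0 < R) (n : ℕ) :
    ∃ K : ℝ, 0 ≤ K ∧ ∀ x ∈ galerkinSpace n, ∀ y ∈ galerkinSpace n, ‖x‖ ≤ R → ‖y‖ ≤ R →
      ‖nonlin γ x - nonlin γ y‖ ≤ K * ‖x - y‖ := by
  have hσ : (5 / 2 : ℝ) < 3 := by norm_num
  obtain ⟨c, hc0, hc⟩ := exists_hn_le_of_galerkin 3 (by norm_num) n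
  obtain ⟨C, hC0, hC⟩ := exists_norm_nonlin_sub_le hγ hσ
  refine ⟨C * (c * (c * R + c * R)), by positivity, fun x hx y hy hxR hyR => ?_⟩
  have hx' := hc _ hx
  have hy' := hc _ hy
  have hxy := (hc _ ((galerkinSpace n).sub_mem hx hy)).2
  have h1 : hn 3 x ≤ c * R := hx'.2.trans (by gcongr)
  have h2 : hn 3 y ≤ c * R := hy'.2.trans (by gcongr)
  calc _ ≤ C * (hn 3 (x - y) * (hn 3 x + hn 3 y)) := hC _ _ hx'.1 hy'.1
    _ ≤ C * ((c * ‖x - y‖) * (c * R + c * R)) := by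
        refine mul_le_mul_of_nonneg_left ?_ hC0.le
        exact mul_le_mul hxy (add_le_add h1 h2) (add_nonneg (hn_nonneg _ _) (hn_nonneg _ _))
          (by positivity)
    _ = _ := by ring

/-- Composing the quadratic field with the retraction makes it bounded and globally Lipschitz on the
closed subspace `galerkinSpace n`. The retraction is a scalar multiple, so it preserves that
subspace. -/
lemma exists_galerkin_retract {γ : ℝ → ℝ} (hγ : AdmissibleSymbol γ) {R T : ℝ} (hR : 0 < R)
    (hT : 0 ≤ T) {n : ℕ} {x₀ : HL2} (hx₀ : x₀ ∈ galerkinSpace n) :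
    ∃ x : ℝ → HL2, x 0 = x₀ ∧ (∀ t, x t ∈ galerkinSpace n) ∧ ∀ t ∈ Icc 0 T,
      HasDerivWithinAt x (lowPass n (nonlin γ (retract R (x t)))) (Icc 0 T) t := by
  obtain ⟨c, -, hc⟩ := exists_hn_le_of_galerkin 3 (by norm_num) n
  obtain ⟨K, hK0, hK⟩ := exists_norm_nonlin_sub_le_of_galerkin hγ hR n
  have hr : ∀ x ∈ galerkinSpace n, retract R x ∈ galerkinSpace n := fun x hx =>
    (galerkinSpace n).smul_mem _ hx
  have hmem : ∀ x ∈ galerkinSpace n, lowPass n (nonlin γ (retract R x)) ∈ galerkinSpace n :=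
    fun x hx => lowPass_mem_galerkinSpace (nonlin_mem_solenoidal hγ (by norm_num : (5 / 2 : ℝ) < 3)
      (mem_galerkinSpace.1 (hr x hx)).1 (hc _ (hr x hx)).1)
  have hlip : ∀ x ∈ galerkinSpace n, ∀ y ∈ galerkinSpace n,
      ‖lowPass n (nonlin γ (retract R x)) - lowPass n (nonlin γ (retract R y))‖
        ≤ K * ‖retract R x - retract R y‖ := by
    intro x hx y hy
    rw [← map_sub]
    exact (norm_lowPass_le n _).trans (hK _ (hr x hx) _ (hr y hy) (norm_retract_le hR x)
      (norm_retract_le hR y))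
  have : CompleteSpace (galerkinSpace n) := (isClosed_galerkinSpace n).completeSpace_coe
  obtain ⟨x, hx0, hx⟩ := exists_solution_of_lipschitz
    (G := fun x : galerkinSpace n => (⟨_, hmem x x.2⟩ : galerkinSpace n)) (K := K * 2)
    (L := ‖lowPass n (nonlin γ (retract R 0))‖ + K * (R + R)) (fun x => by
      rw [Submodule.coe_norm]
      refine (norm_le_norm_add_norm_sub' _ (lowPass n (nonlin γ (retract R 0)))).trans ?_
      refine add_le_add le_rfl ((hlip x x.2 0 (zero_mem _)).trans ?_)
      exact mul_le_mul_of_nonneg_left ((norm_sub_le _ _).trans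
        (add_le_add (norm_retract_le hR _) (norm_retract_le hR _))) hK0) (fun x y => by
      rw [Submodule.coe_norm, Submodule.coe_norm]
      refine (hlip x x.2 y y.2).trans ?_
      rw [mul_assoc]
      exact mul_le_mul_of_nonneg_left (norm_retract_sub_le hR _ _) hK0) hT ⟨x₀, hx₀⟩
  refine ⟨fun t => x t, by simp [hx0], fun t => (x t).2, fun t ht => ?_⟩
  exact ((galerkinSpace n).subtypeL.hasFDerivAt).comp_hasDerivWithinAt t (hx t ht)

/-- A solution of the Galerkin approximation on `[0, T]` that is bounded by `K` in `H^s`. -/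
def IsGalerkin (γ : ℝ → ℝ) (s : ℝ) (n : ℕ) (T K : ℝ) (x : ℝ → HL2) : Prop :=
  ∀ t ∈ Icc 0 T, x t ∈ galerkinSpace n ∧ hs s (x t) < ⊤ ∧ hn s (x t) ≤ K ∧
    HasDerivWithinAt x (lowPass n (nonlin γ (x t))) (Icc 0 T) t

/-- Galerkin approximations exist, with uniform bounds, for a time that depends only on the size
of the initial value. -/
theorem exists_galerkin {γ : ℝ → ℝ} (hγ : AdmissibleSymbol γ) {s : ℝ} (hs' : 5 / 2 < s) {R : ℝ}
    (hR : 0 ≤ R) :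
    ∃ T : ℝ, 0 < T ∧ ∀ (n : ℕ), ∀ x₀ ∈ galerkinSpace n, hn s x₀ ≤ R → ∃ x : ℝ → HL2, x 0 = x₀ ∧
      IsGalerkin γ s n T (R + 1) x := by
  obtain ⟨C, hC0, hC⟩ := exists_energy_deriv_le hγ hs'
  obtain ⟨Cy, hCy0, hCy⟩ := exists_toReal_yn_le hs'
  -- `K` bounds the derivative of the energy while the `H^s` norm is at most `R + 1`. On `[0,
  -- 1/(K+1)]` the squared norm then gains at most `1`, and `R² + 1 ≤ (R+1)²`.
  set K := C * (Cy * (R + 1)) * (R + 1) ^ 2 with hK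
  have hK0 : 0 ≤ K := by positivity
  have hT0 : 0 < 1 / (K + 1) := by positivity
  refine ⟨1 / (K + 1), hT0, fun n x₀ hx₀ hx₀R => ?_⟩
  obtain ⟨x, hx0, hxm, hx⟩ := exists_galerkin_retract hγ (by linarith : 0 < R + 1) hT0.le hx₀
  have hs0 : 0 ≤ s := by linarith
  obtain ⟨c, -, hc⟩ := exists_hn_le_of_galerkin s hs0 n
  obtain ⟨m, hm⟩ := exists_energy_eq_of_lowPass hs0 n
  have hE : ∀ t, energy s m (x t) = hn s (x t) ^ 2 := fun t =>
    hm _ (mem_galerkinSpace.1 (hxm t)).2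
  have hret : ∀ t, hn s (x t) ^ 2 ≤ R ^ 2 + 1 →
      hn s (x t) ≤ R + 1 ∧ retract (R + 1) (x t) = x t := by
    intro t ht
    have h1 : hn s (x t) ≤ R + 1 := by
      apply le_of_sq_le_sq _ (by linarith)
      nlinarith
    exact ⟨h1, retract_of_norm_le (by linarith)
      ((norm_le_hn hs0 (hc _ (hxm t)).1).trans h1)⟩
  have hd : ∀ t ∈ Icc 0 (1 / (K + 1)), HasDerivWithinAt (fun τ => energy s m (x τ))
      (2 * (inner ℂ (mulOp (bddMul_truncWeight s m) (x t))
        (lowPass n (nonlin γ (retract (R + 1) (x t))))).re) (Icc 0 (1 / (K + 1))) t := fun t ht =>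
    hasDerivWithinAt_energy s m (hx t ht)
  -- The barrier argument needs the derivative only at contact points. There the energy equals the
  -- barrier, so the norm is at most `R + 1` and the retraction is inactive; the slope `K + 1` makes
  -- the inequality strict.
  have hbound : ∀ t ∈ Icc 0 (1 / (K + 1)), energy s m (x t) ≤ R ^ 2 + (K + 1) * t := by
    refine image_le_of_deriv_right_lt_deriv_boundary (B := fun t => R ^ 2 + (K + 1) * t)
      (B' := fun _ => K + 1) (fun t ht => (hd t ht).continuousWithinAt)
      (fun t ht => hasDerivWithinAt_Ici ht (hd t (Ico_subset_Icc_self ht))) ?_ ?_ ?_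
    · rw [hE, hx0]
      have := hn_nonneg s x₀
      simp only [mul_zero, add_zero]
      gcongr
    · intro t
      simpa using ((hasDerivAt_id t).const_mul (K + 1)).const_add (R ^ 2)
    · intro t ht heq
      have h1 : (K + 1) * t ≤ 1 := by
        have := mul_le_mul_of_nonneg_left ht.2.le (by linarith : 0 ≤ K + 1)
        rwa [mul_one_div_cancel (by positivity)] at this
      rw [hE] at heq
      obtain ⟨h2, h3⟩ := hret t (by rw [heq]; linarith)
      -- The cut-off is self-adjoint, commutes with the weight and fixes `x t`, so it disappears
      -- from the energy identity.
      rw [h3, inner_mulOp_right, mulOp_comm]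
      have h4 : mulOp (bddMul_cut n) (x t) = x t := (mem_galerkinSpace.1 (hxm t)).2
      rw [h4]
      have hxt := hc _ (hxm t)
      have h5 := hC m (x t) (mem_galerkinSpace.1 (hxm t)).1 hxt.1
      have h6 := (hCy _ hxt.1).2
      have h7 := hn_nonneg s (x t)
      calc _ ≤ C * (yn (x t)).toReal * energy s m (x t) := (le_abs_self _).trans h5
        _ ≤ C * (Cy * (R + 1)) * (R + 1) ^ 2 := by
            rw [hE]
            gcongr
            exact h6.trans (by gcongr)
        _ < K + 1 := by linarith
  refine ⟨x, hx0, fun t ht => ?_⟩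
  have h1 : (K + 1) * t ≤ 1 := by
    have := mul_le_mul_of_nonneg_left ht.2 (by linarith : 0 ≤ K + 1)
    rwa [mul_one_div_cancel (by positivity)] at this
  have h2 := hbound t ht
  rw [hE] at h2
  obtain ⟨h3, h4⟩ := hret t (by linarith)
  have h5 := hx t ht
  rw [h4] at h5
  exact ⟨hxm t, (hc _ (hxm t)).1, h3, h5⟩

/-! ### Continuity in `H^s` -/

/-- The part of the energy above the truncation. -/
noncomputable def highEnergy (s : ℝ) (n : ℕ) (f : HL2) : ℝ :=
  (wEnergy (fun ξ => jb ξ ^ s - truncWeight s n ξ) f).toReal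

lemma wEnergy_high_add (s : ℝ) (n : ℕ) (f : HL2) :
    wEnergy (fun ξ => jb ξ ^ s - truncWeight s n ξ) f + wEnergy (truncWeight s n) f
      = hs s f ^ 2 := by
  have hfm := measurable_coe_HL2 f
  rw [hs_sq, wEnergy, wEnergy, ← lintegral_add_right _ (by fun_prop)]
  congr 1
  ext1 ξ
  have h : truncWeight s n ξ ≤ jb ξ ^ s := min_le_left _ _
  rw [← add_mul, ← ENNReal.ofReal_add (sub_nonneg.2 h) (truncWeight_nonneg s n ξ), sub_add_cancel]

lemma wEnergy_high_lt_top {s : ℝ} {f : HL2} (hf : hs s f < ⊤) (n : ℕ) :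
    wEnergy (fun ξ => jb ξ ^ s - truncWeight s n ξ) f < ⊤ :=
  (le_self_add.trans (wEnergy_high_add s n f).le).trans_lt (ENNReal.pow_lt_top hf)

lemma highEnergy_eq {s : ℝ} {f : HL2} (hf : hs s f < ⊤) (n : ℕ) :
    highEnergy s n f = hn s f ^ 2 - energy s n f := by
  have h := congrArg ENNReal.toReal (wEnergy_high_add s n f)
  rw [ENNReal.toReal_add (wEnergy_high_lt_top hf n).ne (by rw [← ofReal_energy]; simp),
    ← ofReal_energy, ENNReal.toReal_ofReal (energy_nonneg s n f), ENNReal.toReal_pow] at h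
  rw [highEnergy, hn]
  linarith

lemma highEnergy_sub_le {s : ℝ} {f g : HL2} (hf : hs s f < ⊤) (hg : hs s g < ⊤) (n : ℕ) :
    highEnergy s n (f - g) ≤ 2 * highEnergy s n f + 2 * highEnergy s n g := by
  set V : E3 → ℝ := fun ξ => jb ξ ^ s - truncWeight s n ξ with hV
  have hf' := wEnergy_high_lt_top hf n
  have hg' := wEnergy_high_lt_top hg n
  have hfm := measurable_coe_HL2 f
  have hVm : Measurable V := by fun_prop
  have h : wEnergy V (f - g : HL2) ≤ 2 * wEnergy V f + 2 * wEnergy V g := by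
    unfold wEnergy
    rw [← lintegral_const_mul' _ _ (by norm_num), ← lintegral_const_mul' _ _ (by norm_num),
      ← lintegral_add_left (by fun_prop)]
    apply lintegral_mono_ae
    filter_upwards [Lp.coeFn_sub f g] with ξ hξ
    rw [hξ, Pi.sub_apply]
    have h1 : ‖f ξ - g ξ‖ₑ ^ 2 ≤ 2 * ‖f ξ‖ₑ ^ 2 + 2 * ‖g ξ‖ₑ ^ 2 := by
      have h2 := norm_sub_le (f ξ) (g ξ)
      have h3 := norm_nonneg (f ξ - g ξ)
      have h4 : ‖f ξ - g ξ‖ ^ 2 ≤ 2 * ‖f ξ‖ ^ 2 + 2 * ‖g ξ‖ ^ 2 := by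
        nlinarith [sq_nonneg (‖f ξ‖ - ‖g ξ‖)]
      have h5 := ENNReal.ofReal_le_ofReal h4
      rwa [ENNReal.ofReal_add (by positivity) (by positivity), ENNReal.ofReal_mul zero_le_two,
        ENNReal.ofReal_mul zero_le_two, ENNReal.ofReal_pow (norm_nonneg _),
        ENNReal.ofReal_pow (norm_nonneg _), ENNReal.ofReal_pow (norm_nonneg _), ofReal_norm,
        ofReal_norm, ofReal_norm, ENNReal.ofReal_ofNat] at h5
    calc _ ≤ ENNReal.ofReal (V ξ) * (2 * ‖f ξ‖ₑ ^ 2 + 2 * ‖g ξ‖ₑ ^ 2) := by gcongr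
      _ = _ := by ring
  have ht := ENNReal.toReal_mono (by finiteness) h
  rw [ENNReal.toReal_add (by finiteness) (by finiteness), ENNReal.toReal_mul,
    ENNReal.toReal_mul, ENNReal.toReal_ofNat] at ht
  exact ht

/-- A path of class `C¹` in `L²`, bounded in `H^s`, that satisfies the equation is continuous in
`H^s`. -/
theorem FourierSolution.of_bounded {γ : ℝ → ℝ} (hγ : AdmissibleSymbol γ) {s : ℝ} (hs' : 5 / 2 < s)
    {T K : ℝ} {b : ℝ → HL2} (hmem : ∀ t ∈ Icc 0 T, hs s (b t) < ⊤)
    (hK : ∀ t ∈ Icc 0 T, hn s (b t) ≤ K) (hsol : ∀ t ∈ Icc 0 T, b t ∈ ActiveVector.solenoidal)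
    (hderiv : ∀ t ∈ Icc 0 T, HasDerivWithinAt b (nonlin γ (b t)) (Icc 0 T) t) :
    FourierSolution γ s (Icc 0 T) b := by
  refine ⟨hmem, fun t ht => ?_, hsol, hderiv⟩
  obtain ⟨C, hC0, hC⟩ := exists_energy_deriv_le hγ hs'
  obtain ⟨Cy, hCy0, hCy⟩ := exists_toReal_yn_le hs'
  have hK0 : 0 ≤ K := (hn_nonneg _ _).trans (hK t ht)
  -- The truncated energies are Lipschitz in time with a constant independent of the truncation, so
  -- their limit is too.
  have hlip : ∀ τ ∈ Icc 0 T, |hn s (b τ) ^ 2 - hn s (b t) ^ 2| ≤ C * (Cy * K) * K ^ 2 * |τ - t| := by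
    intro τ hτ
    have hm : ∀ m, |energy s m (b τ) - energy s m (b t)| ≤ C * (Cy * K) * K ^ 2 * |τ - t| := by
      intro m
      refine (convex_Icc 0 T).norm_image_sub_le_of_norm_hasDerivWithin_le
        (fun x hx => hasDerivWithinAt_energy s m (hderiv x hx)) (fun x hx => ?_) ht hτ
      refine (hC m _ (hsol x hx) (hmem x hx)).trans ?_
      have h1 := hn_nonneg s (b x)
      have h2 := (hCy _ (hmem x hx)).2
      have h3 := energy_nonneg s m (b x)
      gcongr
      · exact h2.trans (by gcongr; exact hK x hx)
      · exact (energy_le (hmem x hx) m).trans (by gcongr; exact hK x hx)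
    exact le_of_tendsto (((tendsto_energy (hmem τ hτ)).sub (tendsto_energy (hmem t ht))).abs)
      (Eventually.of_forall hm)
  have hcont : Tendsto (fun τ => hn s (b τ) ^ 2) (𝓝[Icc 0 T] t) (𝓝 (hn s (b t) ^ 2)) := by
    rw [tendsto_iff_dist_tendsto_zero]
    have h0 : Tendsto (fun τ : ℝ => C * (Cy * K) * K ^ 2 * |τ - t|) (𝓝[Icc 0 T] t) (𝓝 0) := by
      have : Continuous fun τ : ℝ => C * (Cy * K) * K ^ 2 * |τ - t| := by fun_prop
      simpa using (this.tendsto t).mono_left nhdsWithin_le_nhds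
    refine squeeze_zero' (Eventually.of_forall fun _ => dist_nonneg) ?_ h0
    filter_upwards [self_mem_nhdsWithin] with τ hτ
    exact hlip τ hτ
  have hbc : Tendsto b (𝓝[Icc 0 T] t) (𝓝 (b t)) := (hderiv t ht).continuousWithinAt
  -- The truncated energy of the difference is small by continuity in `L²`. The rest is at most
  -- twice the high parts of `b τ` and `b t`, and continuity of the norm makes the former close to
  -- the latter, which is small for large `m`.
  have hsq : Tendsto (fun τ => hn s (b τ - b t) ^ 2) (𝓝[Icc 0 T] t) (𝓝 0) := by
    rw [Metric.tendsto_nhds]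
    intro ε hε
    obtain ⟨m, hm⟩ : ∃ m, hn s (b t) ^ 2 - energy s m (b t) < ε / 8 := by
      have h1 := (tendsto_energy (hmem t ht)).eventually_const_lt
        (by linarith : hn s (b t) ^ 2 - ε / 8 < hn s (b t) ^ 2)
      obtain ⟨m, hm⟩ := h1.exists
      exact ⟨m, by linarith⟩
    have h2 : Tendsto (fun τ => (m + 1) * ‖b τ - b t‖ ^ 2
        + (2 * (hn s (b τ) ^ 2 - energy s m (b τ)) + 2 * (hn s (b t) ^ 2 - energy s m (b t))))
        (𝓝[Icc 0 T] t) (𝓝 ((m + 1) * ‖b t - b t‖ ^ 2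
        + (2 * (hn s (b t) ^ 2 - energy s m (b t)) + 2 * (hn s (b t) ^ 2 - energy s m (b t))))) := by
      have h3 := ((continuous_energy s m).tendsto (b t)).comp hbc
      exact (((hbc.sub_const (b t)).norm.pow 2).const_mul _).add
        (((hcont.sub h3).const_mul 2).add_const _)
    have h4 := h2.eventually_lt_const (u := ε) (by
      rw [sub_self, norm_zero]
      linarith)
    filter_upwards [h4, self_mem_nhdsWithin] with τ h5 hτ
    rw [dist_zero_right, Real.norm_of_nonneg (sq_nonneg _)]
    refine lt_of_le_of_lt ?_ h5
    have hd := hs_sub_lt_top (hmem τ hτ) (hmem t ht)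
    have h6 := highEnergy_sub_le (hmem τ hτ) (hmem t ht) m
    rw [highEnergy_eq hd, highEnergy_eq (hmem τ hτ), highEnergy_eq (hmem t ht)] at h6
    have h7 := energy_le_norm_sq s m (b τ - b t)
    linarith
  have h := hsq.sqrt
  rw [Real.sqrt_zero] at h
  exact h.congr fun τ => Real.sqrt_sq (hn_nonneg _ _)

/-! ### Convergence of the Galerkin approximation -/

/-- In `hn_sq_le` the threshold `Λ` is first chosen to make the `H^s` contribution small; then `‖f‖`
beats the fixed factor `Λ ^ σ`. -/
lemma exists_hn_le_of_norm_le {σ s : ℝ} (hσ : 0 ≤ σ) (hσs : σ < s) (K : ℝ) {ε : ℝ} (hε : 0 < ε) :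
    ∃ δ : ℝ, 0 < δ ∧ ∀ f : HL2, hs s f < ⊤ → hn s f ≤ K → ‖f‖ ≤ δ → hn σ f ≤ ε := by
  have h1 : Tendsto (fun Λ : ℝ => Λ ^ (σ - s) * K ^ 2) atTop (𝓝 0) := by
    have := (tendsto_rpow_neg_atTop (sub_pos.2 hσs)).mul_const (K ^ 2)
    rwa [zero_mul, neg_sub] at this
  obtain ⟨Λ, hΛ1, hΛ2⟩ := ((h1.eventually_lt_const (by positivity : 0 < ε ^ 2 / 2)).and
    (eventually_ge_atTop 1)).exists
  have hΛσ : 0 < Λ ^ σ := Real.rpow_pos_of_pos (by linarith) σ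
  refine ⟨√(ε ^ 2 / 2 / Λ ^ σ), by positivity, fun f hf hfK hfδ => ?_⟩
  have h2 := hn_sq_le hσ hσs.le hf hΛ2
  have h3 : Λ ^ σ * ‖f‖ ^ 2 ≤ ε ^ 2 / 2 := by
    have : ‖f‖ ^ 2 ≤ ε ^ 2 / 2 / Λ ^ σ := by
      rw [← Real.sq_sqrt (by positivity : 0 ≤ ε ^ 2 / 2 / Λ ^ σ)]
      gcongr
    rw [le_div_iff₀ hΛσ] at this
    linarith
  have h4 : Λ ^ (σ - s) * hn s f ^ 2 ≤ Λ ^ (σ - s) * K ^ 2 := by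
    have := hn_nonneg s f
    gcongr
  exact le_of_sq_le_sq (by linarith) hε.le

lemma exists_norm_nonlin_sub_le_of_bounded {γ : ℝ → ℝ} (hγ : AdmissibleSymbol γ) {s : ℝ}
    (hs' : 5 / 2 < s) {K : ℝ} (hK : 0 ≤ K) {ε : ℝ} (hε : 0 < ε) :
    ∃ δ : ℝ, 0 < δ ∧ ∀ f g : HL2, hs s f < ⊤ → hs s g < ⊤ → hn s f ≤ K → hn s g ≤ K →
      ‖f - g‖ ≤ δ → ‖nonlin γ f - nonlin γ g‖ ≤ ε := by
  -- Halfway: above `5/2` for the bound on the nonlinearity, below `s` for interpolation.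
  set σ := (s + 5 / 2) / 2 with hσdef
  have hσ : 5 / 2 < σ := by rw [hσdef]; linarith
  have hσs : σ < s := by rw [hσdef]; linarith
  obtain ⟨C, hC0, hC⟩ := exists_norm_nonlin_sub_le hγ hσ
  obtain ⟨δ, hδ, h⟩ := exists_hn_le_of_norm_le (by linarith : 0 ≤ σ) hσs (K + K)
    (by positivity : 0 < ε / (C * (K + K + 1)))
  refine ⟨δ, hδ, fun f g hf hg hfK hgK hfg => ?_⟩
  have hd := hs_sub_lt_top hf hg
  have h1 := h (f - g) hd ((hn_sub_le hf hg).trans (add_le_add hfK hgK)) hfg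
  have h2 := (hn_mono_exponent hσs.le hf).trans hfK
  have h3 := (hn_mono_exponent hσs.le hg).trans hgK
  calc _ ≤ C * (hn σ (f - g) * (hn σ f + hn σ g)) :=
        hC f g ((hs_mono_exponent hσs.le _).trans_lt hf) ((hs_mono_exponent hσs.le _).trans_lt hg)
    _ ≤ C * (ε / (C * (K + K + 1)) * (K + K + 1)) := by
        refine mul_le_mul_of_nonneg_left ?_ hC0.le
        exact mul_le_mul h1 (by linarith) (add_nonneg (hn_nonneg _ _) (hn_nonneg _ _))
          (by positivity)
    _ = ε := by field_simp

/-- Near `t` the derivatives of the `f n` are close to `g' t`, so the mean value inequality for `f n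
x - x • g' t` holds with a bound that survives the limit. -/
lemma hasDerivWithinAt_of_uniform_limit {X : Type*} [NormedAddCommGroup X] [NormedSpace ℝ X]
    {f f' : ℕ → ℝ → X} {g g' : ℝ → X} {T : ℝ}
    (hf : ∀ n, ∀ t ∈ Icc 0 T, HasDerivWithinAt (f n) (f' n t) (Icc 0 T) t)
    (hlim : ∀ t ∈ Icc 0 T, Tendsto (fun n => f n t) atTop (𝓝 (g t)))
    (hf' : ∀ ε > 0, ∀ᶠ n in atTop, ∀ t ∈ Icc 0 T, ‖f' n t - g' t‖ ≤ ε)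
    (hg' : ContinuousOn g' (Icc 0 T)) :
    ∀ t ∈ Icc 0 T, HasDerivWithinAt g (g' t) (Icc 0 T) t := by
  intro t ht
  rw [hasDerivWithinAt_iff_isLittleO, Asymptotics.isLittleO_iff]
  intro ε hε
  obtain ⟨δ, hδ, hball⟩ := Metric.continuousWithinAt_iff.1 (hg' t ht) (ε / 2) (by linarith)
  filter_upwards [inter_mem_nhdsWithin _ (Metric.ball_mem_nhds t hδ)] with τ hτ
  set S := Icc 0 T ∩ Metric.ball t δ with hS
  have htS : t ∈ S := ⟨ht, Metric.mem_ball_self hδ⟩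
  have hSc : Convex ℝ S := (convex_Icc 0 T).inter (convex_ball t δ)
  have key : ∀ᶠ n in atTop, ‖f n τ - f n t - (τ - t) • g' t‖ ≤ ε * ‖τ - t‖ := by
    filter_upwards [hf' (ε / 2) (by linarith)] with n hn
    have h := hSc.norm_image_sub_le_of_norm_hasDerivWithin_le (f := fun x => f n x - x • g' t)
      (f' := fun x => f' n x - (1 : ℝ) • g' t) (C := ε)
      (fun x hx => ((hf n x hx.1).mono inter_subset_left).sub
        ((hasDerivWithinAt_id x S).smul_const (g' t))) (fun x hx => ?_) htS hτ
    · convert h using 2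
      module
    · rw [one_smul]
      have h1 := hn x hx.1
      have h2 := (hball hx.1 hx.2).le
      rw [dist_eq_norm] at h2
      calc ‖f' n x - g' t‖ = ‖(f' n x - g' x) + (g' x - g' t)‖ := by congr 1; abel
        _ ≤ ε / 2 + ε / 2 := (norm_add_le _ _).trans (add_le_add h1 h2)
        _ = ε := by ring
  exact le_of_tendsto (((hlim τ hτ.1).sub (hlim t ht)).sub_const _).norm key

lemma exists_limit_of_cauchy {X : Type*} [NormedAddCommGroup X] [CompleteSpace X]
    {f : ℕ → ℝ → X} {S : Set ℝ} {e : ℕ → ℝ} (he : Tendsto e atTop (𝓝 0))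
    (h : ∀ n m, ∀ t ∈ S, ‖f n t - f m t‖ ^ 2 ≤ e n + e m) :
    ∃ g : ℝ → X, ∀ t ∈ S, (∀ n, ‖f n t - g t‖ ^ 2 ≤ e n) ∧
      Tendsto (fun n => f n t) atTop (𝓝 (g t)) := by
  have hc : ∀ t ∈ S, ∃ x, Tendsto (fun n => f n t) atTop (𝓝 x) := by
    intro t ht
    apply cauchySeq_tendsto_of_complete
    rw [Metric.cauchySeq_iff]
    intro ε hε
    obtain ⟨N, hN⟩ := eventually_atTop.1 (he.eventually_lt_const (by positivity : 0 < ε ^ 2 / 2))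
    refine ⟨N, fun m hm n hn => ?_⟩
    rw [dist_eq_norm]
    apply lt_of_pow_lt_pow_left₀ 2 hε.le
    linarith [h m n t ht, hN m hm, hN n hn]
  choose! g hg using hc
  refine ⟨g, fun t ht => ⟨fun n => ?_, hg t ht⟩⟩
  have h1 : Tendsto (fun m => ‖f n t - f m t‖ ^ 2) atTop (𝓝 (‖f n t - g t‖ ^ 2)) :=
    ((hg t ht).const_sub _).norm.pow 2
  have h2 : Tendsto (fun m => e n + e m) atTop (𝓝 (e n)) := by
    simpa using he.const_add (e n)
  exact le_of_tendsto_of_tendsto' h1 h2 fun m => h n m t ht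

lemma norm_sub_lowPass_le {s : ℝ} (hs0 : 0 ≤ s) {f : HL2} (hf : hs s f < ⊤) (n : ℕ) :
    ‖f - lowPass n f‖ ≤ (1 + n : ℝ) ^ (-(s / 2)) * hn s f := by
  have h0 := hn_nonneg s f
  rw [← ENNReal.ofReal_le_ofReal_iff (by positivity), ENNReal.ofReal_mul (by positivity),
    ofReal_hn hf, ofReal_norm, Lp.enorm_def, hs, ← Real.enorm_of_nonneg (by positivity),
    ← eLpNorm_const_smul]
  apply eLpNorm_mono_ae
  filter_upwards [Lp.coeFn_sub f (lowPass n f), mulOp_coe (bddMul_cut n) f] with ξ h1 h2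
  rw [h1, Pi.sub_apply, h2, Pi.smul_apply, norm_smul, norm_smul,
    Real.norm_of_nonneg (by positivity), Real.norm_of_nonneg (by have := jb_pos ξ; positivity)]
  by_cases hb : ‖ξ‖ ≤ n
  · have : cut n ξ = 1 := by simp [cut, hb]
    rw [this, one_smul, sub_self, norm_zero]
    have := jb_pos ξ
    positivity
  · have : cut n ξ = 0 := by simp [cut, hb]
    rw [this, zero_smul, sub_zero, ← mul_assoc]
    refine le_mul_of_one_le_left (norm_nonneg _) ?_
    rw [Real.rpow_neg (by positivity), ← div_eq_inv_mul, one_le_div (by positivity)]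
    apply Real.rpow_le_rpow (by positivity) _ (by linarith)
    unfold jb
    push Not at hb
    have hpi := Real.pi_gt_three
    have h3 : (n : ℝ) ≤ (n : ℝ) ^ 2 := by exact_mod_cast Nat.le_self_pow two_ne_zero n
    have h4 : (n : ℝ) ≤ 2 * Real.pi * ‖ξ‖ := by nlinarith [norm_nonneg ξ]
    have h5 : (n : ℝ) ^ 2 ≤ (2 * Real.pi * ‖ξ‖) ^ 2 := by gcongr
    linarith

lemma re_inner_sub_add_le (D a r r' : HL2) :
    |2 * (inner ℂ D (a - r + r')).re| ≤ |2 * (inner ℂ D a).re| + 2 * ‖D‖ * (‖r‖ + ‖r'‖) := by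
  have h1 : |(inner ℂ D r).re| ≤ ‖D‖ * ‖r‖ :=
    (Complex.abs_re_le_norm _).trans (norm_inner_le_norm D r)
  have h2 : |(inner ℂ D r').re| ≤ ‖D‖ * ‖r'‖ :=
    (Complex.abs_re_le_norm _).trans (norm_inner_le_norm D r')
  rw [inner_add_right, inner_sub_right, Complex.add_re, Complex.sub_re]
  rw [abs_le] at h1 h2 ⊢
  have h3 := neg_abs_le (2 * (inner ℂ D a).re)
  have h4 := le_abs_self (2 * (inner ℂ D a).re)
  constructor <;> linarith

/-- The two approximations solve the full equation up to the tails of the nonlinearity, which decay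
like `(1+n)^(-marg s)`; Grönwall's inequality propagates the error. -/
lemma exists_galerkin_sub_le {γ : ℝ → ℝ} (hγ : AdmissibleSymbol γ) {s : ℝ} (hs' : 5 / 2 < s)
    {K T : ℝ} (hK : 0 ≤ K) :
    ∃ A : ℝ, 0 < A ∧ ∀ n m x y, IsGalerkin γ s n T K x → IsGalerkin γ s m T K y →
      ∀ t ∈ Icc 0 T, ‖x t - y t‖ ^ 2
        ≤ A * (‖x 0 - y 0‖ ^ 2 + ((1 + n : ℝ) ^ (-marg s) + (1 + m : ℝ) ^ (-marg s))) := by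
  obtain ⟨C, hC0, hC⟩ := exists_norm_sub_sq_deriv_le hγ hs'
  obtain ⟨Ct, hCt0, hCt⟩ := exists_norm_tail_le hγ hs'
  have hs0 : 0 ≤ s := by linarith
  -- The added `1` gives `A ≥ 1`, so the division by `A` in the Grönwall bound can be dropped.
  set A := C * (K + K) + 1 with hA
  have hA1 : 1 ≤ A := by rw [hA]; nlinarith [mul_nonneg hC0.le (add_nonneg hK hK)]
  set L := 2 * (K + K) * (Ct * K ^ 2) with hL
  have hL0 : 0 ≤ L := by positivity
  refine ⟨(1 + L) * Real.exp (A * T), by positivity, fun n m x y hx hy t ht => ?_⟩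
  set δn := (1 + n : ℝ) ^ (-marg s) with hδn
  set δm := (1 + m : ℝ) ^ (-marg s) with hδm
  have hδn0 : 0 < δn := by positivity
  have hδm0 : 0 < δm := by positivity
  have hd : ∀ τ ∈ Icc 0 T, HasDerivWithinAt (fun τ => ‖(x - y) τ‖ ^ 2)
      (2 * (inner ℂ (x τ - y τ) (lowPass n (nonlin γ (x τ)) - lowPass m (nonlin γ (y τ)))).re)
      (Icc 0 T) τ := fun τ hτ =>
    hasDerivWithinAt_norm_sq ((hx τ hτ).2.2.2.sub (hy τ hτ).2.2.2)
  have hbound : ∀ τ ∈ Icc 0 T,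
      |2 * (inner ℂ (x τ - y τ) (lowPass n (nonlin γ (x τ)) - lowPass m (nonlin γ (y τ)))).re|
        ≤ A * ‖x τ - y τ‖ ^ 2 + L * (δn + δm) := by
    intro τ hτ
    obtain ⟨hx1, hx2, hx3, -⟩ := hx τ hτ
    obtain ⟨hy1, hy2, hy3, -⟩ := hy τ hτ
    have e : lowPass n (nonlin γ (x τ)) - lowPass m (nonlin γ (y τ))
        = (nonlin γ (x τ) - nonlin γ (y τ)) - (nonlin γ (x τ) - lowPass n (nonlin γ (x τ)))
          + (nonlin γ (y τ) - lowPass m (nonlin γ (y τ))) := by abel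
    rw [e]
    refine (re_inner_sub_add_le _ _ _ _).trans ?_
    have h1 := hC _ _ (mem_galerkinSpace.1 hx1).1 (mem_galerkinSpace.1 hy1).1 hx2 hy2
    have h2 := hCt n _ hx2
    have h3 := hCt m _ hy2
    have h4 : ‖x τ - y τ‖ ≤ K + K := (norm_sub_le _ _).trans
      (add_le_add ((norm_le_hn hs0 hx2).trans hx3) ((norm_le_hn hs0 hy2).trans hy3))
    have h5 := hn_nonneg s (x τ)
    have h6 := hn_nonneg s (y τ)
    have h7 : C * (hn s (x τ) + hn s (y τ)) * ‖x τ - y τ‖ ^ 2 ≤ C * (K + K) * ‖x τ - y τ‖ ^ 2 := by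
      gcongr
    have h8 : 2 * ‖x τ - y τ‖ * (‖nonlin γ (x τ) - lowPass n (nonlin γ (x τ))‖
          + ‖nonlin γ (y τ) - lowPass m (nonlin γ (y τ))‖)
        ≤ 2 * (K + K) * (δn * (Ct * K ^ 2) + δm * (Ct * K ^ 2)) := by
      gcongr
      · exact h2.trans (by gcongr)
      · exact h3.trans (by gcongr)
    have h9 := sq_nonneg ‖x τ - y τ‖
    calc _ ≤ C * (K + K) * ‖x τ - y τ‖ ^ 2
          + 2 * (K + K) * (δn * (Ct * K ^ 2) + δm * (Ct * K ^ 2)) :=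
          add_le_add (h1.trans h7) h8
      _ = C * (K + K) * ‖x τ - y τ‖ ^ 2 + L * (δn + δm) := by rw [hL]; ring
      _ ≤ _ := by rw [hA]; linarith
  have key := norm_le_gronwallBound_of_norm_deriv_right_le (δ := ‖x 0 - y 0‖ ^ 2) (K := A)
    (ε := L * (δn + δm)) (f := fun τ => ‖(x - y) τ‖ ^ 2) (a := 0) (b := T)
    (fun τ hτ => (hd τ hτ).continuousWithinAt)
    (fun τ hτ => hasDerivWithinAt_Ici hτ (hd τ (Ico_subset_Icc_self hτ))) (by simp)
    (fun τ hτ => by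
      rw [Real.norm_of_nonneg (sq_nonneg ‖(x - y) τ‖)]
      exact hbound τ (Ico_subset_Icc_self hτ)) t ht
  rw [gronwallBound_of_K_ne_0 (by linarith), Real.norm_of_nonneg (sq_nonneg _), Pi.sub_apply,
    sub_zero] at key
  refine key.trans ?_
  have hexp : Real.exp (A * t) ≤ Real.exp (A * T) := Real.exp_le_exp.2 (by gcongr; exact ht.2)
  have hpos : 0 < Real.exp (A * t) := Real.exp_pos _
  have hdiv : L * (δn + δm) / A * (Real.exp (A * t) - 1) ≤ L * (δn + δm) * Real.exp (A * T) := by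
    have h1 : L * (δn + δm) / A ≤ L * (δn + δm) := div_le_self (by positivity) hA1
    have h2 : 0 ≤ L * (δn + δm) / A := by positivity
    calc _ ≤ L * (δn + δm) / A * Real.exp (A * T) := by gcongr; linarith
      _ ≤ _ := by gcongr
  have hfirst : ‖x 0 - y 0‖ ^ 2 * Real.exp (A * t) ≤ ‖x 0 - y 0‖ ^ 2 * Real.exp (A * T) := by gcongr
  calc _ ≤ ‖x 0 - y 0‖ ^ 2 * Real.exp (A * T) + L * (δn + δm) * Real.exp (A * T) :=
        add_le_add hfirst hdiv
    _ ≤ ‖x 0 - y 0‖ ^ 2 * Real.exp (A * T) + L * (δn + δm) * Real.exp (A * T)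
        + (L * ‖x 0 - y 0‖ ^ 2 + (δn + δm)) * Real.exp (A * T) := by
        have : 0 ≤ (L * ‖x 0 - y 0‖ ^ 2 + (δn + δm)) * Real.exp (A * T) := by positivity
        linarith
    _ = _ := by ring

lemma tendsto_one_add_rpow_neg {a : ℝ} (ha : 0 < a) :
    Tendsto (fun n : ℕ => (1 + n : ℝ) ^ (-a)) atTop (𝓝 0) :=
  (tendsto_rpow_neg_atTop ha).comp
    (tendsto_atTop_add_const_left _ 1 tendsto_natCast_atTop_atTop)

/-- Local existence, for a time that depends only on the size of the initial value. -/
theorem exists_fourierSolution {γ : ℝ → ℝ} (hγ : AdmissibleSymbol γ) {s : ℝ} (hs' : 5 / 2 < s)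
    {R : ℝ} (hR : 0 ≤ R) :
    ∃ T : ℝ, 0 < T ∧ ∀ b₀ ∈ solenoidal, hs s b₀ < ⊤ → hn s b₀ ≤ R →
      ∃ b : ℝ → HL2, FourierSolution γ s (Icc 0 T) b ∧ b 0 = b₀ := by
  have hs0 : 0 ≤ s := by linarith
  have hmarg : 0 < marg s := by unfold marg; linarith
  obtain ⟨T, hT, hgal⟩ := exists_galerkin hγ hs' hR
  refine ⟨T, hT, fun b₀ hb₀ hfin hle => ?_⟩
  have hstart : ∀ n, ∃ x : ℝ → HL2, x 0 = lowPass n b₀ ∧ IsGalerkin γ s n T (R + 1) x := fun n =>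
    hgal n _ (lowPass_mem_galerkinSpace hb₀)
      ((ENNReal.toReal_mono hfin.ne (hs_lowPass_le s n b₀)).trans hle)
  choose x hx0 hx using hstart
  have hK0 : 0 ≤ R + 1 := by linarith
  obtain ⟨A, hA0, hA⟩ := exists_galerkin_sub_le hγ hs' (K := R + 1) (T := T) hK0
  set d : ℕ → ℝ := fun n => ‖b₀ - lowPass n b₀‖ with hd
  have hdlim : Tendsto d atTop (𝓝 0) := by
    have h1 := (tendsto_one_add_rpow_neg (by linarith : 0 < s / 2)).mul_const (hn s b₀)
    rw [zero_mul] at h1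
    exact squeeze_zero (fun n => norm_nonneg _) (fun n => norm_sub_lowPass_le hs0 hfin n) h1
  set e : ℕ → ℝ := fun n => A * (2 * d n ^ 2 + (1 + n : ℝ) ^ (-marg s)) with he
  have helim : Tendsto e atTop (𝓝 0) := by
    have h := (((hdlim.pow 2).const_mul 2).add (tendsto_one_add_rpow_neg hmarg)).const_mul A
    simpa using h
  obtain ⟨b, hb⟩ := exists_limit_of_cauchy (f := x) (S := Icc 0 T) helim (fun n m t ht => by
    refine (hA n m _ _ (hx n) (hx m) t ht).trans ?_
    rw [he]
    have h1 : ‖x n 0 - x m 0‖ ^ 2 ≤ 2 * d n ^ 2 + 2 * d m ^ 2 := by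
      have h2 : ‖x n 0 - x m 0‖ ≤ d n + d m := by
        rw [hx0, hx0]
        calc _ = ‖(b₀ - lowPass m b₀) - (b₀ - lowPass n b₀)‖ := by congr 1; abel
          _ ≤ d m + d n := norm_sub_le _ _
          _ = _ := add_comm _ _
      nlinarith [sq_nonneg (d n - d m), norm_nonneg (x n 0 - x m 0)]
    calc _ ≤ A * ((2 * d n ^ 2 + 2 * d m ^ 2)
          + ((1 + n : ℝ) ^ (-marg s) + (1 + m : ℝ) ^ (-marg s))) := by gcongr
      _ = _ := by ring)
  have hsol : ∀ t ∈ Icc 0 T, b t ∈ solenoidal := fun t ht =>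
    isClosed_solenoidal.mem_of_tendsto (hb t ht).2
      (Eventually.of_forall fun n => (mem_galerkinSpace.1 (hx n t ht).1).1)
  -- Convergence holds only in `L²`, but the truncated energies are continuous there, so the `H^s`
  -- bound passes to the limit.
  have hbd : ∀ t ∈ Icc 0 T, hs s (b t) < ⊤ ∧ hn s (b t) ≤ R + 1 := by
    intro t ht
    refine hs_lt_top_of_energy_le hK0 fun m => ?_
    refine le_of_tendsto (((continuous_energy s m).tendsto _).comp (hb t ht).2)
      (Eventually.of_forall fun n => ?_)
    obtain ⟨-, h2, h3, -⟩ := hx n t ht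
    exact (energy_le h2 m).trans (by have := hn_nonneg s (x n t); gcongr)
  have hunif : ∀ δ > 0, ∀ᶠ n in atTop, ∀ t ∈ Icc 0 T, ‖x n t - b t‖ ≤ δ := by
    intro δ hδ
    filter_upwards [helim.eventually_lt_const (by positivity : 0 < δ ^ 2)] with n h t ht
    exact le_of_sq_le_sq (((hb t ht).1 n).trans h.le) hδ.le
  have hbcont : ContinuousOn b (Icc 0 T) := by
    have hu : TendstoUniformlyOn x b atTop (Icc 0 T) := by
      rw [Metric.tendstoUniformlyOn_iff]
      intro ε hε
      filter_upwards [hunif (ε / 2) (by linarith)] with n h t ht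
      rw [dist_comm, dist_eq_norm]
      linarith [h t ht]
    exact hu.continuousOn
      (Frequently.of_forall fun n t ht => (hx n t ht).2.2.2.continuousWithinAt)
  have hNcont : ContinuousOn (fun t => nonlin γ (b t)) (Icc 0 T) := by
    intro t ht
    rw [ContinuousWithinAt, Metric.tendsto_nhds]
    intro ε hε
    obtain ⟨δ, hδ, h⟩ := exists_norm_nonlin_sub_le_of_bounded hγ hs' hK0 (half_pos hε)
    filter_upwards [Metric.tendsto_nhds.1 (hbcont t ht) δ hδ, self_mem_nhdsWithin] with τ h1 hτ
    rw [dist_eq_norm] at h1 ⊢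
    have := h _ _ (hbd τ hτ).1 (hbd t ht).1 (hbd τ hτ).2 (hbd t ht).2 h1.le
    linarith
  obtain ⟨Ct, hCt0, hCt⟩ := exists_norm_tail_le hγ hs'
  have hNunif : ∀ ε > 0, ∀ᶠ n in atTop, ∀ t ∈ Icc 0 T,
      ‖lowPass n (nonlin γ (x n t)) - nonlin γ (b t)‖ ≤ ε := by
    intro ε hε
    obtain ⟨δ, hδ, h⟩ := exists_norm_nonlin_sub_le_of_bounded hγ hs' hK0 (half_pos hε)
    have htail := (tendsto_one_add_rpow_neg hmarg).mul_const (Ct * (R + 1) ^ 2)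
    rw [zero_mul] at htail
    filter_upwards [hunif δ hδ, htail.eventually_lt_const (half_pos hε)] with n h1 h2 t ht
    obtain ⟨-, h4, h5, -⟩ := hx n t ht
    have h6 := h _ _ h4 (hbd t ht).1 h5 (hbd t ht).2 (h1 t ht)
    have h7 : ‖nonlin γ (x n t) - lowPass n (nonlin γ (x n t))‖
        ≤ (1 + n : ℝ) ^ (-marg s) * (Ct * (R + 1) ^ 2) :=
      (hCt n _ h4).trans (by have := hn_nonneg s (x n t); gcongr)
    calc _ = ‖(nonlin γ (x n t) - nonlin γ (b t))
          - (nonlin γ (x n t) - lowPass n (nonlin γ (x n t)))‖ := by congr 1; abel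
      _ ≤ _ := norm_sub_le _ _
      _ ≤ ε := by linarith
  have hderiv := hasDerivWithinAt_of_uniform_limit (fun n t ht => (hx n t ht).2.2.2)
    (fun t ht => (hb t ht).2) hNunif hNcont
  refine ⟨b, FourierSolution.of_bounded hγ hs' (fun t ht => (hbd t ht).1)
    (fun t ht => (hbd t ht).2) hsol hderiv, ?_⟩
  refine tendsto_nhds_unique (hb 0 (left_mem_Icc.2 hT.le)).2 ?_
  simp only [hx0]
  rw [tendsto_iff_norm_sub_tendsto_zero]
  exact hdlim.congr fun n => norm_sub_rev _ _

/-! ### The two notions of solution -/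

/-- The Fourier transform of a test field, in `L²`. -/
noncomputable def testHat {φ : E3 → E3} (hφ : ContDiff ℝ ∞ φ) (hc : HasCompactSupport φ) : HL2 :=
  (𝓕 (testField hφ hc)).toLp 2

lemma inner_testHat {φ : E3 → E3} (hφ : ContDiff ℝ ∞ φ) (hc : HasCompactSupport φ) {v : HL2}
    {f : E3 → C3} (h : v =ᵐ[volume] f) :
    inner ℂ (testHat hφ hc) v = ∫ ξ, inner ℂ (𝓕 (testField hφ hc) ξ) (f ξ) := by
  rw [L2.inner_def]
  apply integral_congr_ae
  filter_upwards [(𝓕 (testField hφ hc)).coeFn_toLp 2, h] with ξ h1 h2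
  rw [testHat, h1, h2]

/-- By Plancherel the pairings are those of the inverse transform with real test fields. The fields
`g • e_j` recover every coordinate of its integral against `g`, and complex values of `v` cause no
difficulty. -/
lemma eq_zero_of_inner_testHat {v : HL2}
    (h : ∀ (φ : E3 → E3) (hφ : ContDiff ℝ ∞ φ) (hc : HasCompactSupport φ),
      inner ℂ (testHat hφ hc) v = 0) : v = 0 := by
  set w : HL2 := 𝓕⁻ v with hw
  have hv : 𝓕 w = v := FourierTransform.fourier_fourierInv_eq v
  have hloc : LocallyIntegrable w := (Lp.memLp w).locallyIntegrable one_le_two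
  have key : ∀ᵐ x, w x = 0 := by
    apply ae_eq_zero_of_integral_contDiff_smul_eq_zero hloc
    intro g hg hgc
    have hfin_int := hloc.integrable_smul_left_of_hasCompactSupport hg.continuous hgc
    ext j
    have hφ : ContDiff ℝ ∞ fun x : E3 => g x • EuclideanSpace.single j (1 : ℝ) :=
      hg.smul contDiff_const
    have hc : HasCompactSupport fun x : E3 => g x • (EuclideanSpace.single j (1 : ℝ) : E3) :=
      hgc.smul_right (f' := fun _ => (EuclideanSpace.single j (1 : ℝ) : E3))
    have h1 := h _ hφ hc
    rw [inner_testHat hφ hc (EventuallyEq.refl _ _), ← hv, ← integral_inner_fourier_L2] at h1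
    have h2 : (∫ x, g x • w x) j = inner ℂ (EuclideanSpace.single j (1 : ℂ)) (∫ x, g x • w x) := by
      rw [EuclideanSpace.inner_single_left]; simp
    rw [h2, ← integral_inner hfin_int, PiLp.zero_apply, ← h1]
    congr 1
    ext1 x
    have h3 : testField hφ hc x = (g x : ℂ) • EuclideanSpace.single j (1 : ℂ) := by
      rw [testField_apply]
      ext i
      by_cases hij : i = j <;> simp [hij]
    rw [h3, inner_smul_left, Complex.conj_ofReal, ← Complex.coe_smul, inner_smul_right]
  have hw0 : w = 0 := by
    ext1
    filter_upwards [key, Lp.coeFn_zero C3 2 (volume : Measure E3)] with x h1 h2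
    rw [h1, h2, Pi.zero_apply]
  rw [← hv, hw0]
  exact map_zero (Lp.fourierTransformₗᵢ E3 C3)

lemma memLp_norm_smul_of_hs {s : ℝ} (hs1 : 1 ≤ s) {f : HL2} (hf : hs s f < ⊤) :
    MemLp (fun ξ => ‖ξ‖ • f ξ) 2 := by
  have h : MemLp (fun ξ => (jb ξ ^ (s / 2)) • f ξ) 2 :=
    ⟨aestronglyMeasurable_jb_smul s (Lp.aestronglyMeasurable f), hf⟩
  refine h.of_le ?_ (ae_of_all _ fun ξ => ?_)
  · exact measurable_norm.aestronglyMeasurable.smul (Lp.aestronglyMeasurable f)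
  · have hj := jb_pos ξ
    rw [norm_smul, norm_smul, norm_norm, Real.norm_of_nonneg (by positivity)]
    gcongr
    have hpi := Real.pi_gt_three
    have h1 : ‖ξ‖ ≤ jb ξ ^ (1 / 2 : ℝ) := by
      rw [← Real.sqrt_eq_rpow]
      apply Real.le_sqrt_of_sq_le
      unfold jb
      have h2 : ‖ξ‖ ≤ 2 * Real.pi * ‖ξ‖ := by nlinarith [norm_nonneg ξ]
      have h3 : ‖ξ‖ ^ 2 ≤ (2 * Real.pi * ‖ξ‖) ^ 2 := by gcongr
      linarith
    exact h1.trans (Real.rpow_le_rpow_of_exponent_le (one_le_jb ξ) (by linarith))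

lemma fourierL2_mem_solenoidal {s : ℝ} (hs1 : 1 ≤ s) {f : L2} (hf : sobolevNorm s f < ⊤)
    (hd : DivFree f) : fourierL2 f ∈ solenoidal := by
  rw [sobolevNorm_eq] at hf
  exact ⟨hermitian_fourierL2 f, fourierDivFree_of_divFree (memLp_norm_smul_of_hs hs1 hf) hd⟩

lemma inner_testHat_fourierL2 {φ : E3 → E3} (hφ : ContDiff ℝ ∞ φ) (hc : HasCompactSupport φ)
    (f : L2) : inner ℂ (testHat hφ hc) (fourierL2 f) = ((∫ x, inner ℝ (f x) (φ x) : ℝ) : ℂ) := by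
  rw [integral_inner_testField f hφ hc, inner_testHat hφ hc (EventuallyEq.refl _ _)]

lemma inner_testHat_nonlin {γ : ℝ → ℝ} (hγ : AdmissibleSymbol γ) {s : ℝ} (hs' : 5 / 2 < s)
    {φ : E3 → E3} (hφ : ContDiff ℝ ∞ φ) (hc : HasCompactSupport φ) {f : L2}
    (hf : hs s (fourierL2 f) < ⊤) :
    inner ℂ (testHat hφ hc) (nonlin γ (fourierL2 f))
      = ((-∫ x, inner ℝ (cross (curlGamma γ f x) (f x)) (curl φ x) : ℝ) : ℂ) := by
  have hm := measurable_coe_HL2 (fourierL2 f)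
  rw [neg_integral_inner_curl γ (integrable_kmul hγ hs' hm hf) (integrable_of_hs hs' hm hf) hφ hc,
    inner_testHat hφ hc (nonlin_coe hγ hs' hf)]

lemma tendsto_sobolevNorm_iff {s : ℝ} {I : Set ℝ} {B : ℝ → L2}
    (hmem : ∀ t ∈ I, hs s (fourierL2 (B t)) < ⊤) {t : ℝ} (ht : t ∈ I) :
    Tendsto (fun τ => sobolevNorm s (B τ - B t)) (𝓝[I] t) (𝓝 0)
      ↔ Tendsto (fun τ => hn s (fourierL2 (B τ) - fourierL2 (B t))) (𝓝[I] t) (𝓝 0) := by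
  have h : ∀ τ ∈ I, hs s (fourierL2 (B τ) - fourierL2 (B t) : HL2) ≠ ⊤ := fun τ hτ =>
    (hs_sub_lt_top (hmem τ hτ) (hmem t ht)).ne
  simp only [sobolevNorm_eq, fourierL2_sub]
  constructor
  · intro h1
    have := (ENNReal.tendsto_toReal ENNReal.zero_ne_top).comp h1
    rw [ENNReal.toReal_zero] at this
    exact this
  · intro h1
    have h2 := ENNReal.tendsto_ofReal h1
    rw [ENNReal.ofReal_zero] at h2
    refine h2.congr' ?_
    filter_upwards [self_mem_nhdsWithin] with τ hτ
    exact ENNReal.ofReal_toReal (h τ hτ)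

lemma continuousOn_nonlin_of_hs {γ : ℝ → ℝ} (hγ : AdmissibleSymbol γ) {s : ℝ}
    (hs' : 5 / 2 < s) {I : Set ℝ} {b : ℝ → HL2} (hmem : ∀ t ∈ I, hs s (b t) < ⊤)
    (hcont : ∀ t ∈ I, Tendsto (fun τ => hn s (b τ - b t)) (𝓝[I] t) (𝓝 0)) :
    ContinuousOn (fun t => nonlin γ (b t)) I := by
  obtain ⟨C, hC0, hC⟩ := exists_norm_nonlin_sub_le hγ hs'
  intro t ht
  rw [ContinuousWithinAt, tendsto_iff_norm_sub_tendsto_zero]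
  have h1 := ((hcont t ht).mul ((hcont t ht).const_add (2 * hn s (b t)))).const_mul C
  rw [zero_mul, mul_zero] at h1
  refine squeeze_zero' (Eventually.of_forall fun _ => norm_nonneg _) ?_ h1
  filter_upwards [self_mem_nhdsWithin] with τ hτ
  refine (hC _ _ (hmem τ hτ) (hmem t ht)).trans ?_
  have h2 := hn_le_add_hn_sub (hmem τ hτ) (hmem t ht)
  refine mul_le_mul_of_nonneg_left (mul_le_mul_of_nonneg_left ?_ (hn_nonneg _ _)) hC0.le
  linarith

/-- Weak differentiability becomes strong because the nonlinearity is continuous in time with values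
in `L²`: `b` must coincide with the primitive of `nonlin γ (b ·)`, as their difference has constant
pairing with every test field. -/
theorem IsSolutionOn.fourierSolution {γ : ℝ → ℝ} (hγ : AdmissibleSymbol γ) {s : ℝ}
    (hs' : 5 / 2 < s) {T : ℝ} (hT : 0 ≤ T) {B : ℝ → L2} (h : IsSolutionOn γ s (Icc 0 T) B) :
    FourierSolution γ s (Icc 0 T) fun t => fourierL2 (B t) := by
  have hmem : ∀ t ∈ Icc 0 T, hs s (fourierL2 (B t)) < ⊤ := fun t ht => by
    rw [← sobolevNorm_eq]; exact h.memHs t ht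
  have hcont := fun t ht => (tendsto_sobolevNorm_iff hmem ht).1 (h.continuousHs t ht)
  refine ⟨hmem, hcont, fun t ht =>
    fourierL2_mem_solenoidal (by linarith) (h.memHs t ht) (h.divFree t ht), ?_⟩
  have hNc := continuousOn_nonlin_of_hs hγ hs' hmem hcont
  set b : ℝ → HL2 := fun t => fourierL2 (B t) with hb
  set N : ℝ → HL2 := IccExtend hT ((Icc 0 T).domRestrict fun t => nonlin γ (b t)) with hN
  have hNcont : Continuous N := (continuousOn_iff_continuous_domRestrict.1 hNc).Icc_extend'
  have hNv : ∀ t ∈ Icc 0 T, N t = nonlin γ (b t) := fun t ht => by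
    rw [hN, IccExtend_of_mem _ _ ht, domRestrict_apply]
  set G : ℝ → HL2 := fun t => b 0 + ∫ τ in 0..t, N τ with hG
  have hGd : ∀ t, HasDerivAt G (N t) t := fun t =>
    (intervalIntegral.integral_hasDerivAt_right (hNcont.intervalIntegrable _ _)
      (hNcont.stronglyMeasurableAtFilter _ _) hNcont.continuousAt).const_add _
  have heq : ∀ t ∈ Icc 0 T, b t = G t := by
    intro t ht
    rw [← sub_eq_zero]
    apply eq_zero_of_inner_testHat
    intro φ hφ hc
    have hd : ∀ τ ∈ Icc 0 T,
        HasDerivWithinAt (fun τ => inner ℂ (testHat hφ hc) (b τ - G τ)) 0 (Icc 0 T) τ := by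
      intro τ hτ
      have h1 := (Complex.ofRealCLM.hasFDerivAt).comp_hasDerivWithinAt τ (h.equation φ hφ hc τ hτ)
      have h2 := (hasDerivWithinAt_const τ (Icc 0 T) (testHat hφ hc)).inner ℂ
        (hGd τ).hasDerivWithinAt
      have h3 := h1.sub h2
      refine (h3.congr_deriv ?_).congr_of_mem (fun x _ => ?_) hτ
      · rw [inner_zero_left, add_zero, Complex.ofRealCLM_apply,
          ← inner_testHat_nonlin hγ hs' hφ hc (hmem τ hτ), hNv τ hτ, sub_self]
      · rw [inner_sub_right, Pi.sub_apply, Function.comp_apply, Complex.ofRealCLM_apply,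
          ← inner_testHat_fourierL2]
    have h0 := constant_of_has_deriv_right_zero (f := fun τ => inner ℂ (testHat hφ hc) (b τ - G τ))
      (a := 0) (b := T) (fun τ hτ => (hd τ hτ).continuousWithinAt)
      (fun τ hτ => hasDerivWithinAt_Ici hτ (hd τ (Ico_subset_Icc_self hτ))) t ht
    rw [h0]
    simp [hG]
  intro t ht
  rw [← hNv t ht]
  exact (hGd t).hasDerivWithinAt.congr_of_mem heq ht

theorem FourierSolution.isSolutionOn {γ : ℝ → ℝ} (hγ : AdmissibleSymbol γ) {s : ℝ}
    (hs' : 5 / 2 < s) {I : Set ℝ} {B : ℝ → L2}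
    (h : FourierSolution γ s I fun t => fourierL2 (B t)) : IsSolutionOn γ s I B where
  memHs t ht := by rw [sobolevNorm_eq]; exact h.memHs t ht
  continuousHs t ht := (tendsto_sobolevNorm_iff h.memHs ht).2 (h.continuousHs t ht)
  divFree t ht := divFree_of_fourierDivFree (h.solenoidal t ht).2
  equation φ hφ hc t ht := by
    have h1 := (hasDerivWithinAt_const t I (testHat hφ hc)).inner ℂ (h.hasDeriv t ht)
    have h2 := (Complex.reCLM.hasFDerivAt).comp_hasDerivWithinAt t h1
    refine (h2.congr_deriv ?_).congr_of_mem (fun x _ => ?_) ht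
    · rw [inner_zero_left, add_zero, inner_testHat_nonlin hγ hs' hφ hc (h.memHs t ht),
        Complex.reCLM_apply, Complex.ofReal_re]
    · rw [Function.comp_apply, inner_testHat_fourierL2, Complex.reCLM_apply, Complex.ofReal_re]

/-! ### Translation and gluing of solutions -/

lemma tendsto_nhdsWithin_of_notMem {α : Type*} {f : ℝ → α} {l : Filter α} {J : Set ℝ}
    (hJ : IsClosed J) {t : ℝ} (ht : t ∉ J) : Tendsto f (𝓝[J] t) l := by
  have h : 𝓝[J] t = ⊥ := by
    rwa [← notMem_closure_iff_nhdsWithin_eq_bot, hJ.closure_eq]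
  rw [h]
  exact tendsto_bot

/-- Closedness makes the conditions relative to one set void at points outside it; at a common point
the one-sided statements combine, since both derivatives equal `nonlin γ (b t)`. -/
lemma FourierSolution.union {γ : ℝ → ℝ} {s : ℝ} {I J : Set ℝ} (hI : IsClosed I) (hJ : IsClosed J)
    {b : ℝ → HL2} (h : FourierSolution γ s I b) (h' : FourierSolution γ s J b) :
    FourierSolution γ s (I ∪ J) b where
  memHs t ht := ht.elim (h.memHs t) (h'.memHs t)
  solenoidal t ht := ht.elim (h.solenoidal t) (h'.solenoidal t)
  continuousHs t ht := by
    rw [nhdsWithin_union]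
    refine Tendsto.sup ?_ ?_
    · by_cases hI' : t ∈ I
      · exact h.continuousHs t hI'
      · exact tendsto_nhdsWithin_of_notMem hI hI'
    · by_cases hJ' : t ∈ J
      · exact h'.continuousHs t hJ'
      · exact tendsto_nhdsWithin_of_notMem hJ hJ'
  hasDeriv t ht := by
    refine HasDerivWithinAt.union ?_ ?_
    · by_cases hI' : t ∈ I
      · exact h.hasDeriv t hI'
      · exact HasFDerivWithinAt.of_notMem_closure (by rwa [hI.closure_eq])
    · by_cases hJ' : t ∈ J
      · exact h'.hasDeriv t hJ'
      · exact HasFDerivWithinAt.of_notMem_closure (by rwa [hJ.closure_eq])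

lemma FourierSolution.congr {γ : ℝ → ℝ} {s : ℝ} {I : Set ℝ} {b c : ℝ → HL2}
    (h : FourierSolution γ s I b) (hbc : EqOn c b I) : FourierSolution γ s I c where
  memHs t ht := by rw [hbc ht]; exact h.memHs t ht
  solenoidal t ht := by rw [hbc ht]; exact h.solenoidal t ht
  continuousHs t ht := by
    refine (h.continuousHs t ht).congr' ?_
    filter_upwards [self_mem_nhdsWithin] with τ hτ
    rw [hbc hτ, hbc ht]
  hasDeriv t ht := by
    rw [hbc ht]
    exact (h.hasDeriv t ht).congr_of_mem hbc ht

lemma FourierSolution.translate {γ : ℝ → ℝ} {s : ℝ} {I J : Set ℝ} {b : ℝ → HL2} (a : ℝ)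
    (h : FourierSolution γ s I b) (hJ : MapsTo (fun t => t - a) J I) :
    FourierSolution γ s J fun t => b (t - a) where
  memHs t ht := h.memHs _ (hJ ht)
  solenoidal t ht := h.solenoidal _ (hJ ht)
  continuousHs t ht := by
    refine (h.continuousHs _ (hJ ht)).comp (f := fun t => t - a) ?_
    exact tendsto_nhdsWithin_of_tendsto_nhds_of_eventually_within _
      (((continuous_sub_right a).tendsto t).mono_left nhdsWithin_le_nhds)
      (by filter_upwards [self_mem_nhdsWithin] with τ hτ using hJ hτ)
  hasDeriv t ht := by
    have h1 := (h.hasDeriv _ (hJ ht)).scomp t ((hasDerivWithinAt_id t J).sub_const a) hJ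
    rwa [one_smul] at h1

/-- A solution on `[0, T)` that is bounded in `H^s` can be continued. -/
theorem exists_continuation {γ : ℝ → ℝ} (hγ : AdmissibleSymbol γ) {s : ℝ} (hs' : 5 / 2 < s)
    {T : ℝ} (hT : 0 < T) {b : ℝ → HL2} (hb : ∀ t ∈ Ico 0 T, FourierSolution γ s (Icc 0 t) b)
    {R : ℝ} (hR : 0 ≤ R) (hbR : ∀ t ∈ Ico 0 T, hn s (b t) ≤ R) :
    ∃ T', T < T' ∧ ∃ b' : ℝ → HL2, FourierSolution γ s (Icc 0 T') b' ∧ EqOn b' b (Ico 0 T) := by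
  obtain ⟨T₀, hT₀, hex⟩ := exists_fourierSolution hγ hs' hR
  -- The restart takes place less than one lifespan `T₀` before `T`; the maximum with `0` covers the
  -- case of a long lifespan.
  set t₁ := max 0 (T - T₀ / 2) with ht₁
  have ht₁m : t₁ ∈ Ico 0 T := ⟨le_max_left _ _, max_lt hT (by linarith)⟩
  have hlt : T < t₁ + T₀ := by linarith [le_max_right 0 (T - T₀ / 2)]
  have h1 := hb t₁ ht₁m
  have ht₁I : t₁ ∈ Icc 0 t₁ := right_mem_Icc.2 ht₁m.1
  obtain ⟨c, hc, hc0⟩ := hex (b t₁) (h1.solenoidal _ ht₁I) (h1.memHs _ ht₁I) (hbR t₁ ht₁m)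
  set b' : ℝ → HL2 := fun t => if t ≤ t₁ then b t else c (t - t₁) with hb'
  have e1 : EqOn b' b (Icc 0 t₁) := fun t ht => if_pos ht.2
  have e2 : EqOn b' (fun t => c (t - t₁)) (Icc t₁ (t₁ + T₀)) := fun t ht => by
    rcases ht.1.eq_or_lt with h | h
    · rw [hb', ← h]; simp [hc0]
    · exact if_neg (not_le.2 h)
  have hsecond : FourierSolution γ s (Icc t₁ (t₁ + T₀)) b' :=
    (hc.translate t₁ (fun t ht => ⟨by linarith [ht.1], by linarith [ht.2]⟩)).congr e2
  have hglue := (h1.congr e1).union isClosed_Icc isClosed_Icc hsecond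
  rw [Icc_union_Icc_eq_Icc ht₁m.1 (by linarith)] at hglue
  refine ⟨t₁ + T₀, hlt, b', hglue, fun t ht => ?_⟩
  -- Beyond `t₁` the glued path is a different solution a priori; uniqueness identifies it with `b`
  -- up to `T`.
  have h2 : FourierSolution γ s (Icc 0 t) b' :=
    hglue.mono (Icc_subset_Icc_right (by linarith [ht.2]))
  exact FourierSolution.eqOn hγ hs' h2 (hb t ht) (e1 (left_mem_Icc.2 ht₁m.1)) (right_mem_Icc.2 ht.1)

lemma FourierSolution.exists_field {γ : ℝ → ℝ} {s : ℝ} {I : Set ℝ} {b : ℝ → HL2}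
    (h : FourierSolution γ s I b) : ∃ B : ℝ → L2, ∀ t ∈ I, fourierL2 (B t) = b t := by
  have : ∀ t ∈ I, ∃ f : L2, fourierL2 f = b t := fun t ht =>
    exists_fourierL2_eq (h.solenoidal t ht).1
  choose! B hB using this
  exact ⟨B, hB⟩

lemma IsSolutionOn.mono_of_Ico {γ : ℝ → ℝ} {s T : ℝ} {B : ℝ → L2}
    (h : IsSolutionOn γ s (Ico 0 T) B) {t : ℝ} (ht : t < T) : IsSolutionOn γ s (Icc 0 t) B where
  memHs τ hτ := h.memHs τ (Icc_subset_Ico_right ht hτ)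
  continuousHs τ hτ := (h.continuousHs τ (Icc_subset_Ico_right ht hτ)).mono_left
    (nhdsWithin_mono _ (Icc_subset_Ico_right ht))
  divFree τ hτ := h.divFree τ (Icc_subset_Ico_right ht hτ)
  equation φ hφ hc τ hτ := (h.equation φ hφ hc τ (Icc_subset_Ico_right ht hτ)).mono
    (Icc_subset_Ico_right ht)

/-- The `𝒴¹` norm of a bounded solution is integrable in time. -/
lemma lintegral_yn_lt_top {s : ℝ} (hs' : 5 / 2 < s) {T R : ℝ} {b : ℝ → HL2}
    (hmem : ∀ t ∈ Ioo 0 T, hs s (b t) < ⊤) (hR : ∀ t ∈ Ioo 0 T, hn s (b t) ≤ R) :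
    ∫⁻ t in Ioo 0 T, yn (b t) < ⊤ := by
  obtain ⟨C, hC0, hC⟩ := exists_toReal_yn_le hs'
  refine lt_of_le_of_lt (setLIntegral_mono (g := fun _ => ENNReal.ofReal (C * R)) measurable_const
    fun t ht => ?_) ?_
  · obtain ⟨h1, h2⟩ := hC _ (hmem t ht)
    rw [← ENNReal.ofReal_toReal h1.ne]
    apply ENNReal.ofReal_le_ofReal
    exact h2.trans (by gcongr; exact hR t ht)
  · rw [setLIntegral_const, Real.volume_Ioo]
    exact ENNReal.mul_lt_top ENNReal.ofReal_lt_top ENNReal.ofReal_lt_top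

/-- The norm of `H^s` is bounded as long as the time integral of the `𝒴¹` norm is. -/
lemma exists_hn_le_of_lintegral_lt_top {γ : ℝ → ℝ} (hγ : AdmissibleSymbol γ) {s : ℝ}
    (hs' : 5 / 2 < s) {T : ℝ} {b : ℝ → HL2} (hb : ∀ t ∈ Ico 0 T, FourierSolution γ s (Icc 0 t) b)
    (hfin_int : ∫⁻ t in Ioo 0 T, yn (b t) < ⊤) : ∃ R, 0 ≤ R ∧ ∀ t ∈ Ico 0 T, hn s (b t) ≤ R := by
  obtain ⟨C, hC0, hC⟩ := exists_hn_sq_le_exp hγ hs'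
  set K := (∫⁻ t in Ioo 0 T, yn (b t)).toReal with hK
  refine ⟨√(hn s (b 0) ^ 2 * Real.exp (C * K)), Real.sqrt_nonneg _, fun t ht => ?_⟩
  apply Real.le_sqrt_of_sq_le
  refine hC t ht.1 b (hb t ht) K ENNReal.toReal_nonneg ?_
  rw [ENNReal.ofReal_toReal hfin_int.ne]
  exact lintegral_mono_set (Ioo_subset_Ioo_right ht.2.le)

/-- A bound near the final time gives a bound on the whole interval. -/
lemma exists_hn_le_of_limsup_lt_top {γ : ℝ → ℝ} {s T : ℝ} (hT : 0 < T) {b : ℝ → HL2}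
    (hb : ∀ t ∈ Ico 0 T, FourierSolution γ s (Icc 0 t) b)
    (hlim : limsup (fun t => hs s (b t)) (𝓝[<] T) < ⊤) :
    ∃ R, ∀ t ∈ Ico 0 T, hn s (b t) ≤ R := by
  obtain ⟨r, hr1, hr2⟩ := exists_between hlim
  have h1 := eventually_lt_of_limsup_lt hr1
  obtain ⟨a, ha, h2⟩ := (mem_nhdsLT_iff_exists_Ioo_subset' hT).1 h1
  have ha' : max a 0 ∈ Ico 0 T := ⟨le_max_right _ _, max_lt ha hT⟩
  obtain ⟨K, -, hK⟩ := (hb _ ha').exists_hn_le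
  refine ⟨max K r.toReal, fun t ht => ?_⟩
  rcases le_or_gt t (max a 0) with h | h
  · exact (hK t ⟨ht.1, h⟩).trans (le_max_left _ _)
  · refine le_trans ?_ (le_max_right _ _)
    exact ENNReal.toReal_mono hr2.ne (h2 ⟨(le_max_left _ _).trans_lt h, ht.2⟩ : _ < r).le

end ActiveVector

theorem theoremA (γ : ℝ → ℝ) (hγ : AdmissibleSymbol γ) (s : ℝ) (hs : 5 / 2 < s) :
    -- local well-posedness: existence, and uniqueness on every common interval
    (∀ B₀ : L2, sobolevNorm s B₀ < ⊤ → DivFree B₀ →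
      (∃ T : ℝ, 0 < T ∧ ∃ B : ℝ → L2, IsSolutionOn γ s (Icc 0 T) B ∧ B 0 = B₀) ∧
      (∀ T : ℝ, 0 < T → ∀ B B' : ℝ → L2,
        IsSolutionOn γ s (Icc 0 T) B → B 0 = B₀ →
        IsSolutionOn γ s (Icc 0 T) B' → B' 0 = B₀ → EqOn B B' (Icc 0 T))) ∧
    -- blow-up criterion, and continuation past `T`
    (∀ T : ℝ, 0 < T → ∀ B : ℝ → L2, IsSolutionOn γ s (Ico 0 T) B →
      (limsup (fun t => sobolevNorm s (B t)) (𝓝[<] T) = ⊤ ↔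
        (∫⁻ t in Ioo 0 T, yNorm (B t)) = ⊤) ∧
      ((∃ T' : ℝ, T < T' ∧ ∃ B' : ℝ → L2,
          IsSolutionOn γ s (Icc 0 T') B' ∧ EqOn B' B (Ico 0 T)) ↔
        (∫⁻ t in Ioo 0 T, yNorm (B t)) < ⊤)) := by
  have hs0 : 1 ≤ s := by linarith
  refine ⟨fun B₀ hB₀ hdiv => ⟨?_, fun T hT B B' hB hB0 hB' hB'0 t ht => ?_⟩, fun T hT B hB => ?_⟩
  · have hsol := fourierL2_mem_solenoidal hs0 hB₀ hdiv
    rw [sobolevNorm_eq] at hB₀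
    obtain ⟨T, hT, h⟩ := exists_fourierSolution hγ hs (hn_nonneg s (fourierL2 B₀))
    obtain ⟨b, hb, hb0⟩ := h _ hsol hB₀ le_rfl
    obtain ⟨B, hB⟩ := hb.exists_field
    refine ⟨T, hT, B, FourierSolution.isSolutionOn hγ hs (hb.congr hB), ?_⟩
    apply fourierL2_injective
    rw [hB 0 (left_mem_Icc.2 hT.le), hb0]
  · apply fourierL2_injective
    exact FourierSolution.eqOn hγ hs (hB.fourierSolution hγ hs hT.le)
      (hB'.fourierSolution hγ hs hT.le) (by rw [hB0, hB'0]) ht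
  · have hb : ∀ t ∈ Ico 0 T, FourierSolution γ s (Icc 0 t) fun t => fourierL2 (B t) :=
      fun t ht => (hB.mono_of_Ico ht.2).fourierSolution hγ hs ht.1
    have hmem : ∀ t ∈ Ico 0 T, ActiveVector.hs s (fourierL2 (B t)) < ⊤ := fun t ht =>
      (hb t ht).memHs t (right_mem_Icc.2 ht.1)
    have hbdd : (∫⁻ t in Ioo 0 T, yNorm (B t)) < ⊤ →
        ∃ R, 0 ≤ R ∧ ∀ t ∈ Ico 0 T, hn s (fourierL2 (B t)) ≤ R :=
      exists_hn_le_of_lintegral_lt_top hγ hs hb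
    have hfin_int : ∀ R, (∀ t ∈ Ico 0 T, hn s (fourierL2 (B t)) ≤ R) →
        (∫⁻ t in Ioo 0 T, yNorm (B t)) < ⊤ := fun R hR =>
      lintegral_yn_lt_top hs (fun t ht => hmem t (Ioo_subset_Ico_self ht))
        fun t ht => hR t (Ioo_subset_Ico_self ht)
    refine ⟨?_, fun ⟨T', hT', B', hB', heq⟩ => ?_, fun h => ?_⟩
    -- Finiteness of either side amounts to a bound of the `H^s` norm on all of `[0, T)`.
    · rw [← not_iff_not, ← ne_eq, ← ne_eq, ← lt_top_iff_ne_top, ← lt_top_iff_ne_top]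
      simp only [sobolevNorm_eq]
      refine ⟨fun h => ?_, fun h => ?_⟩
      · obtain ⟨R, hR⟩ := exists_hn_le_of_limsup_lt_top hT hb h
        exact hfin_int R hR
      · obtain ⟨R, hR0, hR⟩ := hbdd h
        refine lt_of_le_of_lt (limsup_le_of_le (a := ENNReal.ofReal R) (by isBoundedDefault) ?_)
          ENNReal.ofReal_lt_top
        filter_upwards [Ioo_mem_nhdsLT hT] with t ht
        have ht' := Ioo_subset_Ico_self ht
        rw [← ofReal_hn (hmem t ht')]
        exact ENNReal.ofReal_le_ofReal (hR t ht')
    -- A continuation is bounded in `H^s` on the compact interval `[0, T']`, hence `B` is bounded on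
    -- `[0, T)`.
    · obtain ⟨K, -, hK⟩ := (hB'.fourierSolution hγ hs (hT.trans hT').le).exists_hn_le
      refine hfin_int K fun t ht => ?_
      rw [← heq ht]
      exact hK t ⟨ht.1, (ht.2.trans hT').le⟩
    · obtain ⟨R, hR0, hR⟩ := hbdd h
      obtain ⟨T', hT', b', hb', heq⟩ := exists_continuation hγ hs hT hb hR0 hR
      obtain ⟨B', hB'⟩ := hb'.exists_field
      refine ⟨T', hT', B', FourierSolution.isSolutionOn hγ hs (hb'.congr hB'), fun t ht => ?_⟩
      apply fourierL2_injective
      rw [hB' t ⟨ht.1, (ht.2.trans hT').le⟩, heq ht]
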